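/- Setting. Let $(\mathcal S,\mathcal A,r,P,\rho,\gamma)$ be an infinite-horizon discounted MDP with measurable state space $\mathcal S$, finite action space $\mathcal A$, measurable rewards $r(s,a)\in[0,1]$, transition kernel $P$, fixed initial state $\rho\in\mathcal S$ and $\gamma\in(0,1)$. For a stationary randomized policy $\pi$ let $V_\pi$, $Q_\pi$ be its value functions, and $V^*=\sup_\pi V_\pi$. Let $\phi:\mathcal S\times\mathcal A\to\mathbb R^d$, $d\ge 1$, be a (measurable) feature map with $\|\phi(s,a)\|_2\le 1$. For $b>0$ and $\varepsilon\ge 0$, call $Q_\pi$ $\varepsilon$-realizable if for every policy $\pi$ there is $w_\pi\in\mathbb R^d$ with $\|w_\pi\|_2\le b$ and $|Q_\pi(s,a)-w_\pi^\top\phi(s,a)|\le\varepsilon$ for all $(s,a)$. A query of the simulator at $(s,a)$ returns $r(s,a)$ and a fresh sample $s'\sim P(\cdot|s,a)$. Algorithm (Confident MC-LSPI, with parameters $\tau,\lambda>0$, $n,K,m\in\mathbb N$ and an arbitrary initial policy $\pi_0$). It keeps a list $C$ of state-action pairs (core set). Let $\Phi_C$ be the matrix whose rows are the features of the elements of $C$;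 a vector $\varphi$ is *good* if $\varphi^\top(\Phi_C^\top\Phi_C+\lambda I)^{-1}\varphi\le\tau$. Initially, going through the actions $a$, it adds $(\rho,a)$ to $C$ if $C$ is empty or $\phi(\rho,a)$ is not good. Then it starts policy iteration: for $k=1,\dots,K$, for each $z\in C$, it computes $q_z$ as the average of the returns $\sum_{t=0}^n\gamma^t r(s_t,a_t)$ of $m$ rollouts with $\pi_{k-1}$ from $z=(s_0,a_0)$; at each state $s_t$, $1\le t\le n$, it first checks the actions in order, and at the first action $a$ for which $\phi(s_t,a)$ is not good it adds $(s_t,a)$ to $C$ and restarts policy iteration from $\pi_0$. After all rollouts of iteration $k$, it sets $w_k=(\Phi_C^\top\Phi_C+\lambda I)^{-1}\Phi_C^\top q_C$ and lets $\pi_k$ be the greedy policy $\pi_k(s)=\arg\max_a w_k^\top\phi(s,a)$ (ties to the first action). It stops after iteration $K$ and outputs $\pi_{K-1}$. The query cost is the number of simulator calls; the computational cost is the number of arithmetic operations, comparisons, loop steps and simulator calls, where one evaluation of $\phi$ costs $p(d)$ for a given polynomial $p$, and one sample from $\pi_0(\cdot|s)$ costs $|\mathcal A|$. The values of $n,K,m$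 below are rounded up to natural numbers (the rounded $K$ is used in $m$). Theorem. Let $\delta\in(0,1)$. (1) Assume exact realizability ($\varepsilon=0$) with weight bound $b>0$. Let $\kappa\in(0,1]$, $\tau=1$, $\lambda=\frac{\kappa^2(1-\gamma)^4}{1024b^2}$, $n=\frac{3}{1-\gamma}\log\frac{4(1+\log(1+\lambda^{-1})d)}{\kappa(1-\gamma)}$, $K=2+\frac{2}{1-\gamma}\log\frac{3}{\kappa(1-\gamma)}$, $m=4096\frac{d(1+\log(1+\lambda^{-1}))}{\kappa^2(1-\gamma)^6}\log\frac{8Kd(1+\log(1+\lambda^{-1}))}{\delta}$. Then Confident MC-LSPI always terminates, and with probability at least $1-\delta$ its output satisfies $V^*(\rho)-V_{\pi_{K-1}}(\rho)\le\kappa$. Its query cost is always bounded by a polynomial in $d,\frac1{1-\gamma},\frac1\kappa,\log\frac1\delta,\log b$, and its computational cost by a polynomial in these quantities and $|\mathcal A|$; the polynomials are universal (the second depends only on $p$). (2) Assume $\varepsilon$-realizability with $\varepsilon>0$ and weight bound $b>0$. Let $\tau=1$, $\lambda=\frac{\varepsilon^2d}{b^2}$, $n=\frac1{1-\gamma}\log\frac1{\varepsilon(1-\gamma)}$,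 $K=2+\frac1{1-\gamma}\log\frac1{\varepsilon\sqrt d}$, $m=\frac1{\varepsilon^2(1-\gamma)^2}\log\frac{8Kd(1+\log(1+\lambda^{-1}))}{\delta}$ (where negative values of $n$ and $K$ are replaced by $0$, $m$ is $0$ if $K=0$, and $\pi_0$ is the output if $K\le 1$). Then Confident MC-LSPI always terminates, and with probability at least $1-\delta$ its output satisfies $$V^*(\rho)-V_{\pi_{K-1}}(\rho)\le\frac{74\,\varepsilon\sqrt d}{(1-\gamma)^2}\bigl(1+\log(1+b^2\varepsilon^{-2}d^{-1})\bigr).$$ Its query cost is always bounded by a universal polynomial in $d,\frac1{1-\gamma},\frac1\varepsilon,\log\frac1\delta,\log b$, and its computational cost by a polynomial (depending only on $p$) in these quantities and $|\mathcal A|$. -/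

import Mathlib

open MeasureTheory ProbabilityTheory
open scoped ENNReal Matrix

noncomputable section

namespace MCLSPI

universe u v w w'

/-! ## Discounted Markov decision processes -/

/-- An infinite-horizon discounted MDP with rewards in `[0, 1]`, a fixed initial state `ρ` and
discount factor `γ ∈ (0, 1)`, on a measurable state space `S` and an action space `A`. -/
structure MDP (S : Type u) (A : Type v) [MeasurableSpace S] [MeasurableSpace A] where
  P : Kernel (S × A) S
  markov : IsMarkovKernel P
  r : S × A → ℝ
  measurable_r : Measurable r
  r_nonneg : ∀ x, 0 ≤ r x
  r_le_one : ∀ x, r x ≤ 1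
  ρ : S
  γ : ℝ
  γ_pos : 0 < γ
  γ_lt_one : γ < 1

/-- A stationary (possibly randomized) policy. -/
structure Policy (S : Type u) (A : Type v) [MeasurableSpace S] [MeasurableSpace A] where
  act : Kernel S A
  markov : IsMarkovKernel act

attribute [instance] MDP.markov Policy.markov

section Values

variable {S : Type u} {A : Type v} [MeasurableSpace S] [MeasurableSpace A]

/-- One step of the state-action chain under `π`: from `(s, a)`, draw `s' ∼ P(· | s, a)` and then
`a' ∼ π(· | s')`. -/
def stepKernel (M : MDP S A) (π : Policy S A) : Kernel (S × A) (S × A) :=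
  M.P ⊗ₖ Kernel.prodMkLeft (S × A) π.act

instance (M : MDP S A) (π : Policy S A) : IsMarkovKernel (stepKernel M π) := by
  unfold stepKernel; infer_instance

/-- The same transition, as a kernel from histories of length `n + 1` (it only looks at the last
state-action pair). -/
def historyKernel (M : MDP S A) (π : Policy S A) (n : ℕ) :
    Kernel ((_ : Finset.Iic n) → S × A) (S × A) :=
  (stepKernel M π).comap (fun h => h ⟨n, Finset.mem_Iic.2 le_rfl⟩) (measurable_pi_apply _)

instance (M : MDP S A) (π : Policy S A) (n : ℕ) : IsMarkovKernel (historyKernel M π n) := by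
  unfold historyKernel; infer_instance

/-- Law of the trajectory `(s₀, a₀), (s₁, a₁), …` under `π` when `(s₀, a₀) ∼ μ`. -/
def trajLaw (M : MDP S A) (π : Policy S A) (μ : Measure (S × A)) [IsProbabilityMeasure μ] :
    Measure (ℕ → S × A) :=
  Kernel.trajMeasure (X := fun _ => S × A) μ (historyKernel M π)

/-- The discounted return of a trajectory. -/
def discountedReturn (M : MDP S A) (ω : ℕ → S × A) : ℝ := ∑' t, M.γ ^ t * M.r (ω t)

/-- The state-action value function `Q_π(s, a)`. -/
def qValue (M : MDP S A) (π : Policy S A) (s : S) (a : A) : ℝ :=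
  ∫ ω, discountedReturn M ω ∂(trajLaw M π (Measure.dirac (s, a)))

/-- The law of `(s, a)` with `a ∼ π(· | s)`. -/
def startLaw (π : Policy S A) (s : S) : Measure (S × A) := (π.act s).map (Prod.mk s)

instance (π : Policy S A) (s : S) : IsProbabilityMeasure (startLaw π s) :=
  Measure.isProbabilityMeasure_map measurable_prodMk_left.aemeasurable

/-- The value function `V_π(s)`. -/
def value (M : MDP S A) (π : Policy S A) (s : S) : ℝ :=
  ∫ ω, discountedReturn M ω ∂(trajLaw M π (startLaw π s))

/-- The optimal value `V*(s)` over all stationary policies (all values lie in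
`[0, 1 / (1 - γ)]`). -/
def optValue (M : MDP S A) (s : S) : ℝ := ⨆ π : Policy S A, value M π s

end Values

/-! ## Linear features -/

/-- A feature map, measurable in the state. -/
structure Features (S : Type u) (A : Type v) (d : ℕ) [MeasurableSpace S] where
  φ : S → A → EuclideanSpace ℝ (Fin d)
  measurable_φ : ∀ a, Measurable fun s => φ s a

section Features

variable {S : Type u} {A : Type v} {d : ℕ} [MeasurableSpace S] [MeasurableSpace A]

/-- `Q_π`-realizability up to an additive error `ε` with weights of norm at most `b`;
`ε = 0` is exact realizability. -/
def Realizable (M : MDP S A) (F : Features S A d) (b ε : ℝ) : Prop :=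
  ∀ π : Policy S A, ∃ wt : EuclideanSpace ℝ (Fin d), ‖wt‖ ≤ b ∧
    ∀ s a, |qValue M π s a - inner ℝ wt (F.φ s a)| ≤ ε

lemma maximizers_nonempty {A : Type v} [Fintype A] [Nonempty A] (f : A → ℝ) :
    (Finset.univ.filter fun a => ∀ a', f a' ≤ f a).Nonempty := by
  obtain ⟨a, -, h⟩ := Finset.exists_max_image Finset.univ f Finset.univ_nonempty
  exact ⟨a, by simpa using h⟩

variable [Fintype A] [LinearOrder A] [Nonempty A]

/-- `argmax`, ties broken in favour of the first action. -/
def greedyAction (f : A → ℝ) : A :=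
  (Finset.univ.filter fun a => ∀ a', f a' ≤ f a).min' (maximizers_nonempty f)

lemma greedyAction_eq_iff {A : Type v} [Fintype A] [LinearOrder A] [Nonempty A] (f : A → ℝ) (a : A) :
    greedyAction f = a ↔
      (∀ a', f a' ≤ f a) ∧ ∀ c, (∀ a', f a' ≤ f c) → a ≤ c := by
  constructor
  · rintro rfl
    refine ⟨?_, fun c hc => Finset.min'_le _ _ (by simpa using hc)⟩
    exact (Finset.mem_filter.1 (Finset.min'_mem _ (maximizers_nonempty f))).2
  · rintro ⟨h1, h2⟩
    refine le_antisymm (Finset.min'_le _ _ (by simpa using h1)) (h2 _ ?_)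
    exact (Finset.mem_filter.1 (Finset.min'_mem _ (maximizers_nonempty f))).2

/-- The action that is greedy for the linear function `wᵀ φ(s, ·)`. -/
def linearGreedy (F : Features S A d) (wt : Fin d → ℝ) (s : S) : A :=
  greedyAction fun a => ∑ i, wt i * F.φ s a i

lemma measurable_linearGreedy [MeasurableSingletonClass A] (F : Features S A d)
    (wt : Fin d → ℝ) : Measurable (linearGreedy F wt) := by
  have hf : ∀ a, Measurable fun s => ∑ i, wt i * F.φ s a i := fun a =>
    Finset.measurable_sum _ fun i _ => (((EuclideanSpace.proj (𝕜 := ℝ) i).continuous.measurable).comp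
      (F.measurable_φ a)).const_mul (wt i)
  refine measurable_to_countable' fun a => ?_
  have : linearGreedy F wt ⁻¹' {a} =
      (⋂ a', {s | ∑ i, wt i * F.φ s a' i ≤ ∑ i, wt i * F.φ s a i}) ∩
        ⋂ c, (⋂ a', {s | ∑ i, wt i * F.φ s a' i ≤ ∑ i, wt i * F.φ s c i})ᶜ ∪ {_s | a ≤ c} := by
    ext s
    simp only [Set.mem_preimage, Set.mem_singleton_iff, linearGreedy, greedyAction_eq_iff]
    simp only [Set.mem_inter_iff, Set.mem_iInter, Set.mem_union, Set.mem_compl_iff,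
      Set.mem_ofPred_eq]
    refine and_congr_right fun _ => forall_congr' fun c => imp_iff_not_or
  rw [this]
  have hm : ∀ c, MeasurableSet
      (⋂ a', {s | ∑ i, wt i * F.φ s a' i ≤ ∑ i, wt i * F.φ s c i}) := fun c =>
    MeasurableSet.iInter fun a' => measurableSet_le (hf a') (hf c)
  exact (hm a).inter (MeasurableSet.iInter fun c => (hm c).compl.union (MeasurableSet.const _))

/-- The deterministic policy `π(a | s) = 1(a = argmax_{a'} wᵀ φ(s, a'))`. -/
def greedyPolicy [MeasurableSingletonClass A] (F : Features S A d) (wt : Fin d → ℝ) :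
    Policy S A where
  act := Kernel.deterministic (linearGreedy F wt) (measurable_linearGreedy F wt)
  markov := inferInstance

end Features

/-! ## Programs with access to a simulator, with a count of queries and of operations

A program is a tree whose nodes are the elementary operations of a real-number machine. A program
sees the MDP, the features and the initial policy only through the answers that it gets at the
nodes `query`, `feature` and `draw`. -/

/-- The arithmetic operations. -/
inductive ArithOp
  | add
  | sub
  | mul
  | div

def ArithOp.eval : ArithOp → ℝ → ℝ → ℝ
  | .add, x, y => x + y
  | .sub, x, y => x - y
  | .mul, x, y => x * y
  | .div, x, y => x / y

/-- Programs returning a value in `α`.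
* `tick`: one step of control (an iteration of a loop);
* `arith`: one arithmetic operation;
* `less`: the comparison `x < y`;
* `feature s a`: computes `φ(s, a)`;
* `draw s`: samples an action from `π₀(· | s)`, with `π₀` the initial policy;
* `query s a`: calls the simulator, which answers with a next state and a reward. -/
inductive Prog (S : Type u) (A : Type v) (d : ℕ) (α : Type w) : Type (max u v w)
  | ret (x : α) : Prog S A d α
  | tick (p : Prog S A d α) : Prog S A d α
  | arith (o : ArithOp) (x y : ℝ) (k : ℝ → Prog S A d α) : Prog S A d α
  | less (x y : ℝ) (k : Bool → Prog S A d α) : Prog S A d α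
  | feature (s : S) (a : A) (k : (Fin d → ℝ) → Prog S A d α) : Prog S A d α
  | draw (s : S) (k : A → Prog S A d α) : Prog S A d α
  | query (s : S) (a : A) (k : S → ℝ → Prog S A d α) : Prog S A d α

namespace Prog

variable {S : Type u} {A : Type v} {d : ℕ} {α : Type w} {β : Type w'}

/-- Sequential composition. -/
def bind : Prog S A d α → (α → Prog S A d β) → Prog S A d β
  | ret x, f => f x
  | tick p, f => tick (p.bind f)
  | arith o x y k, f => arith o x y fun z => (k z).bind f
  | less x y k, f => less x y fun z => (k z).bind f
  | feature s a k, f => feature s a fun z => (k z).bind f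
  | draw s k, f => draw s fun z => (k z).bind f
  | query s a k, f => query s a fun s' r => (k s' r).bind f

/-- A single arithmetic operation. -/
def op (o : ArithOp) (x y : ℝ) : Prog S A d ℝ := arith o x y ret

/-- `for i in l do acc ← f acc i`. -/
def loop {ι : Type w'} (f : α → ι → Prog S A d α) : List ι → α → Prog S A d α
  | [], acc => ret acc
  | i :: l, acc => tick ((f acc i).bind fun acc' => loop f l acc')

/-- Computes a vector, entry by entry. -/
def tabulate : (n : ℕ) → (Fin n → Prog S A d α) → Prog S A d (Fin n → α)
  | 0, _ => ret Fin.elim0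
  | n + 1, f => tick ((f 0).bind fun x =>
      (tabulate n fun i => f i.succ).bind fun xs => ret (Fin.cons x xs))

section Semantics

variable [MeasurableSpace S] [MeasurableSpace A]

/-- The probability that the program returns a value in `E`, when each query `(s, a)` is answered
by a fresh sample `s' ∼ P(· | s, a)` and by the reward `r(s, a)`, and each draw at `s` by a fresh
sample from `π₀(· | s)`. -/
def prob (M : MDP S A) (F : Features S A d) (π₀ : Policy S A) (E : Set α) :
    Prog S A d α → ℝ≥0∞
  | ret x => E.indicator 1 x
  | tick p => prob M F π₀ E p
  | arith o x y k => prob M F π₀ E (k (o.eval x y))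
  | less x y k => prob M F π₀ E (k (decide (x < y)))
  | feature s a k => prob M F π₀ E (k fun i => F.φ s a i)
  | draw s k => ∫⁻ a, prob M F π₀ E (k a) ∂(π₀.act s)
  | query s a k => ∫⁻ s', prob M F π₀ E (k s' (M.r (s, a))) ∂(M.P (s, a))

/-- `Run M F cφ p x q c`: for some answers of the simulator and of the draws, the program `p`
returns `x` after `q` simulator queries and `c` operations. Ticks, arithmetic operations,
comparisons and queries cost one operation each, a feature vector costs `cφ` operations, and a
sample from the initial policy costs one operation for each action. -/
inductive Run [Fintype A] (M : MDP S A) (F : Features S A d) (cφ : ℕ) :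
    Prog S A d α → α → ℕ → ℕ → Prop
  | ret (x : α) : Run M F cφ (ret x) x 0 0
  | tick {p x q c} : Run M F cφ p x q c → Run M F cφ (tick p) x q (c + 1)
  | arith {o y z k x q c} : Run M F cφ (k (ArithOp.eval o y z)) x q c →
      Run M F cφ (arith o y z k) x q (c + 1)
  | less {y z k x q c} : Run M F cφ (k (decide (y < z))) x q c →
      Run M F cφ (less y z k) x q (c + 1)
  | feature {s a k x q c} : Run M F cφ (k fun i => F.φ s a i) x q c →
      Run M F cφ (feature s a k) x q (c + cφ)
  | draw {s k x q c} (a : A) : Run M F cφ (k a) x q c →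
      Run M F cφ (draw s k) x q (c + Fintype.card A)
  | query {s a k x q c} (s' : S) : Run M F cφ (k s' (M.r (s, a))) x q c →
      Run M F cφ (query s a k) x (q + 1) (c + 1)

end Semantics

/-! ### Linear algebra -/

/-- The dot product. -/
def dot (x y : Fin d → ℝ) : Prog S A d ℝ :=
  loop (fun acc i => (op .mul (x i) (y i)).bind fun p => op .add acc p) (List.finRange d) 0

/-- The product of a matrix and a vector. -/
def mulVec (X : Matrix (Fin d) (Fin d) ℝ) (x : Fin d → ℝ) : Prog S A d (Fin d → ℝ) :=
  tabulate d fun i => dot (X i) x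

/-- The quadratic form `xᵀ X x`. -/
def quadForm (X : Matrix (Fin d) (Fin d) ℝ) (x : Fin d → ℝ) : Prog S A d ℝ :=
  (mulVec X x).bind fun y => dot x y

/-- From `X = G⁻¹` computes `(G + x xᵀ)⁻¹ = X - (X x) (X x)ᵀ / (1 + xᵀ X x)`, for symmetric `X`. -/
def rankOneUpdate (X : Matrix (Fin d) (Fin d) ℝ) (x : Fin d → ℝ) :
    Prog S A d (Matrix (Fin d) (Fin d) ℝ) :=
  (mulVec X x).bind fun y =>
  (dot x y).bind fun t =>
  (op .add 1 t).bind fun c =>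
  tabulate d fun i => tabulate d fun j =>
    (op .mul (y i) (y j)).bind fun p =>
    (op .div p c).bind fun p' => op .sub (X i j) p'

end Prog

/-! ## The algorithm -/

/-- An element `(s, a, φ(s, a))` of the core set. -/
structure CoreElt (S : Type u) (A : Type v) (d : ℕ) where
  s : S
  a : A
  φ : Fin d → ℝ

/-- The rollout policies of the algorithm: the initial policy `π₀`, or the greedy policy of a
weight vector. -/
inductive PolicyCode (d : ℕ)
  | init
  | greedy (wt : Fin d → ℝ)

/-- The policy described by a code. -/
def PolicyCode.toPolicy {S : Type u} {A : Type v} {d : ℕ} [MeasurableSpace S] [MeasurableSpace A]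
    [Fintype A] [LinearOrder A] [Nonempty A] [MeasurableSingletonClass A]
    (F : Features S A d) (π₀ : Policy S A) : PolicyCode d → Policy S A
  | .init => π₀
  | .greedy wt => greedyPolicy F wt

/-- The parameters: number `K` of iterations, length `n` of the rollouts, number `m` of rollouts,
regularization `lam`, threshold `tau`, discount `γ`. -/
structure Params where
  K : ℕ
  n : ℕ
  m : ℕ
  lam : ℝ
  tau : ℝ
  γ : ℝ

section Algorithm

open Prog

variable {S : Type u} {A : Type v} {d : ℕ}

/-- Computes `(Φ_Cᵀ Φ_C + λ I)⁻¹`, with the features of the elements of `C` as the rows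
of `Φ_C`. -/
def invGram (lam : ℝ) (C : List (CoreElt S A d)) : Prog S A d (Matrix (Fin d) (Fin d) ℝ) :=
  (tabulate d fun i => tabulate d fun j =>
    if i = j then op .div 1 lam else tick (ret 0)).bind fun X =>
  loop (fun X z => rankOneUpdate X z.φ) C X

/-- Looks for the first action `a` in the list with `φ(s, a)` outside the good set
`{φ | φᵀ X φ ≤ τ}`, where `X = (Φ_Cᵀ Φ_C + λ I)⁻¹`. -/
def findUncertain (tau : ℝ) (X : Matrix (Fin d) (Fin d) ℝ) (s : S) :
    List A → Prog S A d (Option (CoreElt S A d))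
  | [] => ret none
  | a :: l => tick (feature s a fun f => (quadForm X f).bind fun t =>
      less tau t fun bad => if bad then ret (some ⟨s, a, f⟩) else findUncertain tau X s l)

variable [Fintype A] [LinearOrder A]

/-- All the actions, in increasing order. -/
def actions (A : Type v) [Fintype A] [LinearOrder A] : List A :=
  (Finset.univ : Finset A).sort (· ≤ ·)

/-- Initialization: go through the actions `a`, and add `(ρ, a)` to the core set when the core set
is empty or `φ(ρ, a)` is outside its good set. -/
def initCore (par : Params) (ρ : S) : Prog S A d (List (CoreElt S A d)) :=
  loop (fun C a => feature ρ a fun f =>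
    if C.isEmpty then ret [⟨ρ, a, f⟩]
    else (invGram par.lam C).bind fun X => (quadForm X f).bind fun t =>
      less par.tau t fun bad => if bad then ret (C ++ [⟨ρ, a, f⟩]) else ret C)
    (actions A) []

variable [Nonempty A]

/-- Computes `argmax_a wᵀ φ(s, a)`, ties broken in favour of the first action. -/
def argmaxLinear (wt : Fin d → ℝ) (s : S) : Prog S A d A :=
  let a₀ : A := Finset.univ.min' Finset.univ_nonempty
  feature s a₀ fun f₀ => (dot wt f₀).bind fun v₀ =>
  (loop (fun (best : A × ℝ) a => feature s a fun f => (dot wt f).bind fun v' =>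
    less best.2 v' fun better => if better then ret (a, v') else ret best)
    (actions A) (a₀, v₀)).bind fun best => ret best.1

/-- Chooses an action in state `s`. -/
def chooseAction : PolicyCode d → S → Prog S A d A
  | .init, s => draw s ret
  | .greedy wt, s => argmaxLinear wt s

/-- The steps `t = n + 1 - j, …, n` of a single rollout, from the state `s = s_t`, with
`g = γ ^ t` and `acc = ∑_{i < t} γ ^ i r_i`. It stops with an uncertain state-action pair as soon
as it meets one, and else returns the discounted return up to time `n`. -/
def rolloutSteps (par : Params) (X : Matrix (Fin d) (Fin d) ℝ) (pol : PolicyCode d) :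
    (j : ℕ) → S → (g acc : ℝ) → Prog S A d (CoreElt S A d ⊕ ℝ)
  | 0, _, _, acc => ret (.inr acc)
  | j + 1, s, g, acc => tick <|
      (findUncertain par.tau X s (actions A)).bind fun
        | some z => ret (.inl z)
        | none =>
          (chooseAction pol s).bind fun a =>
          query s a fun s' r =>
          (op .mul g r).bind fun x =>
          (op .add acc x).bind fun acc' =>
          (op .mul g par.γ).bind fun g' =>
          rolloutSteps par X pol j s' g' acc'

/-- `j` rollouts from `(s₀, a₀)`; `total` is the sum of the previous returns. -/
def rollouts (par : Params) (X : Matrix (Fin d) (Fin d) ℝ) (pol : PolicyCode d) (s₀ : S) (a₀ : A) :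
    (j : ℕ) → (total : ℝ) → Prog S A d (CoreElt S A d ⊕ ℝ)
  | 0, total => ret (.inr total)
  | j + 1, total => tick <|
      query s₀ a₀ fun s₁ r₀ =>
      (rolloutSteps par X pol par.n s₁ par.γ r₀).bind fun
        | .inl z => ret (.inl z)
        | .inr y => (op .add total y).bind fun total' =>
            rollouts par X pol s₀ a₀ j total'

/-- The subroutine ConfidentRollout: `inl z` is the status "uncertain" with the new
element `z`, and `inr q` is the status "done" with the average return `q`. -/
def confidentRollout (par : Params) (X : Matrix (Fin d) (Fin d) ℝ) (pol : PolicyCode d)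
    (s₀ : S) (a₀ : A) : Prog S A d (CoreElt S A d ⊕ ℝ) :=
  (rollouts par X pol s₀ a₀ par.m 0).bind fun
    | .inl z => ret (.inl z)
    | .inr total => (op .div total par.m).bind fun q => ret (.inr q)

/-- Runs ConfidentRollout from all elements of a list and accumulates `Φᵀ q` on top of `y`. -/
def evalCore (par : Params) (X : Matrix (Fin d) (Fin d) ℝ) (pol : PolicyCode d) :
    List (CoreElt S A d) → (y : Fin d → ℝ) → Prog S A d (CoreElt S A d ⊕ (Fin d → ℝ))
  | [], y => ret (.inr y)
  | z :: l, y => tick <|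
      (confidentRollout par X pol z.s z.a).bind fun
        | .inl z' => ret (.inl z')
        | .inr q =>
          (tabulate d fun i => (op .mul q (z.φ i)).bind fun x => op .add (y i) x).bind fun y' =>
          evalCore par X pol l y'

/-- `j` iterations of policy iteration with a fixed core set `C`. Here `cur` is the current rollout
policy `π_{k-1}`, and `prev` is the one of the previous iteration. In each iteration the next
policy is greedy for `w_k = (Φ_Cᵀ Φ_C + λ I)⁻¹ Φ_Cᵀ q_C`. After `K` iterations `prev` is `π_{K-1}`. -/
def policyIteration (par : Params) (C : List (CoreElt S A d)) (X : Matrix (Fin d) (Fin d) ℝ) :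
    (j : ℕ) → (prev cur : PolicyCode d) → Prog S A d (CoreElt S A d ⊕ PolicyCode d)
  | 0, prev, _ => ret (.inr prev)
  | j + 1, _, cur => tick <|
      (evalCore par X cur C fun _ => 0).bind fun
        | .inl z => ret (.inl z)
        | .inr y => (mulVec X y).bind fun wt =>
            policyIteration par C X j cur (.greedy wt)

/-- The loops of the algorithm: policy iteration is started with core set `C`, and restarted with
a larger core set whenever a rollout reports an uncertain pair. The number `N` caps the number of
loops; `none` means that the cap has been reached before the algorithm returned. -/
def mainLoop (par : Params) : (N : ℕ) → List (CoreElt S A d) → Prog S A d (Option (PolicyCode d))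
  | 0, _ => ret none
  | N + 1, C => tick <|
      (invGram par.lam C).bind fun X =>
      (policyIteration par C X par.K .init .init).bind fun
        | .inl z => mainLoop par N (C ++ [z])
        | .inr pol => ret (some pol)

/-- Confident MC-LSPI from the initial state `ρ`, cut off after `N` loops. Its output is
(a code of) the policy `π_{K-1}`. -/
def confidentMCLSPI (par : Params) (ρ : S) (N : ℕ) : Prog S A d (Option (PolicyCode d)) :=
  (initCore par ρ).bind fun C => mainLoop par N C

end Algorithm

/-! ## The numerical subroutines compute what they should -/

section Correctness

open Prog

variable {S : Type u} {A : Type v} {d : ℕ} {α : Type w} {β : Type w'} [MeasurableSpace S]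
  [MeasurableSpace A] [Fintype A] {M : MDP S A} {F : Features S A d} {cφ : ℕ}

lemma Prog.run_bind {p : Prog S A d α} {f : α → Prog S A d β} {y : β} {q c : ℕ}
    (h : Run M F cφ (p.bind f) y q c) :
    ∃ x q₁ c₁ q₂ c₂, Run M F cφ p x q₁ c₁ ∧ Run M F cφ (f x) y q₂ c₂ ∧
      q = q₁ + q₂ ∧ c = c₁ + c₂ := by
  induction p generalizing q c with
  | ret x => exact ⟨x, 0, 0, q, c, .ret x, h, by omega, by omega⟩
  | tick p ih =>
    cases h with
    | tick h =>
      obtain ⟨x, q₁, c₁, q₂, c₂, h1, h2, rfl, rfl⟩ := ih h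
      exact ⟨x, q₁, c₁ + 1, q₂, c₂, .tick h1, h2, rfl, by omega⟩
  | arith o a b k ih =>
    cases h with
    | arith h =>
      obtain ⟨x, q₁, c₁, q₂, c₂, h1, h2, rfl, rfl⟩ := ih _ h
      exact ⟨x, q₁, c₁ + 1, q₂, c₂, .arith h1, h2, rfl, by omega⟩
  | less a b k ih =>
    cases h with
    | less h =>
      obtain ⟨x, q₁, c₁, q₂, c₂, h1, h2, rfl, rfl⟩ := ih _ h
      exact ⟨x, q₁, c₁ + 1, q₂, c₂, .less h1, h2, rfl, by omega⟩
  | feature s a k ih =>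
    cases h with
    | feature h =>
      obtain ⟨x, q₁, c₁, q₂, c₂, h1, h2, rfl, rfl⟩ := ih _ h
      exact ⟨x, q₁, c₁ + cφ, q₂, c₂, .feature h1, h2, rfl, by omega⟩
  | draw s k ih =>
    cases h with
    | draw a h =>
      obtain ⟨x, q₁, c₁, q₂, c₂, h1, h2, rfl, rfl⟩ := ih _ h
      exact ⟨x, q₁, c₁ + Fintype.card A, q₂, c₂, .draw a h1, h2, rfl, by omega⟩
  | query s a k ih =>
    cases h with
    | query s' h =>
      obtain ⟨x, q₁, c₁, q₂, c₂, h1, h2, rfl, rfl⟩ := ih _ _ h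
      exact ⟨x, q₁ + 1, c₁ + 1, q₂, c₂, .query s' h1, h2, by omega, by omega⟩

lemma Prog.run_op {o : ArithOp} {a b z : ℝ} {q c : ℕ}
    (h : Run M F cφ (op o a b) z q c) : z = o.eval a b := by
  cases h with
  | arith h => cases h; rfl

lemma Prog.run_loop {ι : Type w'} {f : α → ι → Prog S A d α} {g : α → ι → α}
    (hf : ∀ a i z q c, Run M F cφ (f a i) z q c → z = g a i) (l : List ι) (a z : α) (q c : ℕ)
    (h : Run M F cφ (loop f l a) z q c) : z = l.foldl g a := by
  induction l generalizing a q c with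
  | nil => cases h; rfl
  | cons i l ih =>
    cases h with
    | tick h =>
      obtain ⟨x, _, _, _, _, h1, h2, -, -⟩ := run_bind h
      obtain rfl := hf _ _ _ _ _ h1
      exact ih _ _ _ h2

lemma Prog.run_tabulate (n : ℕ) (f : Fin n → Prog S A d α) (g : Fin n → α)
    (hf : ∀ i z q c, Run M F cφ (f i) z q c → z = g i) (z : Fin n → α) (q c : ℕ)
    (h : Run M F cφ (tabulate n f) z q c) : z = g := by
  induction n generalizing q c with
  | zero => exact Subsingleton.elim _ _
  | succ n ih =>
    cases h with
    | tick h =>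
      obtain ⟨x, _, _, _, _, h1, h2, -, -⟩ := run_bind h
      obtain ⟨y, _, _, _, _, h3, h4, -, -⟩ := run_bind h2
      obtain rfl := hf _ _ _ _ h1
      obtain rfl := ih _ _ (fun i => hf i.succ) _ _ _ h3
      cases h4
      exact Fin.cons_self_tail g

lemma Prog.run_dot {x y : Fin d → ℝ} {z : ℝ} {q c : ℕ}
    (h : Run M F cφ (dot x y) z q c) : z = x ⬝ᵥ y := by
  have := run_loop (g := fun acc i => acc + x i * y i) (fun a i z q c h => by
    obtain ⟨_, _, _, _, _, h1, h2, -, -⟩ := run_bind h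
    obtain rfl := run_op h1
    exact run_op h2) _ _ _ _ _ h
  rw [this, dotProduct, ← List.sum_ofFn, List.ofFn_eq_map, ← List.foldl_map
    (f := fun i => x i * y i) (g := fun a b : ℝ => a + b), List.sum_eq_foldl]

lemma Prog.run_mulVec {X : Matrix (Fin d) (Fin d) ℝ} {x z : Fin d → ℝ} {q c : ℕ}
    (h : Run M F cφ (mulVec X x) z q c) : z = X *ᵥ x :=
  run_tabulate _ _ _ (fun _ _ _ _ h => run_dot h) _ _ _ h

lemma Prog.run_quadForm {X : Matrix (Fin d) (Fin d) ℝ} {x : Fin d → ℝ} {z : ℝ} {q c : ℕ}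
    (h : Run M F cφ (quadForm X x) z q c) : z = x ⬝ᵥ X *ᵥ x := by
  obtain ⟨_, _, _, _, _, h1, h2, -, -⟩ := run_bind h
  obtain rfl := run_mulVec h1
  exact run_dot h2

lemma Prog.run_rankOneUpdate {X Z : Matrix (Fin d) (Fin d) ℝ} {x : Fin d → ℝ} {q c : ℕ}
    (h : Run M F cφ (rankOneUpdate X x) Z q c) :
    Z = X - (1 + x ⬝ᵥ X *ᵥ x)⁻¹ • Matrix.vecMulVec (X *ᵥ x) (X *ᵥ x) := by
  obtain ⟨_, _, _, _, _, h1, h, -, -⟩ := run_bind h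
  obtain ⟨_, _, _, _, _, h2, h, -, -⟩ := run_bind h
  obtain ⟨_, _, _, _, _, h3, h, -, -⟩ := run_bind h
  obtain rfl := run_mulVec h1
  obtain rfl := run_dot h2
  obtain rfl := run_op h3
  refine run_tabulate _ _ _ (fun i z q c h => run_tabulate _ _ _ (fun j z q c h => ?_) _ _ _ h)
    _ _ _ h
  obtain ⟨_, _, _, _, _, h1, h, -, -⟩ := run_bind h
  obtain ⟨_, _, _, _, _, h2, h, -, -⟩ := run_bind h
  obtain rfl := run_op h1
  obtain rfl := run_op h2
  obtain rfl := run_op h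
  simp [ArithOp.eval, Matrix.vecMulVec_apply, div_eq_inv_mul]

/-- The feature matrix `Φ_C`, with the features of the elements of `C` as its rows. -/
def featureMatrix {S : Type u} {A : Type v} (C : List (CoreElt S A d)) :
    Matrix (Fin C.length) (Fin d) ℝ :=
  Matrix.of fun k => C[k].φ

lemma gram_eq {S : Type u} {A : Type v} (C : List (CoreElt S A d)) :
    (featureMatrix C)ᵀ * featureMatrix C = (C.map fun z => Matrix.vecMulVec z.φ z.φ).sum := by
  rw [← Fin.sum_univ_fun_getElem]
  ext i j
  simp [Matrix.mul_apply, Matrix.sum_apply, Matrix.vecMulVec_apply, featureMatrix]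

lemma rankOne_inv {G : Matrix (Fin d) (Fin d) ℝ} (hG : G.PosDef) (x : Fin d → ℝ) :
    (G + Matrix.vecMulVec x x).PosDef ∧
    G⁻¹ - (1 + x ⬝ᵥ G⁻¹ *ᵥ x)⁻¹ • Matrix.vecMulVec (G⁻¹ *ᵥ x) (G⁻¹ *ᵥ x) =
      (G + Matrix.vecMulVec x x)⁻¹ := by
  have hps : (Matrix.vecMulVec x x).PosSemidef := by
    simpa using Matrix.posSemidef_vecMulVec_self_star x
  refine ⟨hG.add_posSemidef hps, (Matrix.inv_eq_right_inv ?_).symm⟩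
  have hu : IsUnit G.det := hG.det_pos.ne'.isUnit
  have hpos : 0 ≤ x ⬝ᵥ G⁻¹ *ᵥ x := by simpa using hG.inv.posSemidef.dotProduct_mulVec_nonneg x
  have hne : (1 + x ⬝ᵥ G⁻¹ *ᵥ x) ≠ 0 := by positivity
  have hsymm : x ᵥ* G⁻¹ = G⁻¹ *ᵥ x := by
    have : (G⁻¹)ᵀ = G⁻¹ := by simpa using hG.inv.isHermitian.eq
    rw [← Matrix.vecMul_transpose, this]
  have h1 : G * Matrix.vecMulVec (G⁻¹ *ᵥ x) (G⁻¹ *ᵥ x) = Matrix.vecMulVec x (G⁻¹ *ᵥ x) := by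
    rw [Matrix.mul_vecMulVec, Matrix.mulVec_mulVec, Matrix.mul_nonsing_inv _ hu,
      Matrix.one_mulVec]
  have h2 : Matrix.vecMulVec x x * G⁻¹ = Matrix.vecMulVec x (G⁻¹ *ᵥ x) := by
    rw [Matrix.vecMulVec_mul, hsymm]
  have h3 : Matrix.vecMulVec x x * Matrix.vecMulVec (G⁻¹ *ᵥ x) (G⁻¹ *ᵥ x) =
      (x ⬝ᵥ G⁻¹ *ᵥ x) • Matrix.vecMulVec x (G⁻¹ *ᵥ x) := by
    rw [Matrix.vecMulVec_mul_vecMulVec]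
    ext i j
    simp [Matrix.vecMulVec_apply]
    try ring
  rw [add_mul, mul_sub, mul_sub, Matrix.mul_nonsing_inv _ hu, mul_smul_comm, mul_smul_comm, h1, h2,
    h3]
  ext i j
  simp only [Matrix.add_apply, Matrix.sub_apply, Matrix.smul_apply, smul_eq_mul]
  field_simp
  ring

/-- `invGram` computes what it should. -/
lemma run_invGram {lam : ℝ} (hlam : 0 < lam) {C : List (CoreElt S A d)}
    {X : Matrix (Fin d) (Fin d) ℝ} {q c : ℕ} (h : Run M F cφ (invGram lam C) X q c) :
    X = ((featureMatrix C)ᵀ * featureMatrix C + lam • (1 : Matrix (Fin d) (Fin d) ℝ))⁻¹ := by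
  obtain ⟨X₀, _, _, _, _, h1, h2, -, -⟩ := run_bind h
  have hX₀ : X₀ = (lam • (1 : Matrix (Fin d) (Fin d) ℝ))⁻¹ := by
    have : X₀ = lam⁻¹ • (1 : Matrix (Fin d) (Fin d) ℝ) := by
      refine run_tabulate _ _ _ (fun i z q c h => run_tabulate _ _ _ (fun j z q c h => ?_) _ _ _ h)
        _ _ _ h1
      by_cases hij : i = j
      · subst hij
        rw [if_pos rfl] at h
        rw [run_op h]
        simp [ArithOp.eval]
      · rw [if_neg hij] at h
        cases h with
        | tick h => cases h; simp [hij]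
    rw [this]
    refine (Matrix.inv_eq_right_inv ?_).symm
    rw [smul_mul_smul_comm, mul_inv_cancel₀ hlam.ne', one_mul, one_smul]
  have h3 := run_loop (g := fun (X : Matrix (Fin d) (Fin d) ℝ) (z : CoreElt S A d) =>
    X - (1 + z.φ ⬝ᵥ X *ᵥ z.φ)⁻¹ • Matrix.vecMulVec (X *ᵥ z.φ) (X *ᵥ z.φ))
    (fun _ _ _ _ _ h => run_rankOneUpdate h) _ _ _ _ _ h2
  have hpd : (lam • (1 : Matrix (Fin d) (Fin d) ℝ)).PosDef := Matrix.PosDef.one.smul hlam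
  rw [h3, hX₀, gram_eq, add_comm]
  clear h h1 h2 h3 hX₀
  generalize lam • (1 : Matrix (Fin d) (Fin d) ℝ) = G at hpd
  induction C generalizing G with
  | nil => simp
  | cons z C ih =>
    obtain ⟨hp, he⟩ := rankOne_inv hpd z.φ
    rw [List.foldl_cons, he, ih _ hp, List.map_cons, List.sum_cons, add_assoc]

/-- `argmaxLinear` computes the greedy action. -/
lemma run_argmaxLinear [LinearOrder A] [Nonempty A] {wt : Fin d → ℝ} {s : S} {a : A} {q c : ℕ}
    (h : Run M F cφ (argmaxLinear wt s) a q c) : a = linearGreedy F wt s := by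
  set v : A → ℝ := fun a => ∑ i, wt i * F.φ s a i with hv
  cases h with
  | feature h =>
    obtain ⟨v₀, _, _, _, _, h1, h, -, -⟩ := run_bind h
    obtain ⟨best, _, _, _, _, h2, h3, -, -⟩ := run_bind h
    obtain rfl := run_dot h1
    have h4 := run_loop (g := fun (best : A × ℝ) a => if best.2 < v a then (a, v a) else best)
      (fun best a z q c h => by
        cases h with
        | feature h =>
          obtain ⟨v', _, _, _, _, h1, h, -, -⟩ := run_bind h
          obtain rfl := run_dot h1
          cases h with
          | less h =>
            simp only [decide_eq_true_eq] at h
            change Run M F cφ (if best.2 < v a then _ else _) _ _ _ at h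
            split_ifs at h ⊢ <;> cases h <;> rfl) _ _ _ _ _ h2
    cases h3
    change best = List.foldl _ (_, v _) _ at h4
    set a₀ : A := Finset.univ.min' Finset.univ_nonempty
    -- the scan of a sorted list keeps the first maximizer
    have key : ∀ (l : List A) (p : A), l.Pairwise (· ≤ ·) → (∀ x ∈ l, p ≤ x) →
        ∀ z, z = List.foldl (fun (best : A × ℝ) a => if best.2 < v a then (a, v a) else best)
          (p, v p) l → (∀ x ∈ l, v x ≤ v z.1) ∧ v p ≤ v z.1 ∧
          ∀ x, (x = p ∨ x ∈ l) → v z.1 ≤ v x → z.1 ≤ x := by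
      intro l
      induction l with
      | nil => rintro p - - z rfl; simp
      | cons y l ih =>
        intro p hl hp z hz
        rw [List.pairwise_cons] at hl
        rw [List.foldl_cons] at hz
        split_ifs at hz with hlt
        · obtain ⟨k1, k2, k3⟩ := ih y hl.2 hl.1 z hz
          refine ⟨by simpa using ⟨k2, k1⟩, hlt.le.trans k2, ?_⟩
          rintro x (rfl | hx) hle
          · exact absurd (k2.trans hle) (not_le.2 hlt)
          · exact k3 x (by simpa using hx) hle
        · obtain ⟨k1, k2, k3⟩ := ih p hl.2 (fun x hx => hp x (by simp [hx])) z hz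
          refine ⟨by simpa using ⟨(not_lt.1 hlt).trans k2, k1⟩, k2, ?_⟩
          rintro x (rfl | hx) hle
          · exact k3 x (.inl rfl) hle
          · rcases List.mem_cons.1 hx with rfl | hx
            · exact (k3 p (.inl rfl) (hle.trans (not_lt.1 hlt))).trans (hp x (by simp))
            · exact k3 x (.inr hx) hle
    have hmem : ∀ x : A, x ∈ actions A := fun x => by simp [actions]
    obtain ⟨k1, -, k3⟩ := key (actions A) a₀ (Finset.pairwise_sort _ _)
      (fun x _ => Finset.min'_le _ _ (Finset.mem_univ x)) best h4
    symm
    rw [linearGreedy, greedyAction_eq_iff]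
    exact ⟨fun a' => k1 a' (hmem a'), fun c hc => k3 c (.inr (hmem c)) (hc _)⟩

end Correctness

/-! ## The choices of the parameters -/

/-- The parameters under exact realizability, for target accuracy `κ` and error
probability `δ`. -/
def exactParams (d : ℕ) (γ b κ δ : ℝ) : Params :=
  let lam : ℝ := κ ^ 2 * (1 - γ) ^ 4 / (1024 * b ^ 2)
  let K : ℕ := ⌈2 + 2 / (1 - γ) * Real.log (3 / (κ * (1 - γ)))⌉₊
  { K := K
    n := ⌈3 / (1 - γ) * Real.log (4 * (1 + Real.log (1 + lam⁻¹) * d) / (κ * (1 - γ)))⌉₊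
    m := ⌈4096 * (d * (1 + Real.log (1 + lam⁻¹)) / (κ ^ 2 * (1 - γ) ^ 6)) *
      Real.log (8 * K * d * (1 + Real.log (1 + lam⁻¹)) / δ)⌉₊
    lam := lam
    tau := 1
    γ := γ }

/-- The parameters under approximate realizability with misspecification `ε`, for error
probability `δ`. -/
def approxParams (d : ℕ) (γ b ε δ : ℝ) : Params :=
  let lam : ℝ := ε ^ 2 * d / b ^ 2
  let K : ℕ := ⌈2 + 1 / (1 - γ) * Real.log (1 / (ε * √d))⌉₊
  { K := K
    n := ⌈1 / (1 - γ) * Real.log (1 / (ε * (1 - γ)))⌉₊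
    m := ⌈1 / (ε ^ 2 * (1 - γ) ^ 2) *
      Real.log (8 * K * d * (1 + Real.log (1 + lam⁻¹)) / δ)⌉₊
    lam := lam
    tau := 1
    γ := γ }

/-- The guarantee for a run with parameters `par`: there is a number `N` of loops after which the
algorithm has stopped whatever the answers of the simulator are, with at most `maxQ` queries and at
most `maxC` operations, and with probability at least `1 - δ` its output is `gap`-optimal at the
initial state. -/
def Guarantee {S : Type u} {A : Type v} {d : ℕ} [MeasurableSpace S] [Fintype A] [LinearOrder A]
    [Nonempty A] [MeasurableSpace A] [MeasurableSingletonClass A] (M : MDP S A)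
    (F : Features S A d) (π₀ : Policy S A) (cφ : ℕ) (par : Params) (δ gap maxQ maxC : ℝ) : Prop :=
  ∃ N : ℕ,
    (∀ out q c, Prog.Run M F cφ (confidentMCLSPI par M.ρ N) out q c →
      out ≠ none ∧ (q : ℝ) ≤ maxQ ∧ (c : ℝ) ≤ maxC) ∧
    ENNReal.ofReal (1 - δ) ≤ Prog.prob M F π₀
      {out | ∃ pol, out = some pol ∧ optValue M M.ρ - value M (pol.toPolicy F π₀) M.ρ ≤ gap}
      (confidentMCLSPI par M.ρ N)

end MCLSPI

end

open MCLSPI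

noncomputable section

namespace MCLSPI

/-! ## Value functions and the Bellman equations -/

section ValueFunctions

universe u v
variable {S : Type u} {A : Type v} [MeasurableSpace S] [MeasurableSpace A]

/-! Call a state certain for the current core set when all its feature vectors are good. A rollout
aborts at the first uncertain state, so as long as it returns a number it cannot distinguish its
policy from any policy that acts in the same way on the certain states (`Agree`). The analysis
therefore runs a virtual policy beside the real one: greedy for the computed weights on the certain
states, and greedy elsewhere for realizability weights of the previous virtual policy
(`mixedPolicy`). The weights in use are then accurate at every state, so the virtual policies
perform approximate policy iteration with a uniform error `η`, although the algorithm controls only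
the certain states. `value_sub_le_of_greedy` gives them the gap `γ ^ k / (1 - γ) + 2 * η / (1 - γ) ^
2` against every competitor.

The error `η` comes from `abs_leastSquares_sub_le`: on the good set, ridge regression turns
estimates of accuracy `e` on the core set into weights of accuracy `b * √λ + (ε + e) * √|C|`. Here
`e` is a Hoeffding deviation plus the truncation bias, and `one_le_expect_rolloutSteps` transfers
this accuracy to the virtual policy by coupling.

To return to the real policy, the last evaluation is compared with the action values of the virtual
policy and of the real one at the same time. Initialization makes `ρ` certain, and it stays so; the
two policies act alike there, so their values at `ρ` differ by at most `2 * η`. This is why the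
output is the policy evaluated in iteration `K` and not the one produced by it.

A restart adds a bad vector, which at least doubles the determinant of the regularized Gram matrix,
while the trace grows by at most one. Hence `|C| ≤ 3 d (1 + log (1 + λ⁻¹))` (`ValidCore.length_le`).
With `c` the floor of this number, there are at most `c + 1` loops, the costs are bounded in every
run, and a union bound over `(c + 1) * K * c` batches of rollouts controls the failure probability.

No measurability of programs is proved, so `∫⁻` over program outcomes is only a lower integral.
Statements therefore have the form `1 ≤ (success of the program) + (measurable error)`, which
composes, and deterministic facts are proved for every run (`Spec`) and substituted.

Two degenerate regimes are separate, because there every policy meets the target: `b ≤ κ` in the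
exact case, and `K = 0` in the approximate one. -/

lemma integrable_of_abs_le {X : Type*} [MeasurableSpace X] {μ : Measure X} [IsFiniteMeasure μ]
    {f : X → ℝ} (hf : Measurable f) {B : ℝ} (hB : ∀ x, |f x| ≤ B) : Integrable f μ :=
  Integrable.of_bound hf.aestronglyMeasurable B (Filter.Eventually.of_forall hB)

lemma integral_mem_of_forall_mem {X : Type*} [MeasurableSpace X] {μ : Measure X}
    [IsProbabilityMeasure μ] {f : X → ℝ} (hf : Integrable f μ) {l u : ℝ}
    (hl : ∀ x, l ≤ f x) (hu : ∀ x, f x ≤ u) : l ≤ ∫ x, f x ∂μ ∧ ∫ x, f x ∂μ ≤ u := by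
  constructor
  · simpa using integral_mono (integrable_const l) hf hl
  · simpa using integral_mono hf (integrable_const u) hu

lemma measurable_integral_kernel {X Y : Type*} [MeasurableSpace X] [MeasurableSpace Y]
    (κ : Kernel X Y) {f : Y → ℝ} (hf : Measurable f) : Measurable fun x => ∫ y, f y ∂(κ x) :=
  (hf.stronglyMeasurable.integral_kernel (κ := κ)).measurable

/-- The transition operator of the state-action chain. -/
def transOp (M : MDP S A) (π : Policy S A) (f : S × A → ℝ) (x : S × A) : ℝ :=
  ∫ y, f y ∂(stepKernel M π x)

lemma measurable_transOp (M : MDP S A) (π : Policy S A) {f : S × A → ℝ} (hf : Measurable f) :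
    Measurable (transOp M π f) := measurable_integral_kernel _ hf

lemma transOp_mem (M : MDP S A) (π : Policy S A) {f : S × A → ℝ} (hf : Measurable f)
    (h : ∀ x, 0 ≤ f x ∧ f x ≤ 1) (x : S × A) :
    0 ≤ transOp M π f x ∧ transOp M π f x ≤ 1 :=
  integral_mem_of_forall_mem (integrable_of_abs_le hf (B := 1) fun y => by
    rw [abs_of_nonneg (h y).1]; exact (h y).2) (fun y => (h y).1) (fun y => (h y).2)

/-- Boundedness is carried along with measurability because it supplies integrability at each later
step. -/
lemma iterate_transOp (M : MDP S A) (π : Policy S A) (t : ℕ) {f : S × A → ℝ} (hf : Measurable f)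
    (h : ∀ x, 0 ≤ f x ∧ f x ≤ 1) : Measurable ((transOp M π)^[t] f) ∧
      ∀ x, 0 ≤ (transOp M π)^[t] f x ∧ (transOp M π)^[t] f x ≤ 1 := by
  induction t with
  | zero => exact ⟨hf, h⟩
  | succ t ih =>
    rw [Function.iterate_succ_apply']
    exact ⟨measurable_transOp M π ih.1, transOp_mem M π ih.1 ih.2⟩

lemma integral_trajLaw_zero (M : MDP S A) (π : Policy S A) (μ : Measure (S × A))
    [IsProbabilityMeasure μ] {f : S × A → ℝ} (hf : Measurable f) :
    ∫ ω, f (ω 0) ∂(trajLaw M π μ) = ∫ x, f x ∂μ := by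
  have h : (trajLaw M π μ).map (fun ω => ω 0) = μ := by
    rw [trajLaw, Kernel.trajMeasure, Measure.map_comp _ _ (by fun_prop)]
    -- Coordinate `0` factors through the restriction to times `≤ 0`, where the partial trajectory
    -- is the identity kernel.
    have h1 : (Kernel.traj (X := fun _ => S × A) (historyKernel M π) 0).map (fun ω => ω 0) =
        ((Kernel.traj (X := fun _ => S × A) (historyKernel M π) 0).map
          (Preorder.frestrictLe 0)).map (fun h => h ⟨0, Finset.mem_Iic.2 le_rfl⟩) := by
      rw [← Kernel.map_comp_right _ (by fun_prop) (by fun_prop)]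
      rfl
    rw [h1, Kernel.traj_map_frestrictLe, Kernel.partialTraj_self, ← Measure.map_comp _ _ (by fun_prop),
      Measure.id_comp, Measure.map_map (by fun_prop) (by fun_prop)]
    convert Measure.map_id (μ := μ)
    ext x
    all_goals rfl
  rw [← integral_map (φ := fun ω : ℕ → S × A => ω 0) (measurable_pi_apply 0).aemeasurable (by
    rw [h]; exact hf.aestronglyMeasurable), h]

/-- The history up to `t` followed by one `historyKernel` step has the law of the extended history;
integrating out the new pair replaces `f` by `transOp M π f`. -/
lemma integral_trajLaw_succ (M : MDP S A) (π : Policy S A) (μ : Measure (S × A))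
    [IsProbabilityMeasure μ] (t : ℕ) {f : S × A → ℝ} (hf : Measurable f)
    (h : ∀ x, 0 ≤ f x ∧ f x ≤ 1) :
    ∫ ω, f (ω (t + 1)) ∂(trajLaw M π μ) = ∫ ω, transOp M π f (ω t) ∂(trajLaw M π μ) := by
  have key := Kernel.map_frestrictLe_trajMeasure_compProd_eq_map_trajMeasure
    (X := fun _ => S × A) (μ₀ := μ) (κ := historyKernel M π) (a := t)
  have hm : Measurable fun p : ((_ : Finset.Iic t) → S × A) × (S × A) => f p.2 := by fun_prop
  calc ∫ ω, f (ω (t + 1)) ∂(trajLaw M π μ)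
      = ∫ p, f p.2 ∂((trajLaw M π μ).map
          (fun x => (Preorder.frestrictLe (π := fun _ => S × A) t x, x (t + 1)))) := by
        rw [integral_map (by fun_prop) hm.aestronglyMeasurable]
    _ = ∫ ω, transOp M π f (ω t) ∂(trajLaw M π μ) := by
        unfold trajLaw
        rw [← key, Measure.integral_compProd
          (integrable_of_abs_le hm (B := 1) fun y => by
            rw [abs_of_nonneg (h _).1]; exact (h _).2)]
        have h2 : Measurable fun p : (_ : Finset.Iic t) → S × A =>
            ∫ y, f y ∂(historyKernel M π t p) := measurable_integral_kernel _ hf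
        rw [integral_map (by fun_prop) h2.aestronglyMeasurable]
        rfl

lemma integral_trajLaw (M : MDP S A) (π : Policy S A) (μ : Measure (S × A))
    [IsProbabilityMeasure μ] (t : ℕ) {f : S × A → ℝ} (hf : Measurable f)
    (h : ∀ x, 0 ≤ f x ∧ f x ≤ 1) :
    ∫ ω, f (ω t) ∂(trajLaw M π μ) = ∫ x, (transOp M π)^[t] f x ∂μ := by
  induction t generalizing f with
  | zero => exact integral_trajLaw_zero M π μ hf
  | succ t ih =>
    rw [integral_trajLaw_succ M π μ t hf h, Function.iterate_succ_apply,
      ih (measurable_transOp M π hf) (transOp_mem M π hf h)]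

lemma integral_tsum_discounted {X : Type*} [MeasurableSpace X] (μ : Measure X)
    [IsProbabilityMeasure μ] {g : ℝ} (h0 : 0 ≤ g) (h1 : g < 1) {f : ℕ → X → ℝ}
    (hf : ∀ t, Measurable (f t)) (hb : ∀ t x, 0 ≤ f t x ∧ f t x ≤ 1) :
    ∫ x, ∑' t, g ^ t * f t x ∂μ = ∑' t, g ^ t * ∫ x, f t x ∂μ := by
  have hint : ∀ t, Integrable (fun x => g ^ t * f t x) μ := fun t =>
    (integrable_of_abs_le (hf t) (B := 1) fun y => by
      rw [abs_of_nonneg (hb t y).1]; exact (hb t y).2).const_mul _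
  rw [← integral_tsum_of_summable_integral_norm hint]
  · simp_rw [integral_const_mul]
  · refine (summable_geometric_of_lt_one h0 h1).of_nonneg_of_le
      (fun t => integral_nonneg fun x => norm_nonneg _) fun t => ?_
    refine (integral_mem_of_forall_mem (hint t).norm (l := 0) (fun x => norm_nonneg _)
      fun x => ?_).2
    rw [Real.norm_of_nonneg (mul_nonneg (pow_nonneg h0 t) (hb t x).1)]
    exact mul_le_of_le_one_right (pow_nonneg h0 t) (hb t x).2

lemma summable_discounted {g : ℝ} (h0 : 0 ≤ g) (h1 : g < 1) {f : ℕ → ℝ}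
    (hb : ∀ t, 0 ≤ f t ∧ f t ≤ 1) : Summable fun t => g ^ t * f t :=
  (summable_geometric_of_lt_one h0 h1).of_nonneg_of_le
    (fun t => mul_nonneg (pow_nonneg h0 t) (hb t).1)
    fun t => mul_le_of_le_one_right (pow_nonneg h0 t) (hb t).2

lemma tsum_discounted_mem {g : ℝ} (h0 : 0 ≤ g) (h1 : g < 1) {f : ℕ → ℝ}
    (hb : ∀ t, 0 ≤ f t ∧ f t ≤ 1) :
    0 ≤ ∑' t, g ^ t * f t ∧ ∑' t, g ^ t * f t ≤ 1 / (1 - g) := by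
  refine ⟨tsum_nonneg fun t => mul_nonneg (pow_nonneg h0 t) (hb t).1, ?_⟩
  rw [one_div, ← tsum_geometric_of_lt_one h0 h1]
  exact (summable_discounted h0 h1 hb).tsum_le_tsum
    (fun t => mul_le_of_le_one_right (pow_nonneg h0 t) (hb t).2)
    (summable_geometric_of_lt_one h0 h1)

variable (M : MDP S A) (π : Policy S A)

lemma MDP.r_mem (x : S × A) : 0 ≤ M.r x ∧ M.r x ≤ 1 := ⟨M.r_nonneg x, M.r_le_one x⟩

lemma MDP.one_sub_γ_pos : 0 < 1 - M.γ := sub_pos.2 M.γ_lt_one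

lemma integral_discountedReturn (μ : Measure (S × A)) [IsProbabilityMeasure μ] :
    ∫ ω, discountedReturn M ω ∂(trajLaw M π μ) =
      ∫ x, ∑' t, M.γ ^ t * (transOp M π)^[t] M.r x ∂μ := by
  unfold discountedReturn
  have hp : IsProbabilityMeasure (trajLaw M π μ) := by unfold trajLaw; infer_instance
  have hr : ∀ t : ℕ, Measurable fun ω : ℕ → S × A => M.r (ω t) := fun t =>
    M.measurable_r.comp (measurable_pi_apply t)
  have h1 := integral_tsum_discounted (trajLaw M π μ) M.γ_pos.le M.γ_lt_one hr
    (fun t ω => M.r_mem _)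
  rw [h1, integral_tsum_discounted _ M.γ_pos.le M.γ_lt_one
      (fun t => (iterate_transOp M π t M.measurable_r M.r_mem).1)
      (fun t => (iterate_transOp M π t M.measurable_r M.r_mem).2)]
  simp_rw [integral_trajLaw M π μ _ M.measurable_r M.r_mem]

lemma measurable_qSeries :
    Measurable fun x => ∑' t, M.γ ^ t * (transOp M π)^[t] M.r x := by
  refine Measurable.tsum fun t => ?_
  exact (iterate_transOp M π t M.measurable_r M.r_mem).1.const_mul _

lemma qValue_eq_tsum (s : S) (a : A) :
    qValue M π s a = ∑' t, M.γ ^ t * (transOp M π)^[t] M.r (s, a) := by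
  rw [qValue, integral_discountedReturn, integral_dirac' _ _
    (measurable_qSeries M π).stronglyMeasurable]

lemma measurable_qValue : Measurable fun x : S × A => qValue M π x.1 x.2 := by
  simpa only [qValue_eq_tsum] using measurable_qSeries M π

lemma qValue_mem (s : S) (a : A) : 0 ≤ qValue M π s a ∧ qValue M π s a ≤ 1 / (1 - M.γ) := by
  rw [qValue_eq_tsum]
  exact tsum_discounted_mem M.γ_pos.le M.γ_lt_one fun t =>
    (iterate_transOp M π t M.measurable_r M.r_mem).2 _

lemma abs_qValue_le (s : S) (a : A) : |qValue M π s a| ≤ 1 / (1 - M.γ) := by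
  rw [abs_of_nonneg (qValue_mem M π s a).1]; exact (qValue_mem M π s a).2

lemma value_eq_integral (s : S) : value M π s = ∫ a, qValue M π s a ∂(π.act s) := by
  have h : Measurable fun x : S × A => qValue M π x.1 x.2 := measurable_qValue M π
  rw [value, integral_discountedReturn, startLaw]
  simp_rw [← qValue_eq_tsum]
  rw [integral_map measurable_prodMk_left.aemeasurable h.aestronglyMeasurable]

lemma integrable_qValue (s : S) (μ : Measure A) [IsFiniteMeasure μ] :
    Integrable (fun a => qValue M π s a) μ := by
  have h1 : Measurable fun a : A => (s, a) := measurable_prodMk_left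
  have h : Measurable fun a => qValue M π s a := by
    have h2 := (measurable_qValue M π).comp h1
    simpa only [Function.comp_def] using h2
  exact integrable_of_abs_le h (B := 1 / (1 - M.γ)) fun a => abs_qValue_le M π s a

lemma value_mem (s : S) : 0 ≤ value M π s ∧ value M π s ≤ 1 / (1 - M.γ) := by
  rw [value_eq_integral]
  exact integral_mem_of_forall_mem (integrable_qValue M π s _)
    (fun a => (qValue_mem M π s a).1) (fun a => (qValue_mem M π s a).2)

lemma measurable_value : Measurable (value M π) := by
  have h := ((measurable_qValue M π).stronglyMeasurable.integral_kernel_prod_right'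
    (κ := π.act)).measurable
  exact (funext fun s => value_eq_integral M π s) ▸ h

lemma integrable_value (μ : Measure S) [IsFiniteMeasure μ] : Integrable (value M π) μ :=
  integrable_of_abs_le (measurable_value M π) fun s => by
    rw [abs_of_nonneg (value_mem M π s).1]; exact (value_mem M π s).2

/-- Bellman equation: split the term `t = 0` off the series `∑ γ ^ t P ^ t r` and pull one
transition out of the other terms. -/
lemma qValue_eq (s : S) (a : A) :
    qValue M π s a = M.r (s, a) + M.γ * ∫ s', value M π s' ∂(M.P (s, a)) := by
  have hq := measurable_qValue M π
  have hint : Integrable (fun x : S × A => qValue M π x.1 x.2) (stepKernel M π (s, a)) :=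
    integrable_of_abs_le hq fun x => abs_qValue_le M π x.1 x.2
  have h1 : ∫ y, qValue M π y.1 y.2 ∂(stepKernel M π (s, a)) =
      ∫ s', value M π s' ∂(M.P (s, a)) := by
    unfold stepKernel at hint ⊢
    rw [ProbabilityTheory.integral_compProd hint]
    simp_rw [value_eq_integral]
    rfl
  rw [← h1]
  simp_rw [qValue_eq_tsum]
  rw [integral_tsum_discounted _ M.γ_pos.le M.γ_lt_one
      (fun t => (iterate_transOp M π t M.measurable_r M.r_mem).1)
      (fun t => (iterate_transOp M π t M.measurable_r M.r_mem).2),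
    (summable_discounted M.γ_pos.le M.γ_lt_one fun t =>
      (iterate_transOp M π t M.measurable_r M.r_mem).2 (s, a)).tsum_eq_zero_add, ← tsum_mul_left]
  congr 1
  · simp
  · refine tsum_congr fun t => ?_
    rw [Function.iterate_succ_apply', pow_succ']
    simp only [transOp]
    ring

/-! ## Approximate policy iteration -/

/-- The a priori bound `B₀` makes the supremum finite; it then satisfies `sup ≤ c + g * sup`, which
is solved for `sup`. -/
lemma le_div_of_contraction {X : Type*} [Nonempty X] {f : X → ℝ} {c g B₀ : ℝ} (hg : g < 1)
    (hB₀ : ∀ x, f x ≤ B₀)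
    (h : ∀ B, (∀ x, f x ≤ B) → ∀ x, f x ≤ c + g * B) (x : X) : f x ≤ c / (1 - g) := by
  have hbdd : BddAbove (Set.range f) := ⟨B₀, by rintro _ ⟨y, rfl⟩; exact hB₀ y⟩
  have h1 : ⨆ y, f y ≤ c + g * ⨆ y, f y := ciSup_le (h _ fun y => le_ciSup hbdd y)
  refine (le_ciSup hbdd x).trans ?_
  rw [le_div_iff₀ (sub_pos.2 hg)]
  linarith

variable {M} {π}

lemma qValue_sub_le {π' : Policy S A} {B : ℝ} (h : ∀ s, value M π s - value M π' s ≤ B)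
    (s : S) (a : A) : qValue M π s a - qValue M π' s a ≤ M.γ * B := by
  have h1 := integral_mono ((integrable_value M π (M.P (s, a))).sub (integrable_value M π' _))
    (integrable_const B) h
  rw [integral_sub' (integrable_value M π _) (integrable_value M π' _)] at h1
  simp only [integral_const, probReal_univ, one_smul] at h1
  rw [qValue_eq, qValue_eq M π']
  have := mul_le_mul_of_nonneg_left h1 M.γ_pos.le
  linarith

/-- One step of approximate policy iteration, compared with an arbitrary policy. -/
lemma value_sub_le_of_greedy {π' πs : Policy S A} {g : S → A} {η D : ℝ}
    (hval : ∀ s, value M π' s = qValue M π' s (g s))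
    (hg : ∀ s a, qValue M π s a ≤ qValue M π s (g s) + 2 * η)
    (hD : ∀ s, value M πs s - value M π s ≤ D) (s : S) :
    value M πs s - value M π' s ≤ M.γ * D + 2 * η / (1 - M.γ) := by
  have hle : ∀ (π₁ : Policy S A) s c, (∀ a, qValue M π₁ s a ≤ c) → value M π₁ s ≤ c := by
    intro π₁ s c h
    rw [value_eq_integral]
    simpa using integral_mono (integrable_qValue M π₁ s (π₁.act s)) (integrable_const c) h
  have : Nonempty S := ⟨s⟩
  -- Any bound `B` on the loss of `π'` against `π` improves to `2 * η + γ * B`.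
  have h1 : ∀ s, value M π s - value M π' s ≤ 2 * η / (1 - M.γ) := by
    refine le_div_of_contraction (f := fun s => value M π s - value M π' s) M.γ_lt_one
      (B₀ := 1 / (1 - M.γ)) (fun s => ?_) fun B hB s => ?_
    · linarith [(value_mem M π s).2, (value_mem M π' s).1]
    · have := hle π s _ (hg s)
      have := qValue_sub_le hB s (g s)
      rw [hval]
      linarith
  have h2 := qValue_sub_le h1 s (g s)
  -- Continuing with `π` instead of `πs` after the first action costs at most `γ * D`. As `πs` is
  -- arbitrary, no optimal policy has to exist.
  have h3 : value M πs s ≤ M.γ * D + 2 * η + qValue M π s (g s) :=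
    hle πs s _ fun a => by linarith [qValue_sub_le hD s a, hg s a]
  have h4 : 2 * η / (1 - M.γ) = 2 * η + M.γ * (2 * η / (1 - M.γ)) := by
    field_simp [M.one_sub_γ_pos.ne']
    ring
  rw [hval]
  linarith

lemma optValue_sub_le {s : S} {v c : ℝ} [Nonempty (Policy S A)]
    (h : ∀ πs : Policy S A, value M πs s - v ≤ c) : optValue M s - v ≤ c := by
  have : optValue M s ≤ c + v := ciSup_le fun πs => by linarith [h πs]
  linarith

end ValueFunctions

/-! ## The core set and regularized least squares -/

section CoreSet

universe u v
variable {S : Type u} {A : Type v} {d : ℕ}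

/-- The regularized Gram matrix `Φ_Cᵀ Φ_C + λ I`. -/
def gram (lam : ℝ) (C : List (CoreElt S A d)) : Matrix (Fin d) (Fin d) ℝ :=
  (featureMatrix C)ᵀ * featureMatrix C + lam • (1 : Matrix (Fin d) (Fin d) ℝ)

/-- The vector `f` is in the good set of the core set `C`, for the threshold `1`. -/
def IsGood (lam : ℝ) (C : List (CoreElt S A d)) (f : Fin d → ℝ) : Prop :=
  f ⬝ᵥ (gram lam C)⁻¹ *ᵥ f ≤ 1

lemma gram_nil (lam : ℝ) : gram lam ([] : List (CoreElt S A d)) = lam • 1 := by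
  simp [gram]

lemma gram_append (lam : ℝ) (C : List (CoreElt S A d)) (z : CoreElt S A d) :
    gram lam (C ++ [z]) = gram lam C + Matrix.vecMulVec z.φ z.φ := by
  simp only [gram, gram_eq, List.map_append, List.sum_append, List.map_cons, List.map_nil,
    List.sum_cons, List.sum_nil, add_zero]
  abel

lemma gram_posDef {lam : ℝ} (hlam : 0 < lam) (C : List (CoreElt S A d)) :
    (gram lam C).PosDef := by
  induction C using List.reverseRecOn with
  | nil => rw [gram_nil]; exact Matrix.PosDef.one.smul hlam
  | append_singleton C z ih => rw [gram_append]; exact (rankOne_inv ih z.φ).1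

lemma gram_inv_nonneg {lam : ℝ} (hlam : 0 < lam) (C : List (CoreElt S A d)) (f : Fin d → ℝ) :
    0 ≤ f ⬝ᵥ (gram lam C)⁻¹ *ᵥ f := by
  simpa using (gram_posDef hlam C).inv.posSemidef.dotProduct_mulVec_nonneg f

lemma gram_inv_symm {lam : ℝ} (hlam : 0 < lam) (C : List (CoreElt S A d)) (f g : Fin d → ℝ) :
    f ⬝ᵥ (gram lam C)⁻¹ *ᵥ g = ((gram lam C)⁻¹ *ᵥ f) ⬝ᵥ g := by
  have h : ((gram lam C)⁻¹)ᵀ = (gram lam C)⁻¹ := by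
    simpa using (gram_posDef hlam C).inv.isHermitian.eq
  rw [Matrix.dotProduct_mulVec, ← Matrix.mulVec_transpose, h]

/-- Sherman–Morrison as a quadratic form: a new element lowers the form at every vector. -/
lemma gram_append_inv_quadForm {lam : ℝ} (hlam : 0 < lam) (C : List (CoreElt S A d))
    (z : CoreElt S A d) (f : Fin d → ℝ) :
    f ⬝ᵥ (gram lam (C ++ [z]))⁻¹ *ᵥ f = f ⬝ᵥ (gram lam C)⁻¹ *ᵥ f -
      (1 + z.φ ⬝ᵥ (gram lam C)⁻¹ *ᵥ z.φ)⁻¹ * (f ⬝ᵥ (gram lam C)⁻¹ *ᵥ z.φ) ^ 2 := by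
  rw [gram_append, ← (rankOne_inv (gram_posDef hlam C) z.φ).2, Matrix.sub_mulVec,
    Matrix.smul_mulVec, Matrix.vecMulVec_mulVec, dotProduct_sub, dotProduct_smul]
  simp only [dotProduct_smul, smul_eq_mul, MulOpposite.smul_eq_mul_unop, MulOpposite.unop_op]
  rw [dotProduct_comm _ f]
  ring

/-- Goodness is never lost, so the initial state stays certain through all restarts. -/
lemma IsGood.append {lam : ℝ} (hlam : 0 < lam) {C : List (CoreElt S A d)} {f : Fin d → ℝ}
    (h : IsGood lam C f) (z : CoreElt S A d) : IsGood lam (C ++ [z]) f := by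
  unfold IsGood at h ⊢
  rw [gram_append_inv_quadForm hlam]
  have := gram_inv_nonneg hlam C z.φ
  have : 0 ≤ (1 + z.φ ⬝ᵥ (gram lam C)⁻¹ *ᵥ z.φ)⁻¹ * (f ⬝ᵥ (gram lam C)⁻¹ *ᵥ z.φ) ^ 2 := by
    positivity
  linarith

/-- If the form at the new vector was `u`, it becomes `u / (1 + u)`, which is below `1` whatever `u`
was. -/
lemma isGood_append_self {lam : ℝ} (hlam : 0 < lam) (C : List (CoreElt S A d))
    (z : CoreElt S A d) : IsGood lam (C ++ [z]) z.φ := by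
  unfold IsGood
  rw [gram_append_inv_quadForm hlam]
  have := gram_inv_nonneg hlam C z.φ
  set u := z.φ ⬝ᵥ (gram lam C)⁻¹ *ᵥ z.φ
  have h1 : u - (1 + u)⁻¹ * u ^ 2 = u / (1 + u) := by field_simp; ring
  rw [h1, div_le_one (by positivity)]
  linarith

/-- The core sets that the algorithm can build: all elements but the first have been uncertain
when they were added. -/
inductive ValidCore (lam : ℝ) : List (CoreElt S A d) → Prop
  | nil : ValidCore lam []
  | single (z : CoreElt S A d) (hz : z.φ ⬝ᵥ z.φ ≤ 1) : ValidCore lam [z]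
  | snoc (C : List (CoreElt S A d)) (z : CoreElt S A d) (hC : ValidCore lam C)
      (hz : z.φ ⬝ᵥ z.φ ≤ 1) (hbad : ¬ IsGood lam C z.φ) : ValidCore lam (C ++ [z])

/-- The matrix determinant lemma for a rank-one update. -/
lemma det_gram_append {lam : ℝ} (hlam : 0 < lam) (C : List (CoreElt S A d)) (z : CoreElt S A d) :
    (gram lam (C ++ [z])).det = (gram lam C).det * (1 + z.φ ⬝ᵥ (gram lam C)⁻¹ *ᵥ z.φ) := by
  rw [gram_append, Matrix.vecMulVec_eq Unit,
    Matrix.det_add_replicateCol_mul_replicateRow (gram_posDef hlam C).det_pos.ne'.isUnit]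
  congr 1
  rw [Matrix.det_unique, Matrix.mul_assoc, ← Matrix.replicateCol_mulVec,
    Matrix.add_apply, Matrix.replicateRow_mul_replicateCol_apply, Matrix.one_apply_eq]

/-- An uncertain element multiplies the determinant by `1 + u > 2`. The first element may be good
and guarantees only a factor `≥ 1`, hence the `2` on the right. -/
lemma two_pow_le_det_gram {lam : ℝ} (hlam : 0 < lam) {C : List (CoreElt S A d)}
    (h : ValidCore lam C) : 2 ^ C.length * lam ^ d ≤ 2 * (gram lam C).det := by
  have h0 : (gram lam ([] : List (CoreElt S A d))).det = lam ^ d := by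
    rw [gram_nil, Matrix.det_smul, Matrix.det_one, Fintype.card_fin, mul_one]
  have hp : 0 < lam ^ d := by positivity
  induction h with
  | nil => rw [h0]; simp; linarith
  | single z hz =>
    rw [← List.nil_append [z], det_gram_append hlam, h0]
    have := gram_inv_nonneg hlam ([] : List (CoreElt S A d)) z.φ
    simp only [List.nil_append, List.length_cons, List.length_nil, zero_add, pow_one]
    nlinarith
  | snoc C z hC hz hbad ih =>
    rw [det_gram_append hlam, List.length_append, List.length_singleton, pow_succ]
    unfold IsGood at hbad
    push Not at hbad
    have := (gram_posDef hlam C).det_pos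
    nlinarith

/-- AM–GM for the eigenvalues. -/
lemma det_le_trace_div_pow {d : ℕ} (hd : 0 < d) {G : Matrix (Fin d) (Fin d) ℝ} (hG : G.PosDef) :
    G.det ≤ (G.trace / d) ^ d := by
  rw [hG.isHermitian.det_eq_prod_eigenvalues, hG.isHermitian.trace_eq_sum_eigenvalues]
  have hnn : ∀ i ∈ Finset.univ, 0 ≤ hG.isHermitian.eigenvalues i :=
    fun i _ => (hG.eigenvalues_pos i).le
  have hd' : (d : ℝ) ≠ 0 := by exact_mod_cast hd.ne'
  have h := Real.geom_mean_le_arith_mean Finset.univ (fun _ => 1) hG.isHermitian.eigenvalues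
    (fun _ _ => zero_le_one) (by simpa using hd) hnn
  simp only [Real.rpow_one, Finset.sum_const, Finset.card_univ, Fintype.card_fin, nsmul_eq_mul,
    mul_one, one_mul] at h
  have h2 := pow_le_pow_left₀ (Real.rpow_nonneg (Finset.prod_nonneg hnn) _) h d
  rwa [← Real.rpow_natCast, ← Real.rpow_mul (Finset.prod_nonneg hnn), inv_mul_cancel₀ hd',
    Real.rpow_one] at h2

lemma trace_gram_le {lam : ℝ} {C : List (CoreElt S A d)} (h : ValidCore lam C) :
    (gram lam C).trace ≤ C.length + lam * d := by
  have h1 : ∀ (C : List (CoreElt S A d)) (z : CoreElt S A d), z.φ ⬝ᵥ z.φ ≤ 1 → (gram lam C).trace ≤ C.length + lam * d →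
      (gram lam (C ++ [z])).trace ≤ (C ++ [z]).length + lam * d := by
    intro C z hz hC
    rw [gram_append, Matrix.trace_add, Matrix.trace_vecMulVec]
    simp only [List.length_append, List.length_singleton, Nat.cast_add, Nat.cast_one]
    linarith
  have h0 : (gram lam ([] : List (CoreElt S A d))).trace ≤ ([] : List (CoreElt S A d)).length + lam * d := by
    simp [gram_nil]
  induction h with
  | nil => exact h0
  | single z hz => exact h1 [] z hz h0
  | snoc C z _ hz _ ih => exact h1 C z hz ih

/-- The elliptical potential bound on the size of the core set. -/
lemma ValidCore.length_le {lam : ℝ} (hlam : 0 < lam) (hd : 0 < d) {C : List (CoreElt S A d)}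
    (h : ValidCore lam C) : (C.length : ℝ) ≤ 3 * (d * (1 + Real.log (1 + lam⁻¹))) := by
  have hd' : (0 : ℝ) < d := by exact_mod_cast hd
  set c : ℝ := (C.length : ℝ) with hc
  have hc0 : 0 ≤ c := by positivity
  have h1 : 2 ^ C.length * lam ^ d ≤ 2 * (lam * (1 + c / (lam * d))) ^ d := by
    refine (two_pow_le_det_gram hlam h).trans ?_
    gcongr
    refine (det_le_trace_div_pow hd (gram_posDef hlam C)).trans ?_
    have : 0 ≤ (gram lam C).trace := (gram_posDef hlam C).posSemidef.trace_nonneg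
    have h2 := trace_gram_le h
    gcongr
    rw [div_le_iff₀ hd']
    refine h2.trans (le_of_eq ?_)
    field_simp
    rw [← hc]; ring
  have h2 : (2 : ℝ) ^ C.length ≤ 2 * (1 + c / (lam * d)) ^ d := by
    rw [mul_pow] at h1
    have hp : 0 < lam ^ d := by positivity
    refine le_of_mul_le_mul_right ?_ hp
    linarith
  have h3 : c * Real.log 2 ≤ Real.log 2 + d * Real.log (1 + c / (lam * d)) := by
    have := Real.log_le_log (by positivity) h2
    rwa [Real.log_pow, Real.log_mul (by norm_num) (by positivity), Real.log_pow] at this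
  set x := c / d with hx
  have hcx : c = x * d := by rw [hx]; field_simp
  have hx0 : 0 ≤ x := by positivity
  have h4 : Real.log (1 + c / (lam * d)) ≤ Real.log (1 + x) + Real.log (1 + lam⁻¹) := by
    rw [← Real.log_mul (by positivity) (by positivity)]
    refine Real.log_le_log (by positivity) ?_
    have : c / (lam * d) = x * lam⁻¹ := by rw [hx]; field_simp
    rw [this]
    have : 0 < lam⁻¹ := by positivity
    nlinarith
  -- The tangent of the logarithm at `4`: its slope `1 / 4` is below `log 2`, so the linear term can
  -- be absorbed on the left.
  have h5 : Real.log (1 + x) ≤ 2 * Real.log 2 + (1 + x) / 4 - 1 := by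
    have := Real.log_le_sub_one_of_pos (x := (1 + x) / 4) (by positivity)
    rw [Real.log_div (by positivity) (by norm_num)] at this
    have h6 : Real.log 4 = 2 * Real.log 2 := by
      rw [show (4 : ℝ) = 2 ^ 2 by norm_num, Real.log_pow]; norm_num
    linarith
  have hΛ : 0 ≤ Real.log (1 + lam⁻¹) := Real.log_nonneg (by have : 0 < lam⁻¹ := by positivity
                                                            linarith)
  have hlog := Real.log_two_gt_d9
  have hd1 : (1 : ℝ) ≤ d := by exact_mod_cast hd
  set Λ := Real.log (1 + lam⁻¹)
  set l := Real.log 2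
  have h6 : x * d * l ≤ l + d * (2 * l + (1 + x) / 4 - 1 + Λ) := by
    rw [← hcx]
    refine h3.trans ?_
    gcongr
    linarith
  have h7 : x * l ≤ l + (2 * l + (1 + x) / 4 - 1 + Λ) := by
    refine le_of_mul_le_mul_right ?_ hd'
    have : l ≤ l * d := le_mul_of_one_le_right (by linarith) hd1
    linarith
  -- `h7` reads `x * (l - 1/4) ≤ 3 * (l - 1/4) + Λ`, and `l - 1/4 > 1/3`.
  have h8 : x ≤ 3 * (1 + Λ) := by
    by_contra hcon
    push Not at hcon
    nlinarith
  rw [hcx]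
  nlinarith

lemma dotProduct_sq_le (f g : Fin d → ℝ) : (f ⬝ᵥ g) ^ 2 ≤ (f ⬝ᵥ f) * (g ⬝ᵥ g) := by
  have := Finset.sum_mul_sq_le_sq_mul_sq Finset.univ f g
  simpa only [dotProduct, ← sq] using this

/-- The error of regularized least squares on the good set. -/
lemma abs_leastSquares_sub_le {lam b e : ℝ} (hlam : 0 < lam) (hb : 0 ≤ b) (he : 0 ≤ e)
    (C : List (CoreElt S A d)) {f w : Fin d → ℝ} (hf : IsGood lam C f) (hw : w ⬝ᵥ w ≤ b ^ 2)
    {q : Fin C.length → ℝ} (hq : ∀ k, |q k - w ⬝ᵥ C[k].φ| ≤ e) {y : Fin d → ℝ}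
    (hy : y = ∑ k, q k • C[k].φ) :
    |((gram lam C)⁻¹ *ᵥ y) ⬝ᵥ f - w ⬝ᵥ f| ≤ b * √lam + e * √C.length := by
  set X := (gram lam C)⁻¹ with hX
  set g := X *ᵥ f with hg
  have hGX : gram lam C * X = 1 :=
    Matrix.mul_nonsing_inv _ (gram_posDef hlam C).det_pos.ne'.isUnit
  have hXG : X * gram lam C = 1 :=
    Matrix.nonsing_inv_mul _ (gram_posDef hlam C).det_pos.ne'.isUnit
  have hGv : ∀ v : Fin d → ℝ, gram lam C *ᵥ v =
      (∑ k : Fin C.length, (C[k].φ ⬝ᵥ v) • C[k].φ) + lam • v := by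
    intro v
    rw [gram, Matrix.add_mulVec, Matrix.smul_mulVec, Matrix.one_mulVec, ← Matrix.mulVec_mulVec]
    congr 1
    ext i
    simp [Matrix.mulVec, dotProduct, featureMatrix, Finset.sum_apply, mul_comm]
  -- The numbers `φ_k ⬝ᵥ g` together with `√λ g` form a vector of squared norm `fᵀ G⁻¹ f ≤ 1`; both
  -- Cauchy–Schwarz bounds below rest on this.
  have hgg : ∑ k : Fin C.length, (C[k].φ ⬝ᵥ g) ^ 2 + lam * (g ⬝ᵥ g) ≤ 1 := by
    have h1 : g ⬝ᵥ gram lam C *ᵥ g = f ⬝ᵥ X *ᵥ f := by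
      rw [hg, Matrix.mulVec_mulVec, hGX, Matrix.one_mulVec, dotProduct_comm]
    rw [hGv, dotProduct_add, dotProduct_smul, dotProduct_sum] at h1
    have h2 : ∀ k : Fin C.length, g ⬝ᵥ (C[k].φ ⬝ᵥ g) • C[k].φ = (C[k].φ ⬝ᵥ g) ^ 2 := fun k => by
      rw [dotProduct_smul, dotProduct_comm g, smul_eq_mul, sq]
    simp only [h2, smul_eq_mul] at h1
    rw [h1]
    exact hf
  have hgg0 : 0 ≤ g ⬝ᵥ g := dotProduct_self_star_nonneg g
  -- The error is the noise of the targets weighted by `φ_k ⬝ᵥ g`, minus the regularization bias `λ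
  -- (w ⬝ᵥ g)`.
  have hdec : (X *ᵥ y) ⬝ᵥ f - w ⬝ᵥ f =
      ∑ k : Fin C.length, (q k - w ⬝ᵥ C[k].φ) * (C[k].φ ⬝ᵥ g) - lam * (w ⬝ᵥ g) := by
    have h1 : (X *ᵥ y) ⬝ᵥ f = y ⬝ᵥ g := by
      rw [dotProduct_comm, gram_inv_symm hlam, dotProduct_comm]
    have h2 : w ⬝ᵥ f = (gram lam C *ᵥ w) ⬝ᵥ g := by
      rw [dotProduct_comm (gram lam C *ᵥ w), ← gram_inv_symm hlam, Matrix.mulVec_mulVec, hXG,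
        Matrix.one_mulVec, dotProduct_comm]
    rw [h1, h2, hGv, hy, add_dotProduct, sum_dotProduct, sum_dotProduct]
    simp only [smul_dotProduct, smul_eq_mul, sub_mul, Finset.sum_sub_distrib]
    simp only [dotProduct_comm w]
    ring
  rw [hdec]
  have hw0 : 0 ≤ w ⬝ᵥ w := dotProduct_self_star_nonneg w
  have hsum0 : 0 ≤ ∑ k : Fin C.length, (C[k].φ ⬝ᵥ g) ^ 2 := Finset.sum_nonneg fun _ _ => sq_nonneg _
  have h1 : |∑ k : Fin C.length, (q k - w ⬝ᵥ C[k].φ) * (C[k].φ ⬝ᵥ g)| ≤ e * √C.length := by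
    refine abs_le_of_sq_le_sq ?_ (by positivity)
    refine (Finset.sum_mul_sq_le_sq_mul_sq _ _ _).trans ?_
    have h3 : ∑ k : Fin C.length, (q k - w ⬝ᵥ C[k].φ) ^ 2 ≤ C.length * e ^ 2 := by
      refine (Finset.sum_le_sum fun k _ => sq_le_sq.2 ((hq k).trans (le_abs_self e))).trans ?_
      simp
    rw [mul_pow, Real.sq_sqrt (by positivity)]
    have h4 : ∑ k : Fin C.length, (C[k].φ ⬝ᵥ g) ^ 2 ≤ 1 := by
      have := mul_nonneg hlam.le hgg0
      linarith
    have h5 := mul_le_mul h3 h4 hsum0 (by positivity)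
    linarith
  have h2 : |lam * (w ⬝ᵥ g)| ≤ b * √lam := by
    refine abs_le_of_sq_le_sq ?_ (by positivity)
    rw [mul_pow, mul_pow, Real.sq_sqrt hlam.le]
    have h3 : lam * (g ⬝ᵥ g) ≤ 1 := by linarith
    calc lam ^ 2 * (w ⬝ᵥ g) ^ 2 ≤ lam ^ 2 * ((w ⬝ᵥ w) * (g ⬝ᵥ g)) := by
          gcongr; exact dotProduct_sq_le w g
      _ = (lam * (w ⬝ᵥ w)) * (lam * (g ⬝ᵥ g)) := by ring
      _ ≤ (lam * (w ⬝ᵥ w)) * 1 := by gcongr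
      _ ≤ b ^ 2 * lam := by rw [mul_one, mul_comm]; gcongr
  have h3 := abs_sub (∑ k : Fin C.length, (q k - w ⬝ᵥ C[k].φ) * (C[k].φ ⬝ᵥ g)) (lam * (w ⬝ᵥ g))
  linarith

end CoreSet

/-! ## Rules for programs: worst-case specifications and expectations -/

namespace Prog

section Rules

universe u v w w'
variable {S : Type u} {A : Type v} {d : ℕ} {α : Type w} {β : Type w'} [MeasurableSpace S]
  [MeasurableSpace A]

/-- The lower expectation of `g` over the outputs of a program. -/
def expect (M : MDP S A) (F : Features S A d) (π₀ : Policy S A) (g : α → ℝ≥0∞) :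
    Prog S A d α → ℝ≥0∞
  | ret x => g x
  | tick p => expect M F π₀ g p
  | arith o x y k => expect M F π₀ g (k (o.eval x y))
  | less x y k => expect M F π₀ g (k (decide (x < y)))
  | feature s a k => expect M F π₀ g (k fun i => F.φ s a i)
  | draw s k => ∫⁻ a, expect M F π₀ g (k a) ∂(π₀.act s)
  | query s a k => ∫⁻ s', expect M F π₀ g (k s' (M.r (s, a))) ∂(M.P (s, a))

variable {M : MDP S A} {F : Features S A d} {π₀ : Policy S A} {P : α → Prop}

lemma prob_eq_expect (E : Set α) (p : Prog S A d α) :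
    prob M F π₀ E p = expect M F π₀ (E.indicator 1) p := by
  induction p with
  | ret x => rfl
  | tick p ih => exact ih
  | arith o x y k ih => exact ih _
  | less x y k ih => exact ih _
  | feature s a k ih => exact ih _
  | draw s k ih => exact lintegral_congr fun a => ih a
  | query s a k ih => exact lintegral_congr fun s' => ih s' _

lemma expect_bind (g : β → ℝ≥0∞) (p : Prog S A d α) (f : α → Prog S A d β) :
    expect M F π₀ g (p.bind f) = expect M F π₀ (fun x => expect M F π₀ g (f x)) p := by
  induction p with
  | ret x => rfl
  | tick p ih => exact ih
  | arith o x y k ih => exact ih _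
  | less x y k ih => exact ih _
  | feature s a k ih => exact ih _
  | draw s k ih => exact lintegral_congr fun a => ih a
  | query s a k ih => exact lintegral_congr fun s' => ih s' _

lemma expect_const (t : ℝ≥0∞) (p : Prog S A d α) : expect M F π₀ (fun _ => t) p = t := by
  induction p with
  | ret x => rfl
  | tick p ih => exact ih
  | arith o x y k ih => exact ih _
  | less x y k ih => exact ih _
  | feature s a k ih => exact ih _
  | draw s k ih => simp [expect, ih]
  | query s a k ih => simp [expect, ih]

/-- A lower integral need not be additive, but it is when one summand is measurable. The constant
here is, and this suffices for union bounds. -/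
lemma expect_add_const (g : α → ℝ≥0∞) (t : ℝ≥0∞) (p : Prog S A d α) :
    expect M F π₀ (fun x => g x + t) p = expect M F π₀ g p + t := by
  induction p with
  | ret x => rfl
  | tick p ih => exact ih
  | arith o x y k ih => exact ih _
  | less x y k ih => exact ih _
  | feature s a k ih => exact ih _
  | draw s k ih =>
    simp only [expect, ih]
    rw [lintegral_add_right _ measurable_const]
    simp
  | query s a k ih =>
    simp only [expect, ih]
    rw [lintegral_add_right _ measurable_const]
    simp

/-- The program `p` returns a value that satisfies `G`, up to a failure probability `t`. -/
def Succeeds (M : MDP S A) (F : Features S A d) (π₀ : Policy S A) (p : Prog S A d α)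
    (G : α → Prop) (t : ℝ≥0∞) : Prop :=
  1 ≤ prob M F π₀ {x | G x} p + t

lemma Succeeds.mono {p : Prog S A d α} {t t' : ℝ≥0∞} (h : Succeeds M F π₀ p P t) (ht : t ≤ t') :
    Succeeds M F π₀ p P t' :=
  le_trans (by exact h) (add_le_add le_rfl ht)

lemma succeeds_ret {x : α} (h : P x) (t : ℝ≥0∞) : Succeeds M F π₀ (ret x) P t := by
  unfold Succeeds prob
  rw [Set.indicator_of_mem (show x ∈ {x | P x} from h)]
  simp

variable [Fintype A]

/-- In every run, `p` returns a value that satisfies `P`, after at most `Q` queries and at most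
`C` operations. -/
def Spec (M : MDP S A) (F : Features S A d) (cφ : ℕ) (p : Prog S A d α) (P : α → Prop)
    (Q C : ℕ) : Prop :=
  ∀ x q c, Run M F cφ p x q c → P x ∧ q ≤ Q ∧ c ≤ C

variable {cφ : ℕ} {P' : α → Prop} {R : β → Prop} {Q Q' C C' : ℕ}

lemma Spec.mono {p : Prog S A d α} (h : Spec M F cφ p P Q C) (hP : ∀ x, P x → P' x) (hQ : Q ≤ Q')
    (hC : C ≤ C') : Spec M F cφ p P' Q' C' := fun x q c hr =>
  ⟨hP x (h x q c hr).1, (h x q c hr).2.1.trans hQ, (h x q c hr).2.2.trans hC⟩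

lemma Spec.of_run {p : Prog S A d α} (h : Spec M F cφ p P Q C)
    (h' : ∀ x q c, Run M F cφ p x q c → P' x) : Spec M F cφ p P' Q C := fun x q c hr =>
  ⟨h' x q c hr, (h x q c hr).2⟩

lemma spec_ret {x : α} (h : P x) : Spec M F cφ (ret x) P 0 0 := by
  intro y q c hr
  cases hr
  exact ⟨h, le_rfl, le_rfl⟩

lemma Spec.tick {p : Prog S A d α} (h : Spec M F cφ p P Q C) :
    Spec M F cφ (tick p) P Q (C + 1) := by
  intro y q c hr
  cases hr with
  | tick hr =>
    obtain ⟨h1, h2, h3⟩ := h _ _ _ hr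
    exact ⟨h1, h2, by omega⟩

lemma spec_op (o : ArithOp) (x y : ℝ) :
    Spec M F cφ (op o x y) (fun z => z = o.eval x y) 0 1 := by
  intro z q c hr
  cases hr with
  | arith hr => cases hr; exact ⟨rfl, le_rfl, le_rfl⟩

lemma spec_less {x y : ℝ} {k : Bool → Prog S A d α}
    (h : Spec M F cφ (k (decide (x < y))) P Q C) : Spec M F cφ (less x y k) P Q (C + 1) := by
  intro z q c hr
  cases hr with
  | less hr =>
    obtain ⟨h1, h2, h3⟩ := h _ _ _ hr
    exact ⟨h1, h2, by omega⟩

lemma spec_feature {s : S} {a : A} {k : (Fin d → ℝ) → Prog S A d α}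
    (h : Spec M F cφ (k fun i => F.φ s a i) P Q C) :
    Spec M F cφ (feature s a k) P Q (C + cφ) := by
  intro z q c hr
  cases hr with
  | feature hr =>
    obtain ⟨h1, h2, h3⟩ := h _ _ _ hr
    exact ⟨h1, h2, by omega⟩

lemma spec_draw {s : S} {k : A → Prog S A d α} (h : ∀ a, Spec M F cφ (k a) P Q C) :
    Spec M F cφ (draw s k) P Q (C + Fintype.card A) := by
  intro z q c hr
  cases hr with
  | draw a hr =>
    obtain ⟨h1, h2, h3⟩ := h _ _ _ _ hr
    exact ⟨h1, h2, by omega⟩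

lemma spec_query {s : S} {a : A} {k : S → ℝ → Prog S A d α}
    (h : ∀ s', Spec M F cφ (k s' (M.r (s, a))) P Q C) :
    Spec M F cφ (query s a k) P (Q + 1) (C + 1) := by
  intro z q c hr
  cases hr with
  | query s' hr =>
    obtain ⟨h1, h2, h3⟩ := h _ _ _ _ hr
    exact ⟨h1, by omega, by omega⟩

lemma Spec.bind {p : Prog S A d α} {f : α → Prog S A d β} (hp : Spec M F cφ p P Q C)
    (hf : ∀ x, P x → Spec M F cφ (f x) R Q' C') :
    Spec M F cφ (p.bind f) R (Q + Q') (C + C') := by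
  intro y q c hr
  obtain ⟨x, q₁, c₁, q₂, c₂, h1, h2, rfl, rfl⟩ := run_bind hr
  obtain ⟨h3, h4, h5⟩ := hp _ _ _ h1
  obtain ⟨h6, h7, h8⟩ := hf x h3 _ _ _ h2
  exact ⟨h6, by omega, by omega⟩

lemma spec_loop {ι : Type w'} {f : α → ι → Prog S A d α} {I : List ι → α → Prop}
    (hf : ∀ i l a, I (i :: l) a → Spec M F cφ (f a i) (I l) Q C) (l : List ι) (a : α)
    (ha : I l a) : Spec M F cφ (loop f l a) (I []) (l.length * Q) (l.length * (C + 1)) := by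
  induction l generalizing a with
  | nil => exact (spec_ret ha).mono (fun _ h => h) (by simp) (by simp)
  | cons i l ih =>
    refine (((hf i l a ha).bind fun b hb => ih b hb).tick).mono (fun _ h => h) ?_ ?_
    · simp only [List.length_cons]; linarith
    · simp only [List.length_cons]; linarith

lemma spec_tabulate (n : ℕ) {f : Fin n → Prog S A d α} {I : Fin n → α → Prop}
    (hf : ∀ i, Spec M F cφ (f i) (I i) Q C) :
    Spec M F cφ (tabulate n f) (fun x => ∀ i, I i (x i)) (n * Q) (n * (C + 1)) := by
  induction n with
  | zero => exact (spec_ret fun i => i.elim0).mono (fun _ h => h) (by simp) (by simp)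
  | succ n ih =>
    refine (((hf 0).bind fun x hx => (ih fun i => hf i.succ).bind fun xs hxs =>
      spec_ret (P := fun x : Fin (n + 1) → α => ∀ i, I i (x i)) ?_).tick).mono (fun _ h => h) ?_ ?_
    · exact Fin.cases hx hxs
    · linarith
    · linarith

/-- Only outputs of actual runs need to be compared; this is how facts that hold in every run enter
expectations. The cost parameter plays no role. -/
lemma expect_mono (cφ : ℕ) {g g' : α → ℝ≥0∞} {p : Prog S A d α}
    (h : ∀ x q c, Run M F cφ p x q c → g x ≤ g' x) :
    expect M F π₀ g p ≤ expect M F π₀ g' p := by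
  induction p with
  | ret x => exact h x 0 0 (.ret x)
  | tick p ih => exact ih fun x q c hr => h x q _ (.tick hr)
  | arith o x y k ih => exact ih _ fun x q c hr => h x q _ (.arith hr)
  | less x y k ih => exact ih _ fun x q c hr => h x q _ (.less hr)
  | feature s a k ih => exact ih _ fun x q c hr => h x q _ (.feature hr)
  | draw s k ih => exact lintegral_mono fun a => ih a fun x q c hr => h x q _ (.draw a hr)
  | query s a k ih =>
    exact lintegral_mono fun s' => ih s' _ fun x q c hr => h x _ _ (.query s' hr)

lemma le_expect (cφ : ℕ) {g : α → ℝ≥0∞} {p : Prog S A d α} {t : ℝ≥0∞}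
    (h : ∀ x q c, Run M F cφ p x q c → t ≤ g x) : t ≤ expect M F π₀ g p := by
  rw [← expect_const (M := M) (F := F) (π₀ := π₀) t p]
  exact expect_mono cφ h

/-- A program that satisfies a specification can be skipped when an expectation is bounded from
below. -/
lemma Spec.le_expect_bind {p : Prog S A d α} (hp : Spec M F cφ p P Q C) {g : β → ℝ≥0∞}
    {f : α → Prog S A d β} {t : ℝ≥0∞} (h : ∀ x, P x → t ≤ expect M F π₀ g (f x)) :
    t ≤ expect M F π₀ g (p.bind f) := by
  rw [expect_bind]
  exact le_expect cφ fun x q c hr => h x (hp x q c hr).1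

/-- The conclusions of a specification can be used in the continuation. -/
lemma Succeeds.bind {p : Prog S A d α} {f : α → Prog S A d β} {t t' : ℝ≥0∞}
    (hs : Spec M F cφ p P' Q C) (hp : Succeeds M F π₀ p P t)
    (hf : ∀ x, P' x → P x → Succeeds M F π₀ (f x) R t') :
    Succeeds M F π₀ (p.bind f) R (t + t') := by
  unfold Succeeds at *
  rw [prob_eq_expect] at *
  rw [expect_bind]
  -- Where `P` holds, the continuation succeeds up to `t'`; where it fails, the left side vanishes.
  have h1 : expect M F π₀ (Set.indicator {x | P x} 1) p ≤
      expect M F π₀ (fun x => expect M F π₀ (Set.indicator {x | R x} 1) (f x) + t') p := by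
    refine expect_mono cφ fun x q c hr => ?_
    by_cases hx : P x
    · rw [Set.indicator_of_mem (show x ∈ {x | P x} from hx)]
      have := hf x (hs x q c hr).1 hx
      rwa [prob_eq_expect] at this
    · rw [Set.indicator_of_notMem (show x ∉ {x | P x} from hx)]
      exact zero_le
  rw [expect_add_const] at h1
  calc (1 : ℝ≥0∞) ≤ _ := hp
    _ ≤ _ := add_le_add h1 le_rfl
    _ = _ := by ring

/-- A subroutine that is correct in every run adds nothing to the failure probability. -/
lemma Spec.succeeds_bind {p : Prog S A d α} {f : α → Prog S A d β} {t : ℝ≥0∞}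
    (hs : Spec M F cφ p P Q C) (hf : ∀ x, P x → Succeeds M F π₀ (f x) R t) :
    Succeeds M F π₀ (p.bind f) R t := by
  have h : Succeeds M F π₀ p (fun _ => True) 0 := by
    unfold Succeeds
    rw [prob_eq_expect]
    simpa [Set.indicator_univ, Pi.one_def] using
      (expect_const (M := M) (F := F) (π₀ := π₀) 1 p).ge
  simpa using Succeeds.bind hs h fun x hx _ => hf x hx

lemma Spec.succeeds {p : Prog S A d α} (hs : Spec M F cφ p P Q C) (t : ℝ≥0∞) :
    Succeeds M F π₀ p P t := by
  unfold Succeeds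
  rw [prob_eq_expect]
  refine le_add_right (le_expect cφ fun x q c hr => ?_)
  rw [Set.indicator_of_mem (show x ∈ {x | P x} from (hs x q c hr).1)]
  exact le_rfl

lemma Succeeds.imp {p : Prog S A d α} {t : ℝ≥0∞} (h : Succeeds M F π₀ p P t)
    (hP : ∀ x, P x → P' x) : Succeeds M F π₀ p P' t := by
  unfold Succeeds at *
  rw [prob_eq_expect] at *
  exact h.trans (add_le_add (expect_mono 0 fun x _ _ _ =>
    Set.indicator_le_indicator_of_subset (fun y hy => hP y hy) (fun _ => zero_le) x) le_rfl)

end Rules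

end Prog

open Prog

/-! ## Specifications and costs of the subroutines -/

section Costs

set_option linter.unusedSectionVars false

universe u v
variable {S : Type u} {A : Type v} {d : ℕ} [MeasurableSpace S] [MeasurableSpace A] [Fintype A]
  {M : MDP S A} {F : Features S A d} {cφ : ℕ}

/-- These counts follow the programs term by term, with one extra operation for the tick of each
loop step. `nA` is the number of actions and `c` bounds the size of the core set. -/
def quadCost (d : ℕ) : ℕ := d * (d * 3 + 1) + d * 3

def updateCost (d : ℕ) : ℕ := d * (d * 3 + 1) + (d * 3 + (1 + d * (d * 4 + 1)))

def invCost (d c : ℕ) : ℕ := d * (d * 2 + 1) + c * (updateCost d + 1)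

def findCost (d cφ nA : ℕ) : ℕ := nA * (quadCost d + cφ + 2)

def chooseCost (d cφ nA : ℕ) : ℕ := nA + (cφ + d * 3 + nA * (d * 3 + cφ + 2))

def rolloutCost (d cφ nA n : ℕ) : ℕ := n * (findCost d cφ nA + chooseCost d cφ nA + 5)

def batchCost (d cφ nA n m : ℕ) : ℕ := m * (rolloutCost d cφ nA n + 3) + 1

def evalCost (d cφ nA n m c : ℕ) : ℕ := c * (batchCost d cφ nA n m + d * 3 + 1)

def iterCost (d cφ nA n m K c : ℕ) : ℕ := K * (evalCost d cφ nA n m c + d * (d * 3 + 1) + 1)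

def loopCost (d cφ nA n m K c : ℕ) : ℕ := invCost d c + iterCost d cφ nA n m K c + 1

def initCost (d cφ nA c : ℕ) : ℕ := nA * (invCost d c + quadCost d + cφ + 2)

def totalCost (d cφ nA n m K c : ℕ) : ℕ :=
  initCost d cφ nA c + (c + 1) * loopCost d cφ nA n m K c

/-- At most `c + 1` loops of `K` iterations, each with `m` rollouts of at most `n + 1` queries from
every core element; initialization makes no query. -/
def totalQueries (n m K c : ℕ) : ℕ := (c + 1) * (K * (c * (m * (n + 1))))

lemma spec_dot (x y : Fin d → ℝ) :
    Spec M F cφ (dot x y) (fun z => z = x ⬝ᵥ y) 0 (d * 3) := by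
  refine Spec.of_run (P := fun _ => True) ?_ fun z q c h => run_dot h
  refine (spec_loop (I := fun _ _ => True) (Q := 0) (C := 2) (fun i l a _ => ?_) _ _ trivial).mono
    (fun _ h => h) (by simp) (by simp)
  exact (spec_op _ _ _).bind fun p _ => (spec_op _ _ _).mono (fun _ _ => trivial) le_rfl le_rfl

lemma spec_mulVec (X : Matrix (Fin d) (Fin d) ℝ) (x : Fin d → ℝ) :
    Spec M F cφ (mulVec X x) (fun z => z = X *ᵥ x) 0 (d * (d * 3 + 1)) := by
  refine Spec.of_run (P := fun _ => True) ?_ fun z q c h => run_mulVec h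
  exact (spec_tabulate d fun i => spec_dot (X i) x).mono (fun _ _ => trivial) (by simp) le_rfl

lemma spec_quadForm (X : Matrix (Fin d) (Fin d) ℝ) (x : Fin d → ℝ) :
    Spec M F cφ (quadForm X x) (fun z => z = x ⬝ᵥ X *ᵥ x) 0 (quadCost d) := by
  refine Spec.of_run (P := fun _ => True) ?_ fun z q c h => run_quadForm h
  exact Spec.mono (P := fun _ => True) (Q := 0 + 0) (C := d * (d * 3 + 1) + d * 3)
    ((spec_mulVec X x).bind fun y _ => (spec_dot x y).mono (fun _ _ => trivial) le_rfl le_rfl)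
    (fun _ h => h) le_rfl le_rfl

lemma spec_rankOneUpdate (X : Matrix (Fin d) (Fin d) ℝ) (x : Fin d → ℝ) :
    Spec M F cφ (rankOneUpdate X x) (fun _ => True) 0 (updateCost d) := by
  refine ((spec_mulVec X x).bind fun y _ => (spec_dot x y).bind fun t _ =>
    (spec_op .add 1 t).bind fun c _ => (spec_tabulate (I := fun _ _ => True) (Q := 0)
      (C := d * 4) d fun i => ?_).mono (P' := fun _ => True) (fun _ _ => trivial) le_rfl le_rfl).mono
    (fun _ h => h) (by simp) le_rfl
  refine (spec_tabulate (I := fun _ _ => True) (Q := 0) (C := 3) d fun j => ?_).mono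
    (fun _ _ => trivial) (by simp) le_rfl
  exact Spec.mono (P := fun _ => True) (Q := 0 + (0 + 0)) (C := 1 + (1 + 1))
    ((spec_op .mul (y i) (y j)).bind fun p _ => (spec_op .div p c).bind fun p' _ =>
      (spec_op .sub (X i j) p').mono (fun _ _ => trivial) le_rfl le_rfl)
    (fun _ h => h) le_rfl le_rfl

lemma spec_invGram {lam : ℝ} (hlam : 0 < lam) (C : List (CoreElt S A d)) :
    Spec M F cφ (invGram lam C) (fun X => X = (gram lam C)⁻¹) 0 (invCost d C.length) := by
  refine Spec.of_run (P := fun _ => True) ?_ fun z q c h => run_invGram hlam h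
  refine ((spec_tabulate (I := fun _ _ => True) (Q := 0) (C := d * 2) d fun i => ?_).bind fun X _ =>
    (spec_loop (I := fun _ _ => True) (fun z l X _ => spec_rankOneUpdate X z.φ) C X trivial)).mono
    (fun _ h => h) (by simp) le_rfl
  refine (spec_tabulate (I := fun _ _ => True) (Q := 0) (C := 1) d fun j => ?_).mono
    (fun _ _ => trivial) (by simp) le_rfl
  split_ifs
  · exact (spec_op _ _ _).mono (fun _ _ => trivial) le_rfl le_rfl
  · exact (spec_ret trivial).tick

/-- An element with the correct features outside the good set. -/
def IsNew (F : Features S A d) (X : Matrix (Fin d) (Fin d) ℝ) (z : CoreElt S A d) : Prop :=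
  (z.φ = fun i => F.φ z.s z.a i) ∧ 1 < z.φ ⬝ᵥ X *ᵥ z.φ

/-- All actions are certain in the state `s`. -/
def Certain (F : Features S A d) (X : Matrix (Fin d) (Fin d) ℝ) (s : S) : Prop :=
  ∀ a, (fun i => F.φ s a i) ⬝ᵥ X *ᵥ (fun i => F.φ s a i) ≤ 1

lemma spec_findUncertain_list {tau : ℝ} (htau : tau = 1) (X : Matrix (Fin d) (Fin d) ℝ) (s : S)
    (l : List A) :
    Spec M F cφ (findUncertain tau X s l)
      (fun o => (∀ z, o = some z → z.s = s ∧ IsNew F X z) ∧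
        (o = none → ∀ a ∈ l, (fun i => F.φ s a i) ⬝ᵥ X *ᵥ (fun i => F.φ s a i) ≤ 1))
      0 (l.length * (quadCost d + cφ + 2)) := by
  subst htau
  induction l with
  | nil => exact (spec_ret (by simp)).mono (fun _ h => h) le_rfl (by simp)
  | cons a l ih =>
    refine (Spec.tick (spec_feature ((spec_quadForm X _).bind (Q' := 0)
      (C' := l.length * (quadCost d + cφ + 2) + 1) fun t ht => spec_less ?_))).mono
      (fun _ h => h) le_rfl (by simp only [List.length_cons]; linarith)
    subst ht
    by_cases h : 1 < (fun i => F.φ s a i) ⬝ᵥ X *ᵥ (fun i => F.φ s a i)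
    · simp only [h, decide_true, if_true]
      refine (spec_ret ⟨?_, by simp⟩).mono (fun _ h => h) le_rfl (Nat.zero_le _)
      rintro z hz
      obtain rfl := Option.some.inj hz
      exact ⟨rfl, rfl, h⟩
    · simp only [h, decide_false]
      refine ih.mono (fun o ho => ⟨ho.1, fun hn b hb => ?_⟩) le_rfl le_rfl
      rcases List.mem_cons.1 hb with rfl | hb
      · exact not_lt.1 h
      · exact ho.2 hn b hb

variable [LinearOrder A]

lemma length_actions : (actions A).length = Fintype.card A := by simp [actions]

lemma mem_actions (a : A) : a ∈ actions A := by simp [actions]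

lemma spec_findUncertain {tau : ℝ} (htau : tau = 1) (X : Matrix (Fin d) (Fin d) ℝ) (s : S) :
    Spec M F cφ (findUncertain tau X s (actions A))
      (fun o => (∀ z, o = some z → IsNew F X z ∧ ¬ Certain F X s) ∧ (o = none → Certain F X s))
      0 (findCost d cφ (Fintype.card A)) := by
  refine (spec_findUncertain_list htau X s (actions A)).mono (fun o ho => ⟨fun z hz => ?_,
    fun h a => ho.2 h a (mem_actions a)⟩) le_rfl (by rw [length_actions, findCost])
  obtain ⟨rfl, h2⟩ := ho.1 z hz
  refine ⟨h2, fun hc => ?_⟩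
  have := hc z.a
  rw [← h2.1] at this
  exact absurd this (not_le.2 h2.2)

variable [Nonempty A]

lemma spec_argmaxLinear (wt : Fin d → ℝ) (s : S) :
    Spec M F cφ (argmaxLinear wt s) (fun a => a = linearGreedy F wt s) 0
      (chooseCost d cφ (Fintype.card A)) := by
  refine Spec.of_run (P := fun _ => True) ?_ fun z q c h => run_argmaxLinear h
  refine (spec_feature ((spec_dot _ _).bind fun v _ => (spec_loop (I := fun _ _ => True) (Q := 0)
    (C := d * 3 + cφ + 1) (fun a l best _ => ?_) _ _ trivial).bind fun best _ =>
      spec_ret trivial)).mono (fun _ h => h) (by simp) ?_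
  · refine (spec_feature ((spec_dot _ _).bind fun v' _ => spec_less (Q := 0) (C := 0) ?_)).mono
      (fun _ h => h) (by simp) (by linarith)
    split_ifs <;> exact spec_ret trivial
  · rw [length_actions, chooseCost]
    linarith

lemma spec_chooseAction (pol : PolicyCode d) (s : S) :
    Spec M F cφ (chooseAction pol s) (fun _ => True) 0 (chooseCost d cφ (Fintype.card A)) := by
  cases pol with
  | init =>
    refine (spec_draw (Q := 0) (C := 0) fun a => spec_ret trivial).mono (fun _ h => h) le_rfl ?_
    rw [chooseCost]; omega
  | greedy wt => exact (spec_argmaxLinear wt s).mono (fun _ _ => trivial) le_rfl le_rfl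

/-- The status "uncertain" comes with a new element. -/
def NewIfLeft (F : Features S A d) (X : Matrix (Fin d) (Fin d) ℝ) {β : Type*}
    (o : CoreElt S A d ⊕ β) : Prop := ∀ z, o = .inl z → IsNew F X z

variable {par : Params} (X : Matrix (Fin d) (Fin d) ℝ) (pol : PolicyCode d)

lemma spec_rolloutSteps (htau : par.tau = 1) (j : ℕ) (s : S) (g acc : ℝ) :
    Spec M F cφ (rolloutSteps par X pol j s g acc) (NewIfLeft F X) j
      (rolloutCost d cφ (Fintype.card A) j) := by
  induction j generalizing s g acc with
  | zero => exact (spec_ret (by simp [NewIfLeft])).mono (fun _ h => h) le_rfl (Nat.zero_le _)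
  | succ j ih =>
    refine (Spec.tick ((spec_findUncertain htau X s).bind (Q' := j + 1)
      (C' := chooseCost d cφ (Fintype.card A) + (rolloutCost d cφ (Fintype.card A) j + 4))
      fun o ho => ?_)).mono (fun _ h => h) (by omega) (by unfold rolloutCost; linarith)
    cases o with
    | some z =>
      refine (spec_ret fun z' hz' => ?_).mono (fun _ h => h) (Nat.zero_le _) (Nat.zero_le _)
      obtain rfl := Sum.inl.inj hz'
      exact (ho.1 z rfl).1
    | none =>
      refine ((spec_chooseAction pol s).bind fun a _ => spec_query (Q := j)
        (C := rolloutCost d cφ (Fintype.card A) j + 3) fun s' =>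
        ((spec_op _ _ _).bind fun x _ => (spec_op _ _ _).bind fun acc' _ =>
          (spec_op _ _ _).bind fun g' _ => ih s' g' acc').mono (fun _ h => h) (by omega)
          (by omega)).mono (fun _ h => h) (by omega) (by omega)

lemma spec_rollouts (htau : par.tau = 1) (s : S) (a : A) (j : ℕ) (total : ℝ) :
    Spec M F cφ (rollouts par X pol s a j total) (NewIfLeft F X) (j * (par.n + 1))
      (j * (rolloutCost d cφ (Fintype.card A) par.n + 3)) := by
  induction j generalizing total with
  | zero => exact (spec_ret (by simp [NewIfLeft])).mono (fun _ h => h) (by simp) (by simp)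
  | succ j ih =>
    refine (Spec.tick (spec_query fun s' => (spec_rolloutSteps X pol htau par.n s' _ _).bind
      (Q' := j * (par.n + 1)) (C' := j * (rolloutCost d cφ (Fintype.card A) par.n + 3) + 1)
      fun o ho => ?_)).mono (fun _ h => h) (by linarith) (by linarith)
    cases o with
    | inl z =>
      refine (spec_ret fun z' hz' => ?_).mono (fun _ h => h) (Nat.zero_le _) (Nat.zero_le _)
      obtain rfl := Sum.inl.inj hz'
      exact ho z rfl
    | inr y =>
      exact ((spec_op _ _ _).bind fun t _ => ih t).mono (fun _ h => h) (by omega) (by omega)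

lemma spec_confidentRollout (htau : par.tau = 1) (s : S) (a : A) :
    Spec M F cφ (confidentRollout par X pol s a) (NewIfLeft F X) (par.m * (par.n + 1))
      (batchCost d cφ (Fintype.card A) par.n par.m) := by
  refine ((spec_rollouts X pol htau s a par.m 0).bind (Q' := 0) (C' := 1) fun o ho => ?_).mono
    (fun _ h => h) le_rfl le_rfl
  cases o with
  | inl z =>
    refine (spec_ret fun z' hz' => ?_).mono (fun _ h => h) (Nat.zero_le _) (Nat.zero_le _)
    obtain rfl := Sum.inl.inj hz'
    exact ho z rfl
  | inr y =>
    exact ((spec_op _ _ _).bind fun t _ => spec_ret (by simp [NewIfLeft])).mono (fun _ h => h)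
      le_rfl le_rfl

lemma spec_accumulate (q : ℝ) (z : CoreElt S A d) (y : Fin d → ℝ) :
    Spec M F cφ (tabulate d fun i => (op .mul q (z.φ i)).bind fun x => op .add (y i) x)
      (fun y' => y' = y + q • z.φ) 0 (d * 3) := by
  refine (spec_tabulate (I := fun i x => x = y i + q * z.φ i) (Q := 0) (C := 2) d
    fun i => ?_).mono (fun x hx => funext hx) (by simp) le_rfl
  refine Spec.mono (Q := 0 + 0) (C := 1 + 1) ((spec_op _ _ _).bind fun x hx =>
    (spec_op _ _ _).mono (fun t ht => ?_) le_rfl le_rfl) (fun _ h => h) le_rfl le_rfl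
  rw [ht, hx]
  rfl

lemma spec_evalCore (htau : par.tau = 1) (l : List (CoreElt S A d)) (y : Fin d → ℝ) :
    Spec M F cφ (evalCore par X pol l y) (NewIfLeft F X) (l.length * (par.m * (par.n + 1)))
      (evalCost d cφ (Fintype.card A) par.n par.m l.length) := by
  induction l generalizing y with
  | nil => exact (spec_ret (by simp [NewIfLeft])).mono (fun _ h => h) (by simp) (Nat.zero_le _)
  | cons z l ih =>
    refine (Spec.tick ((spec_confidentRollout X pol htau z.s z.a).bind
      (Q' := l.length * (par.m * (par.n + 1)))
      (C' := d * 3 + evalCost d cφ (Fintype.card A) par.n par.m l.length)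
      fun o ho => ?_)).mono (fun _ h => h) (by simp only [List.length_cons]; linarith)
      (by unfold evalCost; simp only [List.length_cons]; linarith)
    cases o with
    | inl z' =>
      refine (spec_ret fun z'' hz' => ?_).mono (fun _ h => h) (Nat.zero_le _) (Nat.zero_le _)
      obtain rfl := Sum.inl.inj hz'
      exact ho z' rfl
    | inr q =>
      exact ((spec_accumulate q z y).bind fun y' _ => ih y').mono (fun _ h => h) (by omega) le_rfl

lemma spec_policyIteration (htau : par.tau = 1) (C : List (CoreElt S A d)) (j : ℕ)
    (prev cur : PolicyCode d) :
    Spec M F cφ (policyIteration par C X j prev cur) (NewIfLeft F X)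
      (j * (C.length * (par.m * (par.n + 1))))
      (iterCost d cφ (Fintype.card A) par.n par.m j C.length) := by
  induction j generalizing prev cur with
  | zero => exact (spec_ret (by simp [NewIfLeft])).mono (fun _ h => h) (by simp) (Nat.zero_le _)
  | succ j ih =>
    refine (Spec.tick ((spec_evalCore X cur htau C _).bind
      (Q' := j * (C.length * (par.m * (par.n + 1))))
      (C' := d * (d * 3 + 1) + iterCost d cφ (Fintype.card A) par.n par.m j C.length)
      fun o ho => ?_)).mono (fun _ h => h) (by linarith) (by unfold iterCost; linarith)
    cases o with
    | inl z' =>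
      refine (spec_ret fun z'' hz' => ?_).mono (fun _ h => h) (Nat.zero_le _) (Nat.zero_le _)
      obtain rfl := Sum.inl.inj hz'
      exact ho z' rfl
    | inr y =>
      exact ((spec_mulVec X y).bind fun wt _ => ih cur (.greedy wt)).mono (fun _ h => h)
        (by omega) le_rfl

/-- The core sets of the algorithm, with the correct features. -/
structure CoreInv (F : Features S A d) (lam : ℝ) (C : List (CoreElt S A d)) : Prop where
  valid : ValidCore lam C
  feat : ∀ z ∈ C, z.φ = fun i => F.φ z.s z.a i

lemma CoreInv.snoc {lam : ℝ} (hF : ∀ s a, (fun i => F.φ s a i) ⬝ᵥ (fun i => F.φ s a i) ≤ 1)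
    {C : List (CoreElt S A d)} (h : CoreInv F lam C) {z : CoreElt S A d}
    (hz : IsNew F (gram lam C)⁻¹ z) : CoreInv F lam (C ++ [z]) where
  valid := .snoc C z h.valid (by rw [hz.1]; exact hF _ _) (not_le.2 hz.2)
  feat z' hz' := by
    rcases List.mem_append.1 hz' with h' | h'
    · exact h.feat z' h'
    · obtain rfl := List.mem_singleton.1 h'
      exact hz.1

/-- A restart lowers `N` and raises `C.length` by one, so `N + C.length` stays above `c`. At `N = 0`
a valid core set would be longer than `c`, so the cap is never reached. -/
lemma spec_mainLoop (htau : par.tau = 1) (hlam : 0 < par.lam)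
    (hF : ∀ s a, (fun i => F.φ s a i) ⬝ᵥ (fun i => F.φ s a i) ≤ 1) {c : ℕ}
    (hc : ∀ C : List (CoreElt S A d), ValidCore par.lam C → C.length ≤ c) (N : ℕ)
    (C : List (CoreElt S A d)) (hC : CoreInv F par.lam C) (hN : c < N + C.length) :
    Spec M F cφ (mainLoop par N C) (fun o => o ≠ none)
      (N * (par.K * (c * (par.m * (par.n + 1)))))
      (N * loopCost d cφ (Fintype.card A) par.n par.m par.K c) := by
  induction N generalizing C with
  | zero => exact absurd (hc C hC.valid) (by omega)
  | succ N ih =>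
    have hlen := hc C hC.valid
    refine (Spec.tick ((spec_invGram hlam C).bind fun Y hY =>
      (spec_policyIteration Y htau C par.K .init .init).bind
      (Q' := N * (par.K * (c * (par.m * (par.n + 1)))))
      (C' := N * loopCost d cφ (Fintype.card A) par.n par.m par.K c)
      fun o ho => ?_)).mono (fun _ h => h) ?_ ?_
    · cases o with
      | inl z =>
        refine ih (C ++ [z]) (hC.snoc hF ?_) (by simp; omega)
        rw [← hY]
        exact ho z rfl
      | inr pol => exact (spec_ret (by simp)).mono (fun _ h => h) (Nat.zero_le _) (Nat.zero_le _)
    · have : par.K * (C.length * (par.m * (par.n + 1))) ≤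
        par.K * (c * (par.m * (par.n + 1))) := by gcongr
      linarith
    · have h1 : invCost d C.length ≤ invCost d c := by unfold invCost; gcongr
      have h2 : iterCost d cφ (Fintype.card A) par.n par.m par.K C.length ≤
        iterCost d cφ (Fintype.card A) par.n par.m par.K c := by unfold iterCost evalCost; gcongr
      have h3 : loopCost d cφ (Fintype.card A) par.n par.m par.K c = invCost d c +
        iterCost d cφ (Fintype.card A) par.n par.m par.K c + 1 := rfl
      rw [add_mul, one_mul]
      omega

/-- The loop invariant is that every action no longer in the list is good at `ρ`: it either passed
the test or became good by being added. -/
lemma spec_initCore (htau : par.tau = 1) (hlam : 0 < par.lam)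
    (hF : ∀ s a, (fun i => F.φ s a i) ⬝ᵥ (fun i => F.φ s a i) ≤ 1) {c : ℕ}
    (hc : ∀ C : List (CoreElt S A d), ValidCore par.lam C → C.length ≤ c) (ρ : S) :
    Spec M F cφ (initCore par ρ)
      (fun C => CoreInv F par.lam C ∧ ∀ a, IsGood par.lam C (fun i => F.φ ρ a i))
      0 (initCost d cφ (Fintype.card A) c) := by
  have h := spec_loop (M := M) (F := F) (cφ := cφ) (Q := 0) (C := invCost d c + quadCost d + cφ + 1)
    (I := fun (l : List A) (C : List (CoreElt S A d)) => CoreInv F par.lam C ∧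
      ∀ a, a ∉ l → IsGood par.lam C (fun i => F.φ ρ a i))
    (f := fun C a => feature ρ a fun f =>
      if C.isEmpty then ret [⟨ρ, a, f⟩]
      else (invGram par.lam C).bind fun X => (quadForm X f).bind fun t =>
        less par.tau t fun bad => if bad then ret (C ++ [⟨ρ, a, f⟩]) else ret C)
    (fun a l C hC => ?_) (actions A) []
    ⟨⟨.nil, by simp⟩, fun a ha => absurd (mem_actions a) ha⟩
  · exact h.mono (fun C hC => ⟨hC.1, fun a => hC.2 a (by simp)⟩) (by simp)
      (by rw [length_actions, initCost])
  · have hgood : ∀ C' : List (CoreElt S A d), (∀ b, b ∉ a :: l →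
        IsGood par.lam C' (fun i => F.φ ρ b i)) → IsGood par.lam C' (fun i => F.φ ρ a i) →
        ∀ b, b ∉ l → IsGood par.lam C' (fun i => F.φ ρ b i) := by
      intro C' h1 h2 b hb
      by_cases hba : b = a
      · rwa [hba]
      · exact h1 b (by simp [hba, hb])
    refine (spec_feature (Q := 0) (C := invCost d c + quadCost d + 1) ?_).mono (fun _ h => h) le_rfl
      (by omega)
    by_cases he : C.isEmpty
    · obtain rfl := List.isEmpty_iff.1 he
      simp only [he, if_true]
      refine (spec_ret ⟨⟨.single _ (hF _ _), by simp⟩, hgood _ (fun b hb => ?_) ?_⟩).mono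
        (fun _ h => h) le_rfl (Nat.zero_le _)
      · exact (hC.2 b hb).append hlam ⟨ρ, a, fun i => F.φ ρ a i⟩
      · exact isGood_append_self hlam [] ⟨ρ, a, fun i => F.φ ρ a i⟩
    · simp only [he]
      have hlen : invCost d C.length ≤ invCost d c := by
        have := hc C hC.1.valid
        unfold invCost; gcongr
      refine ((spec_invGram hlam C).bind fun X hX => (spec_quadForm X _).bind (Q' := 0) (C' := 1)
        fun t ht => spec_less (Q := 0) (C := 0) ?_).mono (fun _ h => h) le_rfl (by omega)
      subst hX ht
      rw [htau]
      by_cases hb : 1 < (fun i => F.φ ρ a i) ⬝ᵥ (gram par.lam C)⁻¹ *ᵥ (fun i => F.φ ρ a i)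
      · simp only [hb, decide_true, if_true]
        exact spec_ret ⟨hC.1.snoc hF ⟨rfl, hb⟩, hgood _ (fun b hb => (hC.2 b hb).append hlam _)
          (isGood_append_self hlam C ⟨ρ, a, fun i => F.φ ρ a i⟩)⟩
      · simp only [hb, decide_false]
        exact spec_ret ⟨hC.1, hgood _ hC.2 (not_lt.1 hb)⟩

/-- `c + 1` loops suffice because at most `c` of them can end with a new element. -/
lemma spec_confidentMCLSPI (htau : par.tau = 1) (hlam : 0 < par.lam)
    (hF : ∀ s a, (fun i => F.φ s a i) ⬝ᵥ (fun i => F.φ s a i) ≤ 1) {c : ℕ}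
    (hc : ∀ C : List (CoreElt S A d), ValidCore par.lam C → C.length ≤ c) (ρ : S) :
    Spec M F cφ (confidentMCLSPI par ρ (c + 1)) (fun o => o ≠ none)
      (totalQueries par.n par.m par.K c)
      (totalCost d cφ (Fintype.card A) par.n par.m par.K c) :=
  ((spec_initCore htau hlam hF hc ρ).bind fun C hC =>
    spec_mainLoop htau hlam hF hc (c + 1) C hC.1 (by omega)).mono (fun _ h => h)
    (by rw [zero_add, totalQueries]) le_rfl

end Costs

/-! ## The law of the truncated return -/

section Returns

universe u v
variable {S : Type u} {A : Type v} [MeasurableSpace S] [MeasurableSpace A]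

/-- The law of `r(s, a) + γ y` with `s' ∼ P(· | s, a)` and `y ∼ κ(· | s')`. -/
def backup (M : MDP S A) (κ : Kernel S ℝ) : Kernel (S × A) ℝ :=
  (Kernel.id ×ₖ (M.P ⊗ₖ Kernel.prodMkLeft (S × A) κ)).map fun p => M.r p.1 + M.γ * p.2.2

/-- The law of the discounted return of the first `n` steps from a given state. -/
def stateReturn (M : MDP S A) (π : Policy S A) : ℕ → Kernel S ℝ
  | 0 => Kernel.const S (Measure.dirac 0)
  | n + 1 => (π.act ⊗ₖ backup M (stateReturn M π n)).snd

lemma measurable_backup_map (M : MDP S A) :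
    Measurable fun p : (S × A) × (S × ℝ) => M.r p.1 + M.γ * p.2.2 :=
  (M.measurable_r.comp measurable_fst).add (by fun_prop)

instance (M : MDP S A) (κ : Kernel S ℝ) [IsMarkovKernel κ] : IsMarkovKernel (backup M κ) := by
  unfold backup
  exact Kernel.IsMarkovKernel.map _ (measurable_backup_map M)

instance (M : MDP S A) (π : Policy S A) (n : ℕ) : IsMarkovKernel (stateReturn M π n) := by
  induction n with
  | zero => unfold stateReturn; infer_instance
  | succ n ih => unfold stateReturn; infer_instance

/-- The law of the discounted return of a rollout, up to time `n`. -/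
def pairReturn (M : MDP S A) (π : Policy S A) (n : ℕ) : Kernel (S × A) ℝ :=
  backup M (stateReturn M π n)

instance (M : MDP S A) (π : Policy S A) (n : ℕ) : IsMarkovKernel (pairReturn M π n) := by
  unfold pairReturn; infer_instance

lemma backup_apply (M : MDP S A) (κ : Kernel S ℝ) [IsMarkovKernel κ] (x : S × A) :
    backup M κ x = ((M.P ⊗ₖ Kernel.prodMkLeft (S × A) κ) x).map fun p => M.r x + M.γ * p.2 := by
  rw [backup, Kernel.map_apply _ (measurable_backup_map M), Kernel.prod_apply, Kernel.id_apply,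
    Measure.dirac_prod, Measure.map_map (measurable_backup_map M) measurable_prodMk_left]
  rfl

lemma lintegral_backup (M : MDP S A) (κ : Kernel S ℝ) [IsMarkovKernel κ] (x : S × A)
    {f : ℝ → ℝ≥0∞} (hf : Measurable f) :
    ∫⁻ y, f y ∂(backup M κ x) = ∫⁻ s', ∫⁻ y, f (M.r x + M.γ * y) ∂(κ s') ∂(M.P x) := by
  rw [backup_apply, lintegral_map hf (by fun_prop), Kernel.lintegral_compProd _ _ _ (by fun_prop)]
  rfl

lemma lintegral_stateReturn_zero (M : MDP S A) (π : Policy S A) (s : S)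
    (f : ℝ → ℝ≥0∞) : ∫⁻ y, f y ∂(stateReturn M π 0 s) = f 0 := by
  simp [stateReturn]

lemma lintegral_stateReturn_succ (M : MDP S A) (π : Policy S A) (n : ℕ) (s : S)
    {f : ℝ → ℝ≥0∞} (hf : Measurable f) :
    ∫⁻ y, f y ∂(stateReturn M π (n + 1) s) =
      ∫⁻ a, ∫⁻ y, f y ∂(pairReturn M π n (s, a)) ∂(π.act s) := by
  rw [stateReturn, Kernel.snd_apply, lintegral_map hf measurable_snd,
    Kernel.lintegral_compProd _ _ _ (by fun_prop)]
  rfl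

/-- Puts almost sure membership into a form to which the recursive formulas for `∫⁻` apply. -/
lemma ae_mem_of_lintegral {ν : Measure ℝ} {l u : ℝ}
    (h : ∫⁻ y, (Set.Icc l u)ᶜ.indicator 1 y ∂ν = 0) : ∀ᵐ y ∂ν, y ∈ Set.Icc l u := by
  rw [lintegral_indicator_one measurableSet_Icc.compl] at h
  exact h

lemma measurable_notMem_Icc (l u : ℝ) :
    Measurable ((Set.Icc l u)ᶜ.indicator (1 : ℝ → ℝ≥0∞)) :=
  measurable_const.indicator measurableSet_Icc.compl

/-- The interval `[0, 1 / (1 - γ)]` is mapped into itself by `y ↦ r + γ * y` for `r ∈ [0, 1]`. -/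
lemma pairReturn_mem_of (M : MDP S A) (π : Policy S A) (n : ℕ)
    (h : ∀ s, ∀ᵐ y ∂(stateReturn M π n s), y ∈ Set.Icc 0 (1 / (1 - M.γ))) (x : S × A) :
    ∀ᵐ y ∂(pairReturn M π n x), y ∈ Set.Icc 0 (1 / (1 - M.γ)) := by
  apply ae_mem_of_lintegral
  rw [pairReturn, lintegral_backup _ _ _ (measurable_notMem_Icc _ _)]
  refine (lintegral_congr fun s' => ?_).trans lintegral_zero
  refine (lintegral_congr_ae ?_).trans lintegral_zero
  filter_upwards [h s'] with y hy
  refine Set.indicator_of_notMem ?_ _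
  rw [Set.notMem_compl_iff]
  have h1 := M.one_sub_γ_pos
  have h2 : 1 + M.γ * (1 / (1 - M.γ)) = 1 / (1 - M.γ) := by field_simp; ring
  have h3 := mul_le_mul_of_nonneg_left hy.2 M.γ_pos.le
  have h4 := mul_nonneg M.γ_pos.le hy.1
  exact ⟨by linarith [M.r_nonneg x], by linarith [M.r_le_one x]⟩

lemma stateReturn_mem (M : MDP S A) (π : Policy S A) (n : ℕ) (s : S) :
    ∀ᵐ y ∂(stateReturn M π n s), y ∈ Set.Icc 0 (1 / (1 - M.γ)) := by
  induction n generalizing s with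
  | zero =>
    apply ae_mem_of_lintegral
    rw [lintegral_stateReturn_zero]
    refine Set.indicator_of_notMem ?_ _
    rw [Set.notMem_compl_iff]
    exact ⟨le_rfl, one_div_nonneg.2 M.one_sub_γ_pos.le⟩
  | succ n ih =>
    apply ae_mem_of_lintegral
    rw [lintegral_stateReturn_succ _ _ _ _ (measurable_notMem_Icc _ _)]
    refine (lintegral_congr fun a => ?_).trans lintegral_zero
    have := pairReturn_mem_of M π n ih (s, a)
    rw [lintegral_indicator_one measurableSet_Icc.compl]
    exact this

lemma pairReturn_mem (M : MDP S A) (π : Policy S A) (n : ℕ) (x : S × A) :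
    ∀ᵐ y ∂(pairReturn M π n x), y ∈ Set.Icc 0 (1 / (1 - M.γ)) :=
  pairReturn_mem_of M π n (stateReturn_mem M π n) x

lemma integrable_id_of_mem {ν : Measure ℝ} [IsFiniteMeasure ν] {u : ℝ}
    (h : ∀ᵐ y ∂ν, y ∈ Set.Icc 0 u) : Integrable (fun y => y) ν :=
  Integrable.of_bound measurable_id.aestronglyMeasurable u (h.mono fun y hy => by
    rw [Real.norm_of_nonneg hy.1]; exact hy.2)

lemma integral_pairReturn (M : MDP S A) (π : Policy S A) (n : ℕ) (x : S × A) :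
    ∫ y, y ∂(pairReturn M π n x) =
      M.r x + M.γ * ∫ s', ∫ y, y ∂(stateReturn M π n s') ∂(M.P x) := by
  have hint := integrable_id_of_mem (pairReturn_mem M π n x)
  have hm : Measurable fun p : S × ℝ => M.r x + M.γ * p.2 := by fun_prop
  rw [pairReturn, backup_apply] at hint ⊢
  have hint2 : Integrable (fun p : S × ℝ => M.r x + M.γ * p.2)
      ((M.P ⊗ₖ Kernel.prodMkLeft (S × A) (stateReturn M π n)) x) := by
    have := (integrable_map_measure (f := fun p : S × ℝ => M.r x + M.γ * p.2)
      (g := fun y : ℝ => y) measurable_id.aestronglyMeasurable hm.aemeasurable).1 hint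
    exact this
  rw [integral_map hm.aemeasurable measurable_id'.aestronglyMeasurable,
    ProbabilityTheory.integral_compProd hint2]
  have h1 : ∀ s', ∫ y, (M.r x + M.γ * y) ∂(stateReturn M π n s') =
      M.r x + M.γ * ∫ y, y ∂(stateReturn M π n s') := fun s' => by
    rw [integral_add (integrable_const _)
      ((integrable_id_of_mem (stateReturn_mem M π n s')).const_mul _), integral_const_mul]
    simp
  simp only [Kernel.prodMkLeft_apply, h1]
  have hmem : ∀ s', 0 ≤ ∫ y, y ∂(stateReturn M π n s') ∧
      ∫ y, y ∂(stateReturn M π n s') ≤ 1 / (1 - M.γ) := fun s' => by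
    have h0 := stateReturn_mem M π n s'
    refine ⟨integral_nonneg_of_ae (h0.mono fun y hy => hy.1), ?_⟩
    simpa using integral_mono_ae (integrable_id_of_mem h0) (integrable_const _)
      (h0.mono fun y hy => hy.2)
  have hint3 : Integrable (fun s' => ∫ y, y ∂(stateReturn M π n s')) (M.P x) :=
    integrable_of_abs_le (measurable_integral_kernel _ measurable_id) fun s' => by
      rw [abs_of_nonneg (hmem s').1]; exact (hmem s').2
  rw [integral_add (integrable_const _) (hint3.const_mul _), integral_const_mul]
  simp

lemma integral_stateReturn_succ (M : MDP S A) (π : Policy S A) (n : ℕ) (s : S) :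
    ∫ y, y ∂(stateReturn M π (n + 1) s) =
      ∫ a, ∫ y, y ∂(pairReturn M π n (s, a)) ∂(π.act s) := by
  have hint := integrable_id_of_mem (stateReturn_mem M π (n + 1) s)
  rw [stateReturn, Kernel.snd_apply] at hint ⊢
  have hint2 := (integrable_map_measure (f := Prod.snd)
      (g := fun y : ℝ => y) measurable_id.aestronglyMeasurable measurable_snd.aemeasurable).1 hint
  rw [integral_map measurable_snd.aemeasurable measurable_id'.aestronglyMeasurable]
  exact ProbabilityTheory.integral_compProd hint2

lemma abs_integral_sub_le {X : Type*} [MeasurableSpace X] {μ : Measure X} [IsProbabilityMeasure μ]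
    {f g : X → ℝ} (hf : Integrable f μ) (hg : Integrable g μ) {B : ℝ}
    (h : ∀ x, |f x - g x| ≤ B) : |∫ x, f x ∂μ - ∫ x, g x ∂μ| ≤ B := by
  rw [← integral_sub hf hg, ← Real.norm_eq_abs]
  simpa using norm_integral_le_of_norm_le_const (μ := μ) (f := fun x => f x - g x)
    (Filter.Eventually.of_forall h)

lemma integral_mem_of_ae_mem {ν : Measure ℝ} [IsProbabilityMeasure ν] {u : ℝ}
    (h : ∀ᵐ y ∂ν, y ∈ Set.Icc 0 u) : |∫ y, y ∂ν| ≤ u := by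
  rw [abs_of_nonneg (integral_nonneg_of_ae (h.mono fun y hy => hy.1))]
  simpa using integral_mono_ae (integrable_id_of_mem h) (integrable_const _)
    (h.mono fun y hy => hy.2)

lemma abs_pairReturn_sub_le_of (M : MDP S A) (π : Policy S A) (n : ℕ) {B : ℝ}
    (h : ∀ s, |∫ y, y ∂(stateReturn M π n s) - value M π s| ≤ B) (s : S) (a : A) :
    |∫ y, y ∂(pairReturn M π n (s, a)) - qValue M π s a| ≤ M.γ * B := by
  rw [integral_pairReturn, qValue_eq, add_sub_add_left_eq_sub, ← mul_sub, abs_mul,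
    abs_of_pos M.γ_pos]
  refine mul_le_mul_of_nonneg_left ?_ M.γ_pos.le
  exact abs_integral_sub_le (integrable_of_abs_le (measurable_integral_kernel _ measurable_id)
    fun s' => integral_mem_of_ae_mem (stateReturn_mem M π n s')) (integrable_value M π _) h

/-- At length zero the discrepancy is the value itself, at most `1 / (1 - γ)`; each further step
contracts it by `γ`. -/
lemma abs_stateReturn_sub_le (M : MDP S A) (π : Policy S A) (n : ℕ) (s : S) :
    |∫ y, y ∂(stateReturn M π n s) - value M π s| ≤ M.γ ^ n / (1 - M.γ) := by
  induction n generalizing s with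
  | zero =>
    have h1 := value_mem M π s
    simp only [stateReturn, Kernel.const_apply, integral_dirac, zero_sub, abs_neg, pow_zero]
    rw [abs_of_nonneg h1.1]
    exact h1.2
  | succ n ih =>
    have hm : Measurable fun a => ∫ y, y ∂(pairReturn M π n (s, a)) := by
      have h1 : Measurable fun a : A => (s, a) := measurable_prodMk_left
      have h2 := (measurable_integral_kernel (pairReturn M π n) measurable_id).comp h1
      exact h2
    rw [integral_stateReturn_succ, value_eq_integral]
    refine abs_integral_sub_le (integrable_of_abs_le hm
      fun a => integral_mem_of_ae_mem (pairReturn_mem M π n (s, a))) (integrable_qValue M π s _)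
      fun a => ?_
    have := abs_pairReturn_sub_le_of M π n ih s a
    rwa [← mul_div_assoc, ← pow_succ'] at this

lemma abs_pairReturn_sub_le (M : MDP S A) (π : Policy S A) (n : ℕ) (s : S) (a : A) :
    |∫ y, y ∂(pairReturn M π n (s, a)) - qValue M π s a| ≤ M.γ ^ (n + 1) / (1 - M.γ) := by
  have := abs_pairReturn_sub_le_of M π n (abs_stateReturn_sub_le M π n) s a
  rwa [← mul_div_assoc, ← pow_succ'] at this

end Returns

/-! ## Concentration of averages -/

section Concentration

set_option linter.unusedSectionVars false

/-- The expectation of `f (t + y₁ + ⋯ + y_m)` for independent samples `y₁, …, y_m ∼ ν`. -/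
def sumExpect (ν : Measure ℝ) (f : ℝ → ℝ≥0∞) : ℕ → ℝ → ℝ≥0∞
  | 0, t => f t
  | m + 1, t => ∫⁻ y, sumExpect ν f m (t + y) ∂ν

variable {ν : Measure ℝ} [IsProbabilityMeasure ν]

lemma measurable_sumExpect {f : ℝ → ℝ≥0∞} (hf : Measurable f) (m : ℕ) :
    Measurable (sumExpect ν f m) := by
  induction m with
  | zero => exact hf
  | succ m ih =>
    have h : Measurable fun p : ℝ × ℝ => sumExpect ν f m (p.1 + p.2) :=
      ih.comp (measurable_fst.add measurable_snd)
    exact h.lintegral_prod_right'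

lemma sumExpect_mono {f g : ℝ → ℝ≥0∞} (h : ∀ t, f t ≤ g t) (m : ℕ) (t : ℝ) :
    sumExpect ν f m t ≤ sumExpect ν g m t := by
  induction m generalizing t with
  | zero => exact h t
  | succ m ih => exact lintegral_mono fun y => ih _

lemma sumExpect_add {f g : ℝ → ℝ≥0∞} (hf : Measurable f) (m : ℕ) (t : ℝ) :
    sumExpect ν (fun t => f t + g t) m t = sumExpect ν f m t + sumExpect ν g m t := by
  induction m generalizing t with
  | zero => rfl
  | succ m ih =>
    simp only [sumExpect, ih]
    have h : Measurable fun y => sumExpect ν f m (t + y) :=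
      (measurable_sumExpect hf m).comp (measurable_const_add t)
    rw [lintegral_add_left h]

/-- The exponential of a sum factorizes; this is the only place where independence of the samples is
exploited. -/
lemma sumExpect_exp (l B : ℝ) (m : ℕ) (t : ℝ) :
    sumExpect ν (fun t => ENNReal.ofReal (Real.exp (l * (t - B)))) m t =
      ENNReal.ofReal (Real.exp (l * (t - B))) *
        (∫⁻ y, ENNReal.ofReal (Real.exp (l * y)) ∂ν) ^ m := by
  induction m generalizing t with
  | zero => simp [sumExpect]
  | succ m ih =>
    simp only [sumExpect, ih]
    have h : ∀ y, ENNReal.ofReal (Real.exp (l * (t + y - B))) *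
        (∫⁻ y, ENNReal.ofReal (Real.exp (l * y)) ∂ν) ^ m =
        (ENNReal.ofReal (Real.exp (l * (t - B))) *
        (∫⁻ y, ENNReal.ofReal (Real.exp (l * y)) ∂ν) ^ m) * ENNReal.ofReal (Real.exp (l * y)) := by
      intro y
      rw [mul_right_comm, ← ENNReal.ofReal_mul (Real.exp_pos _).le, ← Real.exp_add]
      ring_nf
    simp_rw [h]
    rw [lintegral_const_mul _ (by fun_prop), pow_succ, mul_assoc]

/-- Hoeffding's lemma: a variable in an interval of length `u` is sub-Gaussian with variance proxy
`(u / 2) ^ 2`. -/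
lemma lintegral_exp_le {u : ℝ} (hmem : ∀ᵐ y ∂ν, y ∈ Set.Icc 0 u) (l : ℝ) :
    ∫⁻ y, ENNReal.ofReal (Real.exp (l * y)) ∂ν ≤
      ENNReal.ofReal (Real.exp (l * ∫ y, y ∂ν + (u / 2) ^ 2 * l ^ 2 / 2)) := by
  have h := hasSubgaussianMGF_of_mem_Icc (μ := ν) (X := fun y => y) aemeasurable_id hmem
  have h1 := h.mgf_le l
  have h2 := h.integrable_exp_mul l
  have h3 : ∀ y : ℝ, Real.exp (l * y) = Real.exp (l * ∫ y, y ∂ν) *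
      Real.exp (l * (y - ∫ y, y ∂ν)) := fun y => by
    rw [← Real.exp_add]; ring_nf
  have h4 : Integrable (fun y => Real.exp (l * y)) ν := by
    exact (h2.const_mul _).congr (Filter.Eventually.of_forall fun y => (h3 y).symm)
  rw [← ofReal_integral_eq_lintegral_ofReal h4 (Filter.Eventually.of_forall fun y =>
    (Real.exp_pos _).le)]
  refine ENNReal.ofReal_le_ofReal ?_
  rw [integral_congr_ae (Filter.Eventually.of_forall h3), integral_const_mul, Real.exp_add]
  refine mul_le_mul_of_nonneg_left (h1.trans (le_of_eq ?_)) (Real.exp_pos _).le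
  congr 1
  simp [sq_abs, div_pow]

/-- One side of Hoeffding's inequality, in exponential form. -/
lemma sumExpect_exp_le {u : ℝ} (hu : 0 < u) (hmem : ∀ᵐ y ∂ν, y ∈ Set.Icc 0 u) (m : ℕ) (σ θ : ℝ)
    (hσ : σ ^ 2 = 1) :
    sumExpect ν (fun t => ENNReal.ofReal (Real.exp
      (σ * (4 * θ / u ^ 2) * (t - m * (∫ y, y ∂ν + σ * θ))))) m 0 ≤
      ENNReal.ofReal (Real.exp (-(2 * m * θ ^ 2 / u ^ 2))) := by
  rw [sumExpect_exp]
  refine (mul_le_mul_right (pow_le_pow_left' (lintegral_exp_le hmem _) m) _).trans ?_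
  rw [← ENNReal.ofReal_pow (Real.exp_pos _).le, ← ENNReal.ofReal_mul (Real.exp_pos _).le,
    ← Real.exp_nat_mul, ← Real.exp_add]
  refine ENNReal.ofReal_le_ofReal (Real.exp_le_exp.2 (le_of_eq ?_))
  generalize ∫ y, y ∂ν = μ
  -- The Chernoff parameter `4 * θ / u ^ 2` minimizes `l ↦ -l * θ + u ^ 2 * l ^ 2 / 8`, with minimum
  -- `-2 * θ ^ 2 / u ^ 2`; the sign `σ` selects the tail.
  have h1 : σ * (4 * θ / u ^ 2) * (0 - m * (μ + σ * θ)) + m * (σ * (4 * θ / u ^ 2) * μ +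
      (u / 2) ^ 2 * (σ * (4 * θ / u ^ 2)) ^ 2 / 2) =
      - σ ^ 2 * (4 * θ ^ 2 / u ^ 2 * m) + σ ^ 2 * (m * (2 * θ ^ 2 / u ^ 2)) := by
    field_simp
    ring
  rw [h1, hσ]
  ring

/-- Hoeffding's inequality. -/
lemma sumExpect_deviation_le {u : ℝ} (hu : 0 < u) (hmem : ∀ᵐ y ∂ν, y ∈ Set.Icc 0 u) {m : ℕ}
    (hm : 0 < m) {θ : ℝ} (hθ : 0 < θ) :
    sumExpect ν ({t | θ < |t / m - ∫ y, y ∂ν|}.indicator 1) m 0 ≤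
      2 * ENNReal.ofReal (Real.exp (-(2 * m * θ ^ 2 / u ^ 2))) := by
  have hm' : (0 : ℝ) < m := by exact_mod_cast hm
  have h1 := sumExpect_exp_le hu hmem m 1 θ (by norm_num)
  have h2 := sumExpect_exp_le hu hmem m (-1) θ (by norm_num)
  rw [two_mul]
  refine le_trans ?_ (add_le_add h1 h2)
  rw [← sumExpect_add (by fun_prop)]
  -- The indicator of a deviation is at most the sum of the exponentials for the two tails.
  refine sumExpect_mono (fun t => ?_) m 0
  by_cases ht : θ < |t / m - ∫ y, y ∂ν|
  · rw [Set.indicator_of_mem (show t ∈ {t | θ < |t / m - ∫ y, y ∂ν|} from ht), Pi.one_apply]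
    have hc : 0 < 4 * θ / u ^ 2 := by positivity
    have key : ∀ z : ℝ, 0 ≤ z → (1 : ℝ≥0∞) ≤ ENNReal.ofReal (Real.exp z) := fun z hz => by
      rw [← ENNReal.ofReal_one]
      exact ENNReal.ofReal_le_ofReal (Real.one_le_exp hz)
    rcases lt_abs.1 ht with h | h
    · refine le_add_right (key _ ?_)
      rw [lt_sub_iff_add_lt, lt_div_iff₀ hm'] at h
      refine mul_nonneg (by linarith) ?_
      nlinarith
    · refine le_add_left (key _ ?_)
      rw [neg_sub, lt_sub_comm, div_lt_iff₀ hm'] at h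
      have : t - m * (∫ y, y ∂ν + -1 * θ) ≤ 0 := by nlinarith
      nlinarith
  · rw [Set.indicator_of_notMem (show t ∉ {t | θ < |t / m - ∫ y, y ∂ν|} from ht)]
    exact zero_le

end Concentration

/-! ## Rollouts are coupled with those of any policy that agrees on the certain states -/

section Coupling

set_option linter.unusedSectionVars false

universe u v
variable {S : Type u} {A : Type v} {d : ℕ} [MeasurableSpace S] [MeasurableSpace A] [Fintype A]
  [LinearOrder A] [Nonempty A] [MeasurableSingletonClass A]
  {M : MDP S A} {F : Features S A d} {π₀ : Policy S A} {par : Params}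
  {X : Matrix (Fin d) (Fin d) ℝ}

/-- The two policies agree on the certain states. -/
def Agree (F : Features S A d) (X : Matrix (Fin d) (Fin d) ℝ) (π π' : Policy S A) : Prop :=
  ∀ s, Certain F X s → π.act s = π'.act s

/-- For a greedy code, every run returns `linearGreedy`, which is the atom of the Dirac policy. -/
lemma lintegral_le_expect_chooseAction {β : Type*} (g : β → ℝ≥0∞) (pol : PolicyCode d) (s : S)
    (f : A → Prog S A d β) :
    ∫⁻ a, expect M F π₀ g (f a) ∂((pol.toPolicy F π₀).act s) ≤
      expect M F π₀ g ((chooseAction pol s).bind f) := by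
  cases pol with
  | init => exact le_rfl
  | greedy wt =>
    refine (spec_argmaxLinear (M := M) (cφ := 0) wt s).le_expect_bind fun a ha => ?_
    rw [ha, PolicyCode.toPolicy, greedyPolicy]
    simp only [Kernel.deterministic_apply, lintegral_dirac]
    exact le_rfl

/-- Only the error terms have to be measurable; the program part `e` is not known to be. -/
lemma one_le_lintegral_add {Y : Type*} [MeasurableSpace Y] {μ : Measure Y} [IsProbabilityMeasure μ]
    {e f₁ f₂ : Y → ℝ≥0∞} (h₁ : Measurable f₁) (h₂ : Measurable f₂)
    (h : ∀ y, 1 ≤ e y + f₁ y + f₂ y) :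
    1 ≤ ∫⁻ y, e y ∂μ + ∫⁻ y, f₁ y ∂μ + ∫⁻ y, f₂ y ∂μ := by
  rw [← lintegral_add_right _ h₁, ← lintegral_add_right _ h₂]
  calc (1 : ℝ≥0∞) = ∫⁻ _, 1 ∂μ := by simp
    _ ≤ _ := lintegral_mono h

lemma lintegral_stateReturn_affine (π : Policy S A) (n : ℕ) (s : S) {f : ℝ → ℝ≥0∞}
    (hf : Measurable f) (g acc : ℝ) :
    ∫⁻ y, f (acc + g * y) ∂(stateReturn M π (n + 1) s) =
      ∫⁻ a, ∫⁻ s', ∫⁻ y, f (acc + g * M.r (s, a) + g * M.γ * y) ∂(stateReturn M π n s')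
        ∂(M.P (s, a)) ∂(π.act s) := by
  rw [lintegral_stateReturn_succ M π n s (f := fun y => f (acc + g * y)) (by fun_prop)]
  refine lintegral_congr fun a => ?_
  rw [pairReturn, lintegral_backup M _ _ (f := fun y => f (acc + g * y)) (by fun_prop)]
  refine lintegral_congr fun s' => lintegral_congr fun y => ?_
  congr 1
  ring

lemma measurable_lintegral_stateReturn (π : Policy S A) (n : ℕ) {f : ℝ → ℝ≥0∞}
    (hf : Measurable f) : Measurable fun s => ∫⁻ y, f y ∂(stateReturn M π n s) :=
  hf.lintegral_kernel

/-- A coupling without a joint space: `H` is the success of the rollout, `f₁` and `f₂` are the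
failures of the returns under `π₁` and `π₂`. At a certain state all three use the same law of
actions and the induction hypothesis integrates. At an uncertain state the rollout stops with `inl`,
which counts as success, and the other returns no longer matter. Two policies are carried because
the last evaluation serves the real and the virtual policy together. -/
lemma one_le_expect_rolloutSteps (htau : par.tau = 1) (hγ : par.γ = M.γ) {pol : PolicyCode d}
    {π₁ π₂ : Policy S A} (h₁ : Agree F X (pol.toPolicy F π₀) π₁)
    (h₂ : Agree F X (pol.toPolicy F π₀) π₂) {f₁ f₂ : ℝ → ℝ≥0∞} (hf₁ : Measurable f₁)
    (hf₂ : Measurable f₂) {H : CoreElt S A d ⊕ ℝ → ℝ≥0∞} (hl : ∀ z, 1 ≤ H (.inl z))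
    (hr : ∀ y, 1 ≤ H (.inr y) + f₁ y + f₂ y) (j : ℕ) (s : S) (g acc : ℝ) :
    1 ≤ expect M F π₀ H (rolloutSteps par X pol j s g acc) +
      ∫⁻ y, f₁ (acc + g * y) ∂(stateReturn M π₁ j s) +
      ∫⁻ y, f₂ (acc + g * y) ∂(stateReturn M π₂ j s) := by
  induction j generalizing s g acc with
  | zero =>
    rw [lintegral_stateReturn_zero, lintegral_stateReturn_zero]
    simpa [rolloutSteps, expect] using hr acc
  | succ j ih =>
    -- Truncated subtraction moves the errors to the left, so that the goal is a lower bound on an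
    -- expectation.
    rw [add_assoc, ← tsub_le_iff_right, rolloutSteps, expect]
    refine (spec_findUncertain (M := M) (cφ := 0) htau X s).le_expect_bind fun o ho => ?_
    cases o with
    | some z => exact tsub_le_self.trans (hl z)
    | none =>
      have hs := ho.2 rfl
      refine le_trans ?_ (lintegral_le_expect_chooseAction _ pol s _)
      rw [tsub_le_iff_right, ← add_assoc, lintegral_stateReturn_affine π₁ j s hf₁,
        lintegral_stateReturn_affine π₂ j s hf₂, ← h₁ s hs, ← h₂ s hs]
      refine one_le_lintegral_add (Measurable.of_discrete) (Measurable.of_discrete) fun a => ?_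
      refine one_le_lintegral_add
        (measurable_lintegral_stateReturn π₁ j
          (f := fun y => f₁ (acc + g * M.r (s, a) + g * M.γ * y)) (by fun_prop))
        (measurable_lintegral_stateReturn π₂ j
          (f := fun y => f₂ (acc + g * M.r (s, a) + g * M.γ * y)) (by fun_prop)) fun s' => ?_
      have := ih s' (g * M.γ) (acc + g * M.r (s, a))
      rw [← hγ] at this ⊢
      exact this

/-- `sumExpect` unfolds one sample at a time, exactly as the program does, so the coupling of single
rollouts iterates. -/
lemma one_le_expect_rollouts (htau : par.tau = 1) (hγ : par.γ = M.γ) {pol : PolicyCode d}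
    {π₁ π₂ : Policy S A} (h₁ : Agree F X (pol.toPolicy F π₀) π₁)
    (h₂ : Agree F X (pol.toPolicy F π₀) π₂) {f₁ f₂ : ℝ → ℝ≥0∞} (hf₁ : Measurable f₁)
    (hf₂ : Measurable f₂) {H : CoreElt S A d ⊕ ℝ → ℝ≥0∞} (hl : ∀ z, 1 ≤ H (.inl z))
    (hr : ∀ y, 1 ≤ H (.inr y) + f₁ y + f₂ y) (s : S) (a : A) (j : ℕ) (total : ℝ) :
    1 ≤ expect M F π₀ H (rollouts par X pol s a j total) +
      sumExpect (pairReturn M π₁ par.n (s, a)) f₁ j total +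
      sumExpect (pairReturn M π₂ par.n (s, a)) f₂ j total := by
  induction j generalizing total with
  | zero => exact hr total
  | succ j ih =>
    have hm₁ : Measurable fun y => sumExpect (pairReturn M π₁ par.n (s, a)) f₁ j (total + y) :=
      (measurable_sumExpect hf₁ j).comp (measurable_const_add total)
    have hm₂ : Measurable fun y => sumExpect (pairReturn M π₂ par.n (s, a)) f₂ j (total + y) :=
      (measurable_sumExpect hf₂ j).comp (measurable_const_add total)
    rw [sumExpect, sumExpect, rollouts, expect, expect]
    conv_rhs =>
      rw [pairReturn, pairReturn, lintegral_backup _ _ _ (by rw [← pairReturn]; exact hm₁),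
        lintegral_backup _ _ _ (by rw [← pairReturn]; exact hm₂)]
    rw [← pairReturn, ← pairReturn]
    refine one_le_lintegral_add
      (measurable_lintegral_stateReturn π₁ par.n
        (f := fun y => sumExpect (pairReturn M π₁ par.n (s, a)) f₁ j
          (total + (M.r (s, a) + M.γ * y))) (hm₁.comp (by fun_prop)))
      (measurable_lintegral_stateReturn π₂ par.n
        (f := fun y => sumExpect (pairReturn M π₂ par.n (s, a)) f₂ j
          (total + (M.r (s, a) + M.γ * y))) (hm₂.comp (by fun_prop))) fun s' => ?_
    rw [expect_bind, ← hγ]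
    -- The rest of the batch plays the role of `H`, and the induction hypothesis is the required
    -- bound on it.
    exact one_le_expect_rolloutSteps htau hγ h₁ h₂ hm₁ hm₂
      (H := fun x => expect M F π₀ H (match x with
        | .inl z => ret (.inl z)
        | .inr y => (op .add total y).bind fun total' => rollouts par X pol s a j total'))
      (fun z => hl z) (fun y => ih (total + y)) par.n s' par.γ (M.r (s, a))

/-- The failure probability of a batch of `m` rollouts, for the accuracy `θ`. -/
def batchFailure (M : MDP S A) (m : ℕ) (θ : ℝ) : ℝ≥0∞ :=
  4 * ENNReal.ofReal (Real.exp (-(2 * m * θ ^ 2 / (1 / (1 - M.γ)) ^ 2)))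

/-- `θ` is the sampling error and the power of `γ` is the truncation bias. An aborted batch
satisfies the claim vacuously. -/
lemma succeeds_confidentRollout (htau : par.tau = 1) (hγ : par.γ = M.γ) (hm : 0 < par.m)
    {pol : PolicyCode d} {π₁ π₂ : Policy S A} (h₁ : Agree F X (pol.toPolicy F π₀) π₁)
    (h₂ : Agree F X (pol.toPolicy F π₀) π₂) {θ : ℝ} (hθ : 0 < θ) (s : S) (a : A) :
    Succeeds M F π₀ (confidentRollout par X pol s a)
      (fun o => ∀ q, o = .inr q →
        |q - qValue M π₁ s a| ≤ θ + M.γ ^ (par.n + 1) / (1 - M.γ) ∧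
        |q - qValue M π₂ s a| ≤ θ + M.γ ^ (par.n + 1) / (1 - M.γ))
      (batchFailure M par.m θ) := by
  set f : Policy S A → ℝ → ℝ≥0∞ := fun π =>
    {t : ℝ | θ < |t / par.m - ∫ y, y ∂(pairReturn M π par.n (s, a))|}.indicator 1 with hf
  have hmeas : ∀ π, Measurable (f π) := fun π => measurable_const.indicator
    (measurableSet_lt measurable_const (by fun_prop))
  have hdev : ∀ π, sumExpect (pairReturn M π par.n (s, a)) (f π) par.m 0 ≤
      2 * ENNReal.ofReal (Real.exp (-(2 * par.m * θ ^ 2 / (1 / (1 - M.γ)) ^ 2))) := fun π =>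
    sumExpect_deviation_le (one_div_pos.2 M.one_sub_γ_pos) (pairReturn_mem M π par.n (s, a)) hm hθ
  set E : Set (CoreElt S A d ⊕ ℝ) := {o | ∀ q, o = .inr q →
        |q - qValue M π₁ s a| ≤ θ + M.γ ^ (par.n + 1) / (1 - M.γ) ∧
        |q - qValue M π₂ s a| ≤ θ + M.γ ^ (par.n + 1) / (1 - M.γ)} with hE
  unfold Succeeds
  rw [prob_eq_expect, confidentRollout, expect_bind]
  have key := one_le_expect_rollouts (M := M) (π₀ := π₀) htau hγ h₁ h₂ (hmeas π₁) (hmeas π₂)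
    (H := fun x => expect M F π₀ (E.indicator 1) (match x with
      | .inl z => ret (.inl z)
      | .inr total => (op .div total par.m).bind fun q => ret (.inr q)))
    (fun z => ?_) (fun y => ?_) s a par.m 0
  · refine key.trans ?_
    rw [add_assoc]
    -- Two tails for each of the two policies give the factor `4` in `batchFailure`.
    refine add_le_add le_rfl ((add_le_add (hdev π₁) (hdev π₂)).trans (le_of_eq ?_))
    rw [batchFailure]
    ring
  · change 1 ≤ E.indicator 1 _
    rw [Set.indicator_of_mem (by simp [hE])]
    exact le_rfl
  · change 1 ≤ E.indicator 1 (Sum.inr (y / par.m)) + f π₁ y + f π₂ y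
    by_cases c₁ : θ < |y / par.m - ∫ y, y ∂(pairReturn M π₁ par.n (s, a))|
    · refine le_add_right (le_add_left ?_)
      have h : f π₁ y = 1 := Set.indicator_of_mem
        (show y ∈ {t : ℝ | θ < |t / par.m - ∫ y, y ∂(pairReturn M π₁ par.n (s, a))|} from c₁) _
      exact h.ge
    by_cases c₂ : θ < |y / par.m - ∫ y, y ∂(pairReturn M π₂ par.n (s, a))|
    · refine le_add_left ?_
      have h : f π₂ y = 1 := Set.indicator_of_mem
        (show y ∈ {t : ℝ | θ < |t / par.m - ∫ y, y ∂(pairReturn M π₂ par.n (s, a))|} from c₂) _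
      exact h.ge
    refine le_add_right (le_add_right ?_)
    rw [Set.indicator_of_mem]
    · exact le_rfl
    rintro q hq
    obtain rfl := Sum.inr.inj hq
    exact ⟨(abs_sub_le _ _ _).trans (add_le_add (not_lt.1 c₁) (abs_pairReturn_sub_le M π₁ _ s a)),
      (abs_sub_le _ _ _).trans (add_le_add (not_lt.1 c₂) (abs_pairReturn_sub_le M π₂ _ s a))⟩

/-- A union bound over the core elements. The program keeps only the sum `Φᵀ q`, so the individual
estimates appear existentially. -/
lemma succeeds_evalCore (htau : par.tau = 1) (hγ : par.γ = M.γ) (hm : 0 < par.m)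
    {pol : PolicyCode d} {π₁ π₂ : Policy S A} (h₁ : Agree F X (pol.toPolicy F π₀) π₁)
    (h₂ : Agree F X (pol.toPolicy F π₀) π₂) {θ : ℝ} (hθ : 0 < θ) (l : List (CoreElt S A d))
    (y : Fin d → ℝ) :
    Succeeds M F π₀ (evalCore par X pol l y)
      (fun o => ∀ y', o = .inr y' → ∃ q : Fin l.length → ℝ, y' = y + ∑ k, q k • l[k].φ ∧
        ∀ k, |q k - qValue M π₁ l[k].s l[k].a| ≤ θ + M.γ ^ (par.n + 1) / (1 - M.γ) ∧
          |q k - qValue M π₂ l[k].s l[k].a| ≤ θ + M.γ ^ (par.n + 1) / (1 - M.γ))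
      (l.length * batchFailure M par.m θ) := by
  induction l generalizing y with
  | nil =>
    refine succeeds_ret ?_ _
    rintro y' h
    obtain rfl := Sum.inr.inj h
    exact ⟨fun _ => 0, by simp, fun k => k.elim0⟩
  | cons z l ih =>
    have h := (Succeeds.bind (spec_confidentRollout (M := M) (F := F) (cφ := 0) X pol htau z.s z.a)
      (succeeds_confidentRollout htau hγ hm h₁ h₂ hθ z.s z.a)
      (t' := l.length * batchFailure M par.m θ)
      (f := fun o => match o with
        | .inl z' => ret (.inl z')
        | .inr q =>
          (tabulate d fun i => (op .mul q (z.φ i)).bind fun x => op .add (y i) x).bind fun y' =>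
          evalCore par X pol l y')
      (R := fun o => ∀ y', o = .inr y' → ∃ q : Fin (z :: l).length → ℝ,
        y' = y + ∑ k, q k • (z :: l)[k].φ ∧
        ∀ k, |q k - qValue M π₁ (z :: l)[k].s (z :: l)[k].a| ≤
            θ + M.γ ^ (par.n + 1) / (1 - M.γ) ∧
          |q k - qValue M π₂ (z :: l)[k].s (z :: l)[k].a| ≤
            θ + M.γ ^ (par.n + 1) / (1 - M.γ))
      fun o _ ho => ?_)
    · refine Succeeds.mono (by exact h) (le_of_eq ?_)
      simp only [List.length_cons]
      push_cast
      ring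
    · cases o with
      | inl z' => exact succeeds_ret (by simp) _
      | inr q =>
        refine (spec_accumulate (M := M) (F := F) (cφ := 0) q z y).succeeds_bind fun y₁ hy₁ => ?_
        refine (ih y₁).imp fun o h y' hy' => ?_
        obtain ⟨qs, h4, h5⟩ := h y' hy'
        refine ⟨Fin.cons q qs, ?_, Fin.cases (ho q rfl) h5⟩
        rw [h4, hy₁, add_assoc]
        congr 1
        exact (Fin.sum_univ_succ (n := l.length)
          (fun k => (Fin.cons q qs : Fin (l.length + 1) → ℝ) k • (z :: l)[k].φ)).symm

end Coupling

/-! ## Policy iteration and the main loop -/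

section Iteration

set_option linter.unusedSectionVars false

universe u v
variable {S : Type u} {A : Type v} {d : ℕ} [MeasurableSpace S] [MeasurableSpace A] [Fintype A]
  [LinearOrder A] [Nonempty A] [MeasurableSingletonClass A]
  {M : MDP S A} {F : Features S A d} {π₀ : Policy S A} {par : Params}
  {X : Matrix (Fin d) (Fin d) ℝ}

lemma Realizable.exists_dotProduct {b ε : ℝ} (h : Realizable M F b ε) (π : Policy S A) :
    ∃ w : Fin d → ℝ, w ⬝ᵥ w ≤ b ^ 2 ∧
      ∀ s a, |qValue M π s a - w ⬝ᵥ (fun i => F.φ s a i)| ≤ ε := by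
  obtain ⟨wt, h1, h2⟩ := h π
  have hi : ∀ v : EuclideanSpace ℝ (Fin d), inner ℝ wt v = (fun i => wt i) ⬝ᵥ (fun i => v i) := by
    intro v
    rw [PiLp.inner_apply, dotProduct]
    exact Finset.sum_congr rfl fun i _ => by simp [mul_comm]
  refine ⟨fun i => wt i, ?_, fun s a => ?_⟩
  · rw [← hi, real_inner_self_eq_norm_sq]
    exact pow_le_pow_left₀ (norm_nonneg _) h1 2
  · rw [← hi]
    exact h2 s a

lemma dotProduct_features_le (hF : ∀ s a, ‖F.φ s a‖ ≤ 1) (s : S) (a : A) :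
    (fun i => F.φ s a i) ⬝ᵥ (fun i => F.φ s a i) ≤ 1 := by
  have h1 : ‖F.φ s a‖ ^ 2 = (fun i => F.φ s a i) ⬝ᵥ (fun i => F.φ s a i) := by
    rw [EuclideanSpace.norm_sq_eq, dotProduct]
    exact Finset.sum_congr rfl fun i _ => by simp [sq]
  rw [← h1]
  exact pow_le_one₀ (norm_nonneg _) (hF s a)

lemma linearGreedy_spec (F : Features S A d) (w : Fin d → ℝ) (s : S) (a : A) :
    w ⬝ᵥ (fun i => F.φ s a i) ≤ w ⬝ᵥ (fun i => F.φ s (linearGreedy F w s) i) :=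
  ((greedyAction_eq_iff (fun a => ∑ i, w i * F.φ s a i) _).1 rfl).1 a

lemma measurable_feature (F : Features S A d) (a : A) (i : Fin d) :
    Measurable fun s => F.φ s a i :=
  ((EuclideanSpace.proj (𝕜 := ℝ) i).continuous.measurable).comp (F.measurable_φ a)

lemma measurableSet_certain (F : Features S A d) (X : Matrix (Fin d) (Fin d) ℝ) :
    MeasurableSet {s | Certain F X s} := by
  have h : {s | Certain F X s} =
      ⋂ a, {s | (fun i => F.φ s a i) ⬝ᵥ X *ᵥ (fun i => F.φ s a i) ≤ 1} := by
    ext s; simp [Certain]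
  rw [h]
  refine MeasurableSet.iInter fun a => measurableSet_le ?_ measurable_const
  simp only [dotProduct, Matrix.mulVec]
  exact Finset.measurable_sum _ fun i _ => (measurable_feature F a i).mul
    (Finset.measurable_sum _ fun j _ => (measurable_feature F a j).const_mul _)

open Classical in
/-- Greedy for `w` on the certain states, and for `w'` on the others. -/
def mixedGreedy (F : Features S A d) (X : Matrix (Fin d) (Fin d) ℝ) (w w' : Fin d → ℝ) (s : S) : A :=
  if Certain F X s then linearGreedy F w s else linearGreedy F w' s

lemma measurable_mixedGreedy (F : Features S A d) (X : Matrix (Fin d) (Fin d) ℝ)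
    (w w' : Fin d → ℝ) : Measurable (mixedGreedy F X w w') :=
  Measurable.ite (measurableSet_certain F X) (measurable_linearGreedy F w)
    (measurable_linearGreedy F w')

/-- The virtual policy, which the algorithm never computes: `w'` will be a realizability weight of
the previous virtual policy. -/
def mixedPolicy (F : Features S A d) (X : Matrix (Fin d) (Fin d) ℝ) (w w' : Fin d → ℝ) :
    Policy S A where
  act := Kernel.deterministic (mixedGreedy F X w w') (measurable_mixedGreedy F X w w')
  markov := inferInstance

lemma agree_mixedPolicy (w w' : Fin d → ℝ) :
    Agree F X ((PolicyCode.greedy w).toPolicy F π₀) (mixedPolicy F X w w') := by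
  intro s hs
  simp [PolicyCode.toPolicy, greedyPolicy, mixedPolicy, Kernel.deterministic_apply, mixedGreedy, hs]

lemma value_mixedPolicy (w w' : Fin d → ℝ) (s : S) :
    value M (mixedPolicy F X w w') s =
      qValue M (mixedPolicy F X w w') s (mixedGreedy F X w w' s) := by
  rw [value_eq_integral]
  conv_lhs => rw [mixedPolicy, Kernel.deterministic_apply]
  rw [integral_dirac]
  rfl

/-- Each weight vector is `η`-accurate on the states where it is used, so maximizing it loses at
most `2 * η`. -/
lemma qValue_le_mixedGreedy {π : Policy S A} {w w' : Fin d → ℝ} {η : ℝ}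
    (hw : ∀ s, Certain F X s → ∀ a, |w ⬝ᵥ (fun i => F.φ s a i) - qValue M π s a| ≤ η)
    (hw' : ∀ s a, |qValue M π s a - w' ⬝ᵥ (fun i => F.φ s a i)| ≤ η) (s : S) (a : A) :
    qValue M π s a ≤ qValue M π s (mixedGreedy F X w w' s) + 2 * η := by
  unfold mixedGreedy
  split_ifs with hs
  · have h1 := abs_le.1 (hw s hs a)
    have h2 := abs_le.1 (hw s hs (linearGreedy F w s))
    linarith [linearGreedy_spec F w s a]
  · have h1 := abs_le.1 (hw' s a)
    have h2 := abs_le.1 (hw' s (linearGreedy F w' s))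
    linarith [linearGreedy_spec F w' s a]

/-- The suboptimality after `k` steps of policy iteration with evaluation error `η`. -/
def iterationGap (γ η : ℝ) (k : ℕ) : ℝ := γ ^ k / (1 - γ) + 2 * η / (1 - γ) ^ 2

lemma iterationGap_succ {γ : ℝ} (hγ : γ < 1) (η : ℝ) (k : ℕ) :
    γ * iterationGap γ η k + 2 * η / (1 - γ) = iterationGap γ η (k + 1) := by
  have : 1 - γ ≠ 0 := (sub_pos.2 hγ).ne'
  unfold iterationGap
  field_simp
  ring

/-- The rollout policy agrees on the certain states with a policy that is nearly optimal
everywhere. -/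
def Tracks (M : MDP S A) (F : Features S A d) (π₀ : Policy S A) (X : Matrix (Fin d) (Fin d) ℝ)
    (η : ℝ) (k : ℕ) (pol : PolicyCode d) : Prop :=
  ∃ π : Policy S A, Agree F X (pol.toPolicy F π₀) π ∧
    ∀ πs s, value M πs s - value M π s ≤ iterationGap M.γ η k

lemma tracks_init {η : ℝ} (hη : 0 ≤ η) : Tracks M F π₀ X η 0 .init := by
  refine ⟨π₀, fun s _ => rfl, fun πs s => ?_⟩
  have h1 := (value_mem M πs s).2
  have h2 := (value_mem M π₀ s).1
  have h3 : 0 ≤ 2 * η / (1 - M.γ) ^ 2 := by positivity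
  rw [iterationGap, pow_zero]
  linarith

/-- The output policy is good at the initial state. -/
def GoodPolicy (M : MDP S A) (F : Features S A d) (π₀ : Policy S A) (gap : ℝ)
    (pol : PolicyCode d) : Prop :=
  optValue M M.ρ - value M (pol.toPolicy F π₀) M.ρ ≤ gap

/-- The error of the weights computed from accurate estimates of the action values on the
core set. -/
lemma abs_weights_sub_qValue_le {b ε e lam : ℝ} (hb : 0 ≤ b) (hlam : 0 < lam) (hε : 0 ≤ ε)
    (he : 0 ≤ e) {C : List (CoreElt S A d)} (hC : CoreInv F lam C) {π : Policy S A}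
    {w : Fin d → ℝ} (hw : w ⬝ᵥ w ≤ b ^ 2)
    (hwq : ∀ s a, |qValue M π s a - w ⬝ᵥ (fun i => F.φ s a i)| ≤ ε)
    {q : Fin C.length → ℝ} (hq : ∀ k, |q k - qValue M π C[k].s C[k].a| ≤ e) {s : S} {a : A}
    (hs : IsGood lam C (fun i => F.φ s a i)) :
    |((gram lam C)⁻¹ *ᵥ ∑ k, q k • C[k].φ) ⬝ᵥ (fun i => F.φ s a i) - qValue M π s a| ≤
      b * √lam + (ε + e) * √C.length + ε := by
  have h1 : ∀ k : Fin C.length, |q k - w ⬝ᵥ C[k].φ| ≤ ε + e := fun k => by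
    rw [hC.feat C[k] (List.getElem_mem _)]
    refine (abs_sub_le _ (qValue M π C[k].s C[k].a) _).trans ?_
    linarith [hq k, hwq C[k].s C[k].a]
  have h2 := abs_leastSquares_sub_le hlam hb (by positivity) C hs hw h1 rfl
  have h3 := hwq s a
  rw [abs_sub_comm] at h3
  exact (abs_sub_le _ _ _).trans (add_le_add h2 h3)

variable {b ε θ gap : ℝ} {c : ℕ}

/-- The error bound for the action values on the good set. -/
def evalError (b ε θ trunc lam : ℝ) (c : ℕ) : ℝ :=
  b * √lam + (ε + (θ + trunc)) * √c + ε

/-- The error is stated with `c` instead of the actual size of the core set, so that one `η` serves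
all loops. -/
lemma succeeds_evalCore_weights (htau : par.tau = 1) (hγ : par.γ = M.γ) (hm : 0 < par.m)
    (hb : 0 ≤ b) (hlam : 0 < par.lam) (hε : 0 ≤ ε) (hθ : 0 < θ) (hreal : Realizable M F b ε)
    {η : ℝ} (hη : evalError b ε θ (M.γ ^ (par.n + 1) / (1 - M.γ)) par.lam c ≤ η)
    {C : List (CoreElt S A d)} (hC : CoreInv F par.lam C) (hCc : C.length ≤ c)
    {pol : PolicyCode d} {π₁ π₂ : Policy S A}
    (h₁ : Agree F (gram par.lam C)⁻¹ (pol.toPolicy F π₀) π₁)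
    (h₂ : Agree F (gram par.lam C)⁻¹ (pol.toPolicy F π₀) π₂) :
    Succeeds M F π₀ (evalCore par (gram par.lam C)⁻¹ pol C fun _ => 0)
      (fun o => ∀ y, o = .inr y → ∀ s, Certain F (gram par.lam C)⁻¹ s → ∀ a,
        |((gram par.lam C)⁻¹ *ᵥ y) ⬝ᵥ (fun i => F.φ s a i) - qValue M π₁ s a| ≤ η ∧
        |((gram par.lam C)⁻¹ *ᵥ y) ⬝ᵥ (fun i => F.φ s a i) - qValue M π₂ s a| ≤ η)
      (c * batchFailure M par.m θ) := by
  set T := M.γ ^ (par.n + 1) / (1 - M.γ) with hT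
  have hT0 : 0 ≤ T := div_nonneg (pow_nonneg M.γ_pos.le _) M.one_sub_γ_pos.le
  have hmono : b * √par.lam + (ε + (θ + T)) * √C.length + ε ≤ η := by
    refine le_trans ?_ hη
    unfold evalError
    have : √(C.length : ℝ) ≤ √c := Real.sqrt_le_sqrt (Nat.cast_le.2 hCc)
    gcongr
  have hlen : (C.length : ℝ≥0∞) ≤ c := Nat.cast_le.2 hCc
  refine ((succeeds_evalCore htau hγ hm h₁ h₂ hθ C _).imp fun o ho y hy s hs a => ?_).mono
    (mul_le_mul_left hlen _)
  obtain ⟨q, hyq, hq⟩ := ho y hy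
  rw [show y = ∑ k, q k • C[k].φ by rw [hyq]; exact zero_add _]
  obtain ⟨w₁, hw₁, hwq₁⟩ := hreal.exists_dotProduct π₁
  obtain ⟨w₂, hw₂, hwq₂⟩ := hreal.exists_dotProduct π₂
  exact ⟨(abs_weights_sub_qValue_le hb hlam hε (by positivity) hC hw₁ hwq₁
      (fun k => (hq k).1) (hs a)).trans hmono,
    (abs_weights_sub_qValue_le hb hlam hε (by positivity) hC hw₂ hwq₂
      (fun k => (hq k).2) (hs a)).trans hmono⟩

/-- The same numbers `w a` approximate both action value functions, and the two policies average
over the same law of actions at `s`. -/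
lemma abs_value_sub_le {π₁ π₂ : Policy S A} {η : ℝ} {s : S} {w : A → ℝ}
    (hact : π₁.act s = π₂.act s)
    (h : ∀ a, |w a - qValue M π₁ s a| ≤ η ∧ |w a - qValue M π₂ s a| ≤ η) :
    |value M π₁ s - value M π₂ s| ≤ 2 * η := by
  rw [value_eq_integral M π₁, value_eq_integral M π₂, hact]
  refine abs_integral_sub_le (integrable_qValue _ _ _ _) (integrable_qValue _ _ _ _) fun a => ?_
  have h1 := abs_le.1 (h a).1
  have h2 := abs_le.1 (h a).2
  rw [abs_le]
  constructor <;> linarith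

/-- `Tracks` is the invariant along the iterations. The induction starts at one remaining iteration,
whose evaluation is used not to improve a policy but to certify the output. -/
lemma succeeds_policyIteration (htau : par.tau = 1) (hγ : par.γ = M.γ) (hm : 0 < par.m)
    (hb : 0 ≤ b) (hlam : 0 < par.lam) (hε : 0 ≤ ε) (hθ : 0 < θ) (hreal : Realizable M F b ε)
    {η : ℝ} (hη : evalError b ε θ (M.γ ^ (par.n + 1) / (1 - M.γ)) par.lam c ≤ η)
    (hηε : ε ≤ η) (hgap : iterationGap M.γ η (par.K - 1) + 2 * η ≤ gap)
    {C : List (CoreElt S A d)} (hC : CoreInv F par.lam C) (hCc : C.length ≤ c)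
    (hρ : Certain F (gram par.lam C)⁻¹ M.ρ) (j k : ℕ) (hjk : k + (j + 1) = par.K)
    (prev cur : PolicyCode d) (hcur : Tracks M F π₀ (gram par.lam C)⁻¹ η k cur) :
    Succeeds M F π₀ (policyIteration par C (gram par.lam C)⁻¹ (j + 1) prev cur)
      (fun o => ∀ pol, o = .inr pol → GoodPolicy M F π₀ gap pol)
      ((j + 1 : ℕ) * (c * batchFailure M par.m θ)) := by
  have hpol : Nonempty (Policy S A) := ⟨π₀⟩
  induction j generalizing k prev cur with
  | zero =>
    obtain ⟨π, hag, hval⟩ := hcur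
    -- The estimates are coupled with the output policy itself and with its virtual companion.
    have h := succeeds_evalCore_weights (π₀ := π₀) htau hγ hm hb hlam hε hθ hreal hη hC hCc
      (π₁ := cur.toPolicy F π₀) (fun s _ => rfl) hag
    refine Succeeds.mono (Succeeds.bind (spec_evalCore (cφ := 0) _ cur htau C _) h (t' := 0)
      fun o _ ho => ?_) (by simp)
    cases o with
    | inl z => exact succeeds_ret (by simp) _
    | inr y =>
      refine (spec_mulVec (M := M) (F := F) (cφ := 0) _ y).succeeds_bind fun wt _ =>
        succeeds_ret (fun pol hp => ?_) _
      obtain rfl := Sum.inr.inj hp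
      refine (optValue_sub_le (c := iterationGap M.γ η k + 2 * η) fun πs => ?_).trans ?_
      · have h1 := hval πs M.ρ
        have h2 := abs_le.1 (abs_value_sub_le (hag M.ρ hρ) (ho y rfl M.ρ hρ))
        linarith
      · rwa [show k = par.K - 1 by omega]
  | succ j ih =>
    obtain ⟨π, hag, hval⟩ := hcur
    obtain ⟨w, hw, hwq⟩ := hreal.exists_dotProduct π
    have h := succeeds_evalCore_weights (π₀ := π₀) htau hγ hm hb hlam hε hθ hreal hη hC hCc hag hag
    refine Succeeds.mono (Succeeds.bind (spec_evalCore (cφ := 0) _ cur htau C _) h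
      (t' := (j + 1 : ℕ) * (c * batchFailure M par.m θ)) fun o _ ho => ?_)
      (le_of_eq (by push_cast; ring))
    cases o with
    | inl z => exact succeeds_ret (by simp) _
    | inr y =>
      refine (spec_mulVec (M := M) (F := F) (cφ := 0) _ y).succeeds_bind fun wt hwt => ?_
      subst hwt
      -- The realizability weight `w` of the current virtual policy defines the next one off the
      -- certain states.
      refine ih (k + 1) (by omega) cur _ ⟨mixedPolicy F (gram par.lam C)⁻¹ _ w,
        agree_mixedPolicy _ w, fun πs s => ?_⟩
      rw [← iterationGap_succ M.γ_lt_one]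
      exact value_sub_le_of_greedy (value_mixedPolicy _ w)
        (qValue_le_mixedGreedy (fun s hs a => (ho y rfl s hs a).1)
          fun s a => (hwq s a).trans hηε) (fun s => hval πs s) s

lemma le_evalError {trunc lam : ℝ} (hb : 0 ≤ b) (hε : 0 ≤ ε) (hθ : 0 ≤ θ) (ht : 0 ≤ trunc) :
    ε ≤ evalError b ε θ trunc lam c := by
  have : 0 ≤ b * √lam + (ε + (θ + trunc)) * √c := by positivity
  unfold evalError
  linarith

/-- A loop that ends in a restart is not a failure: the virtual policies are discarded and begin
again at `π₀`. Each loop pays for `K` iterations with at most `c` batches. -/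
lemma succeeds_mainLoop (htau : par.tau = 1) (hγ : par.γ = M.γ) (hm : 0 < par.m)
    (hK : 0 < par.K) (hb : 0 ≤ b) (hlam : 0 < par.lam) (hε : 0 ≤ ε) (hθ : 0 < θ)
    (hreal : Realizable M F b ε)
    (hF : ∀ s a, (fun i => F.φ s a i) ⬝ᵥ (fun i => F.φ s a i) ≤ 1)
    (hc : ∀ C : List (CoreElt S A d), ValidCore par.lam C → C.length ≤ c)
    {η : ℝ} (hη : evalError b ε θ (M.γ ^ (par.n + 1) / (1 - M.γ)) par.lam c ≤ η)
    (hgap : iterationGap M.γ η (par.K - 1) + 2 * η ≤ gap) (N : ℕ)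
    (C : List (CoreElt S A d)) (hC : CoreInv F par.lam C)
    (hρ : ∀ a, IsGood par.lam C (fun i => F.φ M.ρ a i)) (hN : c < N + C.length) :
    Succeeds M F π₀ (mainLoop par N C)
      (fun o => ∃ pol, o = some pol ∧ GoodPolicy M F π₀ gap pol)
      (N * (par.K * (c * batchFailure M par.m θ))) := by
  have hηε : ε ≤ η := (le_evalError hb hε hθ.le
    (div_nonneg (pow_nonneg M.γ_pos.le _) M.one_sub_γ_pos.le)).trans hη
  induction N generalizing C with
  | zero => exact absurd (hc C hC.valid) (by omega)
  | succ N ih =>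
    rw [mainLoop]
    change Succeeds M F π₀ ((invGram par.lam C).bind _) _ _
    refine (spec_invGram (M := M) (F := F) (cφ := 0) hlam C).succeeds_bind fun Y hY => ?_
    subst hY
    obtain ⟨j, hj⟩ : ∃ j, par.K = j + 1 := ⟨par.K - 1, by omega⟩
    have h := succeeds_policyIteration (π₀ := π₀) htau hγ hm hb hlam hε hθ hreal hη hηε hgap
      hC (hc C hC.valid) hρ j 0 (by omega) .init .init (tracks_init (hε.trans hηε))
    rw [← hj] at h
    refine Succeeds.mono (Succeeds.bind (spec_policyIteration (cφ := 0) _ htau C par.K .init .init)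
      h (t' := N * (par.K * (c * batchFailure M par.m θ))) fun o ho hg => ?_) ?_
    · cases o with
      | inl z =>
        refine ih (C ++ [z]) (hC.snoc hF (ho z rfl)) (fun a => (hρ a).append hlam z) ?_
        simp only [List.length_append, List.length_singleton]
        omega
      | inr pol => exact succeeds_ret ⟨pol, rfl, hg pol rfl⟩ _
    · push_cast
      apply le_of_eq
      ring

lemma succeeds_confidentMCLSPI (htau : par.tau = 1) (hγ : par.γ = M.γ) (hm : 0 < par.m)
    (hK : 0 < par.K) (hb : 0 ≤ b) (hlam : 0 < par.lam) (hε : 0 ≤ ε) (hθ : 0 < θ)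
    (hreal : Realizable M F b ε)
    (hF : ∀ s a, (fun i => F.φ s a i) ⬝ᵥ (fun i => F.φ s a i) ≤ 1)
    (hc : ∀ C : List (CoreElt S A d), ValidCore par.lam C → C.length ≤ c)
    {η : ℝ} (hη : evalError b ε θ (M.γ ^ (par.n + 1) / (1 - M.γ)) par.lam c ≤ η)
    (hgap : iterationGap M.γ η (par.K - 1) + 2 * η ≤ gap) :
    Succeeds M F π₀ (confidentMCLSPI par M.ρ (c + 1))
      (fun o => ∃ pol, o = some pol ∧ GoodPolicy M F π₀ gap pol)
      ((c + 1 : ℕ) * (par.K * (c * batchFailure M par.m θ))) :=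
  (spec_initCore (M := M) (cφ := 0) htau hlam hF hc M.ρ).succeeds_bind fun C hC =>
    succeeds_mainLoop htau hγ hm hK hb hlam hε hθ hreal hF hc hη hgap (c + 1) C hC.1 hC.2
      (by omega)

lemma guarantee_of_succeeds {cφ : ℕ} {δ maxQ maxC : ℝ} (htau : par.tau = 1) (hlam : 0 < par.lam)
    (hF : ∀ s a, (fun i => F.φ s a i) ⬝ᵥ (fun i => F.φ s a i) ≤ 1)
    (hc : ∀ C : List (CoreElt S A d), ValidCore par.lam C → C.length ≤ c)
    (hQ : (totalQueries par.n par.m par.K c : ℝ) ≤ maxQ)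
    (hC : (totalCost d cφ (Fintype.card A) par.n par.m par.K c : ℝ) ≤ maxC) (hδ : 0 ≤ δ)
    (h : Succeeds M F π₀ (confidentMCLSPI par M.ρ (c + 1))
      (fun o => ∃ pol, o = some pol ∧ GoodPolicy M F π₀ gap pol) (ENNReal.ofReal δ)) :
    Guarantee M F π₀ cφ par δ gap maxQ maxC := by
  refine ⟨c + 1, fun out q k hr => ?_, ?_⟩
  · obtain ⟨h1, h2, h3⟩ := spec_confidentMCLSPI htau hlam hF hc M.ρ _ _ _ hr
    exact ⟨h1, (Nat.cast_le.2 h2).trans hQ, (Nat.cast_le.2 h3).trans hC⟩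
  · rw [ENNReal.ofReal_sub _ hδ, ENNReal.ofReal_one, tsub_le_iff_right]
    exact h

/-- For the degenerate parameters, where every policy meets the target and only termination and
costs remain. -/
lemma guarantee_of_forall_good {cφ : ℕ} {δ maxQ maxC : ℝ} (htau : par.tau = 1)
    (hlam : 0 < par.lam)
    (hF : ∀ s a, (fun i => F.φ s a i) ⬝ᵥ (fun i => F.φ s a i) ≤ 1)
    (hc : ∀ C : List (CoreElt S A d), ValidCore par.lam C → C.length ≤ c)
    (hQ : (totalQueries par.n par.m par.K c : ℝ) ≤ maxQ)
    (hC : (totalCost d cφ (Fintype.card A) par.n par.m par.K c : ℝ) ≤ maxC) (hδ : 0 ≤ δ)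
    (h : ∀ πs π : Policy S A, value M πs M.ρ - value M π M.ρ ≤ gap) :
    Guarantee M F π₀ cφ par δ gap maxQ maxC := by
  have : Nonempty (Policy S A) := ⟨π₀⟩
  refine guarantee_of_succeeds htau hlam hF hc hQ hC hδ
    (((spec_confidentMCLSPI (M := M) (cφ := cφ) htau hlam hF hc M.ρ).succeeds _).imp
      fun o ho => ?_)
  obtain ⟨pol, rfl⟩ := Option.ne_none_iff_exists'.1 ho
  exact ⟨pol, rfl, optValue_sub_le fun πs => h πs _⟩

end Iteration

/-! ## Polynomially bounded quantities -/

section PolynomialBounds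

/-- The nonnegative quantity `f` is bounded by a polynomial in the quantities `V`. -/
def PolyBdd {ι σ : Type*} (V : ι → σ → ℝ) (f : ι → ℝ) : Prop :=
  ∃ P : MvPolynomial σ ℝ, ∀ i, 0 ≤ f i ∧ f i ≤ MvPolynomial.eval (V i) P

variable {ι σ : Type*} {V : ι → σ → ℝ} {f g : ι → ℝ}

lemma PolyBdd.add (hf : PolyBdd V f) (hg : PolyBdd V g) : PolyBdd V fun i => f i + g i := by
  obtain ⟨P, hP⟩ := hf
  obtain ⟨Q, hQ⟩ := hg
  refine ⟨P + Q, fun i => ⟨add_nonneg (hP i).1 (hQ i).1, ?_⟩⟩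
  rw [map_add]
  exact add_le_add (hP i).2 (hQ i).2

/-- Bounds can be multiplied only because `PolyBdd` includes nonnegativity. -/
lemma PolyBdd.mul (hf : PolyBdd V f) (hg : PolyBdd V g) : PolyBdd V fun i => f i * g i := by
  obtain ⟨P, hP⟩ := hf
  obtain ⟨Q, hQ⟩ := hg
  refine ⟨P * Q, fun i => ⟨mul_nonneg (hP i).1 (hQ i).1, ?_⟩⟩
  rw [map_mul]
  exact mul_le_mul (hP i).2 (hQ i).2 (hQ i).1 ((hP i).1.trans (hP i).2)

lemma PolyBdd.mono (hg : PolyBdd V g) (h0 : ∀ i, 0 ≤ f i) (h : ∀ i, f i ≤ g i) :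
    PolyBdd V f := by
  obtain ⟨P, hP⟩ := hg
  exact ⟨P, fun i => ⟨h0 i, (h i).trans (hP i).2⟩⟩

lemma polyBdd_const {a : ℝ} (ha : 0 ≤ a) : PolyBdd V fun _ => a :=
  ⟨MvPolynomial.C a, fun i => ⟨ha, by simp⟩⟩

lemma polyBdd_var (j : σ) (h : ∀ i, 0 ≤ V i j) : PolyBdd V fun i => V i j :=
  ⟨MvPolynomial.X j, fun i => ⟨h i, by simp⟩⟩

/-- Meant for `log b`, which can be negative and enters only through its square. -/
lemma polyBdd_var_sq (j : σ) : PolyBdd V fun i => V i j ^ 2 :=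
  ⟨MvPolynomial.X j ^ 2, fun i => ⟨sq_nonneg _, by simp⟩⟩

lemma PolyBdd.pow (hf : PolyBdd V f) (k : ℕ) : PolyBdd V fun i => f i ^ k := by
  induction k with
  | zero => simpa using polyBdd_const zero_le_one
  | succ k ih => simpa only [pow_succ] using ih.mul hf

lemma PolyBdd.ceil (hg : PolyBdd V g) (h : ∀ i, f i ≤ g i) :
    PolyBdd V fun i => ((⌈f i⌉₊ : ℕ) : ℝ) := by
  have hg0 : ∀ i, 0 ≤ g i := fun i => by
    obtain ⟨P, hP⟩ := hg
    exact (hP i).1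
  refine (hg.add (polyBdd_const zero_le_one)).mono (fun i => Nat.cast_nonneg _) fun i => ?_
  exact (Nat.cast_le.2 (Nat.ceil_le_ceil (h i))).trans (Nat.ceil_lt_add_one (hg0 i)).le

lemma PolyBdd.floor (hg : PolyBdd V g) : PolyBdd V fun i => ((⌊g i⌋₊ : ℕ) : ℝ) := by
  refine hg.mono (fun i => Nat.cast_nonneg _) fun i => Nat.floor_le ?_
  obtain ⟨P, hP⟩ := hg
  exact (hP i).1

lemma polyBdd_natPolynomial {d : ι → ℕ} (hd : PolyBdd V fun i => (d i : ℝ)) (p : Polynomial ℕ) :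
    PolyBdd V fun i => ((p.eval (d i) : ℕ) : ℝ) := by
  induction p using Polynomial.induction_on' with
  | add p q hp hq => simpa only [Polynomial.eval_add, Nat.cast_add] using hp.add hq
  | monomial k a =>
    simpa only [Polynomial.eval_monomial, Nat.cast_mul, Nat.cast_pow] using
      (polyBdd_const (Nat.cast_nonneg a)).mul (hd.pow k)

lemma polyBdd_totalQueries {n m K c : ι → ℕ} (hn : PolyBdd V fun i => (n i : ℝ))
    (hm : PolyBdd V fun i => (m i : ℝ)) (hK : PolyBdd V fun i => (K i : ℝ))
    (hc : PolyBdd V fun i => (c i : ℝ)) :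
    PolyBdd V fun i => (totalQueries (n i) (m i) (K i) (c i) : ℝ) := by
  have h1 : PolyBdd V fun _ => (1 : ℝ) := polyBdd_const zero_le_one
  simp only [totalQueries, Nat.cast_add, Nat.cast_mul, Nat.cast_one]
  exact (hc.add h1).mul (hK.mul (hc.mul (hm.mul (hn.add h1))))

lemma polyBdd_totalCost {d cφ nA n m K c : ι → ℕ} (hd : PolyBdd V fun i => (d i : ℝ))
    (hφ : PolyBdd V fun i => (cφ i : ℝ)) (hA : PolyBdd V fun i => (nA i : ℝ))
    (hn : PolyBdd V fun i => (n i : ℝ))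
    (hm : PolyBdd V fun i => (m i : ℝ)) (hK : PolyBdd V fun i => (K i : ℝ))
    (hc : PolyBdd V fun i => (c i : ℝ)) :
    PolyBdd V fun i => (totalCost (d i) (cφ i) (nA i) (n i) (m i) (K i) (c i) : ℝ) := by
  simp only [totalCost, initCost, loopCost, iterCost, evalCost, batchCost, rolloutCost, chooseCost,
    findCost, invCost, updateCost, quadCost, Nat.cast_add, Nat.cast_mul, Nat.cast_one,
    Nat.cast_ofNat]
  repeat' first
    | assumption
    | exact polyBdd_const (by norm_num)
    | apply PolyBdd.add
    | apply PolyBdd.mul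

end PolynomialBounds

/-! ## The parameters -/

section Parameters

lemma log_one_add_sq_le {b : ℝ} (hb : 0 < b) : Real.log (1 + b ^ 2) ≤ 2 + Real.log b ^ 2 := by
  have hl2 : Real.log 2 ≤ 1 := by linarith [Real.log_two_lt_d9]
  rcases le_total b 1 with h | h
  · have : Real.log (1 + b ^ 2) ≤ Real.log 2 := Real.log_le_log (by positivity) (by nlinarith)
    nlinarith [sq_nonneg (Real.log b)]
  · have : Real.log (1 + b ^ 2) ≤ Real.log (2 * b ^ 2) :=
      Real.log_le_log (by positivity) (by nlinarith)
    rw [Real.log_mul (by norm_num) (by positivity), Real.log_pow] at this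
    push_cast at this
    nlinarith [sq_nonneg (Real.log b - 1)]

/-- Separates `b` from `y`: the final polynomial may contain `b` only through `log b`, while `y` may
enter linearly. -/
lemma log_one_add_mul_le {b y : ℝ} (hb : 0 < b) (hy : 0 ≤ y) :
    Real.log (1 + b ^ 2 * y) ≤ 2 + Real.log b ^ 2 + y := by
  have h1 : Real.log (1 + b ^ 2 * y) ≤ Real.log ((1 + b ^ 2) * (1 + y)) :=
    Real.log_le_log (by positivity) (by nlinarith [sq_nonneg b])
  rw [Real.log_mul (by positivity) (by positivity)] at h1
  have h2 := Real.log_le_sub_one_of_pos (x := 1 + y) (by positivity)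
  linarith [log_one_add_sq_le hb]

/-- Keeps `1 / δ` inside the logarithm. The case `y = 0` is included because `K` can be `0`. -/
lemma log_div_le {y δ : ℝ} (hy : 0 ≤ y) (hδ : 0 < δ) (hδ1 : δ < 1) :
    Real.log (y / δ) ≤ y + Real.log (1 / δ) := by
  have h0 : 0 ≤ Real.log (1 / δ) := Real.log_nonneg (by rw [le_div_iff₀ hδ]; linarith)
  rcases hy.eq_or_lt with rfl | hy'
  · simpa using h0
  · rw [div_eq_mul_one_div, Real.log_mul hy'.ne' (by positivity)]
    linarith [Real.log_le_self hy]

/-- The bound on the size of the core set. -/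
def coreBound (d : ℕ) (lam : ℝ) : ℕ := ⌊3 * (d * (1 + Real.log (1 + lam⁻¹)))⌋₊

lemma log_one_add_inv_nonneg {lam : ℝ} (h : 0 < lam) : 0 ≤ Real.log (1 + lam⁻¹) :=
  Real.log_nonneg (by linarith [inv_pos.2 h])

lemma pow_le_exp {γ : ℝ} (h0 : 0 < γ) {x : ℝ} {k : ℕ} (h1 : γ < 1) (hx : x ≤ k) :
    γ ^ k ≤ Real.exp (-((1 - γ) * x)) := by
  have h2 : γ ≤ Real.exp (-(1 - γ)) := by linarith [Real.add_one_le_exp (-(1 - γ))]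
  refine (pow_le_pow_left₀ h0.le h2 k).trans ?_
  rw [← Real.exp_nat_mul]
  refine Real.exp_le_exp.2 ?_
  have := mul_le_mul_of_nonneg_left hx (sub_pos.2 h1).le
  linarith

/-- The total failure probability. -/
lemma failure_le {γ δ Y T θ : ℝ} {c K m : ℕ} (hδ : 0 < δ) (hδ1 : δ < 1) (hY : 1 ≤ Y)
    (hK : 0 < K) (hc : (c : ℝ) ≤ 3 * Y) (hT : T = 8 * K * Y / δ)
    (hexp : 2 * Real.log T ≤ 2 * m * θ ^ 2 / (1 / (1 - γ)) ^ 2) :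
    ((c + 1 : ℕ) : ℝ≥0∞) * (K * (c *
      (4 * ENNReal.ofReal (Real.exp (-(2 * m * θ ^ 2 / (1 / (1 - γ)) ^ 2)))))) ≤
      ENNReal.ofReal δ := by
  have hK' : (1 : ℝ) ≤ K := by exact_mod_cast hK
  have hT0 : 0 < T := by rw [hT]; positivity
  have h1 : Real.exp (-(2 * m * θ ^ 2 / (1 / (1 - γ)) ^ 2)) ≤ (T ^ 2)⁻¹ := by
    rw [← Real.exp_log (inv_pos.2 (pow_pos hT0 2)), Real.log_inv, Real.log_pow]
    refine Real.exp_le_exp.2 ?_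
    push_cast
    linarith
  have h2 : ((c + 1 : ℕ) : ℝ≥0∞) * (K * (c *
      (4 * ENNReal.ofReal (Real.exp (-(2 * m * θ ^ 2 / (1 / (1 - γ)) ^ 2)))))) =
      ENNReal.ofReal ((c + 1 : ℕ) * (K * (c *
        (4 * Real.exp (-(2 * m * θ ^ 2 / (1 / (1 - γ)) ^ 2)))))) := by
    rw [ENNReal.ofReal_mul (by positivity), ENNReal.ofReal_mul (by positivity),
      ENNReal.ofReal_mul (by positivity), ENNReal.ofReal_mul (by positivity),
      ENNReal.ofReal_natCast, ENNReal.ofReal_natCast, ENNReal.ofReal_natCast]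
    norm_num
  rw [h2]
  refine ENNReal.ofReal_le_ofReal ?_
  -- `c + 1 ≤ 4 * Y` and `c ≤ 3 * Y` give `48 * K * Y ^ 2 / T ^ 2`; the square of `T` absorbs both
  -- factors from the core set.
  calc ((c + 1 : ℕ) : ℝ) * (K * (c * (4 * Real.exp (-(2 * m * θ ^ 2 / (1 / (1 - γ)) ^ 2)))))
      ≤ (4 * Y) * (K * ((3 * Y) * (4 * (T ^ 2)⁻¹))) := by
        gcongr
        push_cast; linarith
    _ = 3 / 4 * δ ^ 2 / K := by rw [hT]; field_simp; ring
    _ ≤ δ := by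
        rw [div_le_iff₀ (by positivity)]
        nlinarith

lemma coreBound_le {d : ℕ} {lam : ℝ} (h : 0 < lam) :
    (coreBound d lam : ℝ) ≤ 3 * (d * (1 + Real.log (1 + lam⁻¹))) :=
  Nat.floor_le (by have := log_one_add_inv_nonneg h; positivity)

lemma one_le_mul_log {d : ℕ} (hd : 0 < d) {lam : ℝ} (h : 0 < lam) :
    1 ≤ d * (1 + Real.log (1 + lam⁻¹)) := by
  have h1 : (1 : ℝ) ≤ d := by exact_mod_cast hd
  nlinarith [log_one_add_inv_nonneg h]

end Parameters

/-! ### Polynomial bounds on the parameters -/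

section Bounds

variable {ι σ : Type*} {V : ι → σ → ℝ}

lemma polyBdd_exactParams {d : ι → ℕ} {γ b κ δ : ι → ℝ}
    (hγ1 : ∀ i, γ i < 1) (hb : ∀ i, 0 < b i) (hκ0 : ∀ i, 0 < κ i)
    (hδ0 : ∀ i, 0 < δ i) (hδ1 : ∀ i, δ i < 1)
    (pd : PolyBdd V fun i => (d i : ℝ)) (pg : PolyBdd V fun i => 1 / (1 - γ i))
    (pk : PolyBdd V fun i => 1 / κ i) (pl : PolyBdd V fun i => Real.log (1 / δ i))
    (pb : PolyBdd V fun i => Real.log (b i) ^ 2) :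
    PolyBdd V (fun i => ((exactParams (d i) (γ i) (b i) (κ i) (δ i)).n : ℝ)) ∧
    PolyBdd V (fun i => ((exactParams (d i) (γ i) (b i) (κ i) (δ i)).m : ℝ)) ∧
    PolyBdd V (fun i => ((exactParams (d i) (γ i) (b i) (κ i) (δ i)).K : ℝ)) ∧
    PolyBdd V (fun i =>
      (coreBound (d i) (exactParams (d i) (γ i) (b i) (κ i) (δ i)).lam : ℝ)) := by
  have pc : ∀ {a : ℝ}, 0 ≤ a → PolyBdd V fun _ => a := fun h => polyBdd_const h
  have hg : ∀ i, 0 < 1 - γ i := fun i => sub_pos.2 (hγ1 i)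
  have hlam : ∀ i, 0 < κ i ^ 2 * (1 - γ i) ^ 4 / (1024 * b i ^ 2) := fun i => by
    have := hg i; have := hκ0 i; have := hb i
    positivity
  have pΛ : PolyBdd V fun i =>
      Real.log (1 + (κ i ^ 2 * (1 - γ i) ^ 4 / (1024 * b i ^ 2))⁻¹) := by
    refine (((pc zero_le_two).add pb).add ((pc (a := 1024) (by norm_num)).mul
      ((pg.pow 4).mul (pk.pow 2)))).mono (fun i => log_one_add_inv_nonneg (hlam i)) fun i => ?_
    have hg := hg i; have hκ := hκ0 i
    have h := log_one_add_mul_le (y := 1024 * ((1 / (1 - γ i)) ^ 4 * (1 / κ i) ^ 2)) (hb i)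
      (by positivity)
    refine le_trans (le_of_eq ?_) h
    congr 2
    have := (hb i).ne'
    field_simp
  have pL := (pc zero_le_one).add pΛ
  have pY := pd.mul pL
  have pK : PolyBdd V (fun i => ((exactParams (d i) (γ i) (b i) (κ i) (δ i)).K : ℝ)) := by
    refine ((pc zero_le_two).add (((pc zero_le_two).mul pg).mul (((pc (a := 3)
      (by norm_num)).mul pg).mul pk))).ceil fun i => ?_
    have hg := hg i; have hκ := hκ0 i
    have h1 : Real.log (3 / (κ i * (1 - γ i))) ≤ 3 * (1 / (1 - γ i)) * (1 / κ i) :=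
      (Real.log_le_self (by positivity)).trans (le_of_eq (by field_simp))
    rw [show 2 / (1 - γ i) = 2 * (1 / (1 - γ i)) by ring]
    gcongr
  refine ⟨?_, ?_, pK, ?_⟩
  · refine (((pc (a := 3) (by norm_num)).mul pg).mul (((pc (a := 4) (by norm_num)).mul
      ((pc zero_le_one).add (pΛ.mul pd))).mul (pk.mul pg))).ceil fun i => ?_
    have hg := hg i; have hκ := hκ0 i
    have hΛ := log_one_add_inv_nonneg (hlam i)
    rw [show 3 / (1 - γ i) = 3 * (1 / (1 - γ i)) by ring]
    refine mul_le_mul_of_nonneg_left ?_ (by positivity)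
    exact (Real.log_le_self (by positivity)).trans (le_of_eq (by field_simp))
  · refine (((pc (a := 4096) (by norm_num)).mul (pY.mul ((pk.pow 2).mul (pg.pow 6)))).mul
      ((((pc (a := 8) (by norm_num)).mul pK).mul pd).mul pL |>.add pl)).ceil fun i => ?_
    have hg := hg i; have hκ := hκ0 i
    have hΛ := log_one_add_inv_nonneg (hlam i)
    have h1 : ∀ y : ℝ, y / (κ i ^ 2 * (1 - γ i) ^ 6) =
        y * ((1 / κ i) ^ 2 * (1 / (1 - γ i)) ^ 6) := fun y => by field_simp
    rw [h1]
    refine mul_le_mul_of_nonneg_left ?_ (by positivity)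
    exact log_div_le (by positivity) (hδ0 i) (hδ1 i)
  · exact ((pc (a := 3) (by norm_num)).mul pY).floor

lemma polyBdd_approxParams {d : ι → ℕ} {γ b ε δ : ι → ℝ} (hd : ∀ i, 0 < d i)
    (hγ1 : ∀ i, γ i < 1) (hb : ∀ i, 0 < b i) (hε : ∀ i, 0 < ε i)
    (hδ0 : ∀ i, 0 < δ i) (hδ1 : ∀ i, δ i < 1)
    (pd : PolyBdd V fun i => (d i : ℝ)) (pg : PolyBdd V fun i => 1 / (1 - γ i))
    (pe : PolyBdd V fun i => 1 / ε i) (pl : PolyBdd V fun i => Real.log (1 / δ i))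
    (pb : PolyBdd V fun i => Real.log (b i) ^ 2) :
    PolyBdd V (fun i => ((approxParams (d i) (γ i) (b i) (ε i) (δ i)).n : ℝ)) ∧
    PolyBdd V (fun i => ((approxParams (d i) (γ i) (b i) (ε i) (δ i)).m : ℝ)) ∧
    PolyBdd V (fun i => ((approxParams (d i) (γ i) (b i) (ε i) (δ i)).K : ℝ)) ∧
    PolyBdd V (fun i =>
      (coreBound (d i) (approxParams (d i) (γ i) (b i) (ε i) (δ i)).lam : ℝ)) := by
  have pc : ∀ {a : ℝ}, 0 ≤ a → PolyBdd V fun _ => a := fun h => polyBdd_const h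
  have hg : ∀ i, 0 < 1 - γ i := fun i => sub_pos.2 (hγ1 i)
  have hd1 : ∀ i, (1 : ℝ) ≤ d i := fun i => by exact_mod_cast hd i
  have hlam : ∀ i, 0 < ε i ^ 2 * d i / b i ^ 2 := fun i => by
    have := hε i; have := hb i; have := hd1 i
    positivity
  have pΛ : PolyBdd V fun i => Real.log (1 + (ε i ^ 2 * d i / b i ^ 2)⁻¹) := by
    refine (((pc zero_le_two).add pb).add (pe.pow 2)).mono
      (fun i => log_one_add_inv_nonneg (hlam i)) fun i => ?_
    have hε := hε i
    have h := log_one_add_mul_le (y := (1 / ε i) ^ 2) (hb i) (by positivity)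
    refine le_trans (Real.log_le_log (by have := hlam i; positivity) ?_) h
    have h1 : (ε i ^ 2 * d i / b i ^ 2)⁻¹ = b i ^ 2 * (1 / ε i) ^ 2 / d i := by
      have := (hb i).ne'; have := hd1 i
      field_simp
    rw [h1]
    gcongr
    exact div_le_self (by positivity) (hd1 i)
  have pL := (pc zero_le_one).add pΛ
  have pK : PolyBdd V (fun i => ((approxParams (d i) (γ i) (b i) (ε i) (δ i)).K : ℝ)) := by
    refine ((pc zero_le_two).add (pg.mul pe)).ceil fun i => ?_
    have hg := hg i; have hε := hε i
    have h1 : Real.log (1 / (ε i * √(d i))) ≤ 1 / ε i := by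
      have hs : 1 ≤ √(d i : ℝ) := Real.one_le_sqrt.2 (hd1 i)
      refine (Real.log_le_self (by positivity)).trans ?_
      exact one_div_le_one_div_of_le hε (le_mul_of_one_le_right hε.le hs)
    gcongr
  refine ⟨?_, ?_, pK, ?_⟩
  · refine (pg.mul (pe.mul pg)).ceil fun i => ?_
    have hg := hg i; have hε := hε i
    refine mul_le_mul_of_nonneg_left ?_ (by positivity)
    exact (Real.log_le_self (by positivity)).trans (le_of_eq (by field_simp))
  · refine (((pe.pow 2).mul (pg.pow 2)).mul
      ((((pc (a := 8) (by norm_num)).mul pK).mul pd).mul pL |>.add pl)).ceil fun i => ?_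
    have hg := hg i; have hε := hε i
    have hΛ := log_one_add_inv_nonneg (hlam i)
    rw [show 1 / (ε i ^ 2 * (1 - γ i) ^ 2) = (1 / ε i) ^ 2 * (1 / (1 - γ i)) ^ 2 by field_simp]
    refine mul_le_mul_of_nonneg_left ?_ (by positivity)
    exact log_div_le (by positivity) (hδ0 i) (hδ1 i)
  · exact ((pc (a := 3) (by norm_num)).mul (pd.mul pL)).floor

end Bounds

/-! ### Numerical estimates behind the constants -/

section Numerics

/-- Since `γ ≤ exp (-(1 - γ))`, a horizon of `p * log z / (1 - γ)` gains the factor `z⁻¹ ^ p`. -/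
lemma pow_le_inv_pow {γ z : ℝ} {k p : ℕ} (hγ0 : 0 < γ) (hγ1 : γ < 1) (hz : 0 < z)
    (h : p / (1 - γ) * Real.log z ≤ k) : γ ^ k ≤ z⁻¹ ^ p := by
  have hg : 1 - γ ≠ 0 := (sub_pos.2 hγ1).ne'
  have h1 : -((1 - γ) * (p / (1 - γ) * Real.log z)) = Real.log (z⁻¹ ^ p) := by
    rw [Real.log_pow, Real.log_inv]
    field_simp
  refine (pow_le_exp hγ0 hγ1 h).trans (le_of_eq ?_)
  rw [h1, Real.exp_log (by positivity)]

/-- `κ < b` forces `λ ≤ 1 / 1024`. The lower bound makes `y = 1 + Λ d` at least `3` and comparable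
with `d (1 + Λ)`. -/
lemma two_le_log_exact {γ κ b lam : ℝ} (hγ0 : 0 < γ) (hγ1 : γ < 1) (hκ0 : 0 < κ) (hbκ : κ < b)
    (hlam : lam = κ ^ 2 * (1 - γ) ^ 4 / (1024 * b ^ 2)) : 2 ≤ Real.log (1 + lam⁻¹) := by
  have hg : 0 < 1 - γ := sub_pos.2 hγ1
  have hb : 0 < b := hκ0.trans hbκ
  have h2 : 1024 ≤ lam⁻¹ := by
    rw [hlam, inv_div, le_div_iff₀ (by positivity)]
    have h3 : κ ^ 2 ≤ b ^ 2 := pow_le_pow_left₀ hκ0.le hbκ.le 2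
    have h4 : (1 - γ) ^ 4 ≤ 1 := pow_le_one₀ hg.le (by linarith)
    have := mul_le_mul h3 h4 (by positivity) (by positivity)
    linarith
  rw [Real.le_log_iff_exp_le (by linarith)]
  have h1 : Real.exp 2 ≤ 9 := by
    have : Real.exp 2 = Real.exp 1 ^ 2 := by rw [← Real.exp_nat_mul]; norm_num
    rw [this]
    nlinarith [Real.exp_one_lt_d9, Real.exp_pos 1]
  linarith

/-- The factor `3` in `n` yields a cube, enough to beat both `1 / (1 - γ)` and `√c`. -/
lemma truncation_exact_le {γ κ y : ℝ} {n : ℕ} (hγ0 : 0 < γ) (hγ1 : γ < 1) (hκ0 : 0 < κ)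
    (hκ1 : κ ≤ 1) (hy : 0 < y)
    (hn : 3 / (1 - γ) * Real.log (4 * y / (κ * (1 - γ))) ≤ n) :
    γ ^ (n + 1) / (1 - γ) ≤ κ * (1 - γ) ^ 2 / (64 * y ^ 3) := by
  have hg : 0 < 1 - γ := sub_pos.2 hγ1
  have h1 := pow_le_inv_pow (p := 3) (k := n) (z := 4 * y / (κ * (1 - γ))) hγ0 hγ1
    (by positivity) (by exact_mod_cast hn)
  rw [inv_div] at h1
  rw [div_le_iff₀ hg, pow_succ]
  refine (mul_le_of_le_one_right (by positivity) hγ1.le).trans (h1.trans ?_)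
  have h4 : (κ * (1 - γ) / (4 * y)) ^ 3 =
      κ * (1 - γ) ^ 2 / (64 * y ^ 3) * (1 - γ) * κ ^ 2 := by
    field_simp; ring
  rw [h4]
  exact mul_le_of_le_one_right (by positivity) (pow_le_one₀ hκ0.le hκ1)

/-- In units of `κ * (1 - γ) ^ 2`: regularization `1/32`, sampling `1.74/64`, truncation `1.5/576`,
together below `1/16`. -/
lemma evalError_exact_le {γ κ b Y y T lam : ℝ} {c : ℕ} (hγ1 : γ < 1) (hκ0 : 0 < κ)
    (hb : 0 < b) (hlam : lam = κ ^ 2 * (1 - γ) ^ 4 / (1024 * b ^ 2)) (hY : 1 ≤ Y)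
    (hcY : (c : ℝ) ≤ 3 * Y) (hy : 3 ≤ y) (hYy : Y ≤ 2 * y)
    (hT : T ≤ κ * (1 - γ) ^ 2 / (64 * y ^ 3)) :
    evalError b 0 (κ * (1 - γ) ^ 2 / (64 * √Y)) T lam c ≤ κ * (1 - γ) ^ 2 / 16 := by
  have hg : 0 < 1 - γ := sub_pos.2 hγ1
  have h1 : b * √lam = κ * (1 - γ) ^ 2 / 32 := by
    have : lam = (κ * (1 - γ) ^ 2 / (32 * b)) ^ 2 := by rw [hlam]; field_simp; ring
    rw [this, Real.sqrt_sq (by positivity)]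
    field_simp
  have hG0 : 0 < κ * (1 - γ) ^ 2 := by positivity
  clear hlam
  generalize κ * (1 - γ) ^ 2 = G at *
  have hsY : 0 < √Y := Real.sqrt_pos.2 (by linarith)
  have h2 : √(c : ℝ) ≤ 1.74 * √Y := by
    have h3 : √(3 : ℝ) ≤ 1.74 := Real.sqrt_le_iff.2 (by norm_num)
    refine (Real.sqrt_le_sqrt hcY).trans ?_
    rw [Real.sqrt_mul (by norm_num)]
    exact mul_le_mul_of_nonneg_right h3 hsY.le
  have h4 : G / (64 * √Y) * √(c : ℝ) ≤ G * (1.74 / 64) := by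
    refine (mul_le_mul_of_nonneg_left h2 (by positivity)).trans (le_of_eq ?_)
    field_simp
  -- `c ≤ 6 * y ≤ (1.5 * y) ^ 2`, as `y ≥ 3`.
  have h6 : √(c : ℝ) ≤ 1.5 * y := by
    refine Real.sqrt_le_iff.2 ⟨by linarith, ?_⟩
    nlinarith
  have h5 : T * √(c : ℝ) ≤ G * (1.5 / 576) := by
    calc T * √(c : ℝ) ≤ G / (64 * y ^ 3) * (1.5 * y) :=
          mul_le_mul hT h6 (Real.sqrt_nonneg _) (by positivity)
      _ = G * (1.5 / (64 * y ^ 2)) := by field_simp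
      _ ≤ G * (1.5 / 576) := by
          gcongr
          nlinarith
  unfold evalError
  rw [h1, zero_add, add_mul, add_zero]
  linarith

/-- At most `κ / 9` from the initial gap, `κ / 8` from the accumulated evaluation errors and `κ / 8`
from the passage to the real policy. -/
lemma iterationGap_exact_le {γ κ : ℝ} {k : ℕ} (hγ0 : 0 < γ) (hγ1 : γ < 1) (hκ0 : 0 < κ)
    (hκ1 : κ ≤ 1) (hk : 2 / (1 - γ) * Real.log (3 / (κ * (1 - γ))) ≤ k) :
    iterationGap γ (κ * (1 - γ) ^ 2 / 16) k + 2 * (κ * (1 - γ) ^ 2 / 16) ≤ κ := by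
  have hg : 0 < 1 - γ := sub_pos.2 hγ1
  have h1 := pow_le_inv_pow (p := 2) (k := k) (z := 3 / (κ * (1 - γ))) hγ0 hγ1
    (by positivity) (by exact_mod_cast hk)
  rw [inv_div] at h1
  have h3 : γ ^ k / (1 - γ) ≤ κ / 9 := by
    rw [div_le_iff₀ hg]
    refine h1.trans ?_
    have : (κ * (1 - γ) / 3) ^ 2 = κ / 9 * (1 - γ) * (κ * (1 - γ)) := by ring
    rw [this]
    exact mul_le_of_le_one_right (by positivity) (mul_le_one₀ hκ1 hg.le (by linarith))
  have h4 : 2 * (κ * (1 - γ) ^ 2 / 16) / (1 - γ) ^ 2 = κ / 8 := by field_simp; ring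
  have h5 : κ * (1 - γ) ^ 2 ≤ κ :=
    mul_le_of_le_one_right hκ0.le (pow_le_one₀ hg.le (by linarith))
  unfold iterationGap
  rw [h4]
  linarith

lemma truncation_approx_le {γ ε : ℝ} {n : ℕ} (hγ0 : 0 < γ) (hγ1 : γ < 1) (hε : 0 < ε)
    (hn : 1 / (1 - γ) * Real.log (1 / (ε * (1 - γ))) ≤ n) : γ ^ (n + 1) / (1 - γ) ≤ ε := by
  have hg : 0 < 1 - γ := sub_pos.2 hγ1
  have h1 := pow_le_inv_pow (p := 1) (k := n) (z := 1 / (ε * (1 - γ))) hγ0 hγ1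
    (by positivity) (by exact_mod_cast hn)
  rw [inv_div, pow_one, div_one] at h1
  rw [div_le_iff₀ hg, pow_succ]
  exact (mul_le_of_le_one_right (by positivity) hγ1.le).trans h1

/-- In units of `ε * √D * L`: regularization `1`, core-set error `5.22`, misspecification at the
evaluated pair `1`. -/
lemma evalError_approx_le {ε b T lam L D : ℝ} {c : ℕ} (hε : 0 < ε) (hb : 0 < b) (hD : 1 ≤ D)
    (hlam : lam = ε ^ 2 * D / b ^ 2) (hL : 1 ≤ L) (hcY : (c : ℝ) ≤ 3 * (D * L)) (hT : T ≤ ε) :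
    evalError b ε ε T lam c ≤ 8 * (ε * √D * L) := by
  have hs1 : 1 ≤ √D := Real.one_le_sqrt.2 hD
  have h1 : b * √lam = ε * √D := by
    rw [hlam, Real.sqrt_div (by positivity), Real.sqrt_mul (by positivity), Real.sqrt_sq hε.le,
      Real.sqrt_sq hb.le]
    field_simp
  have h2 : √(c : ℝ) ≤ 1.74 * (√D * L) := by
    refine Real.sqrt_le_iff.2 ⟨by positivity, hcY.trans ?_⟩
    rw [mul_pow, mul_pow, Real.sq_sqrt (by linarith)]
    have h3 : D * L ≤ D * L ^ 2 := by gcongr; nlinarith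
    have h4 : 0 ≤ D * L ^ 2 := by positivity
    linarith
  have h3 : (ε + (ε + T)) * √(c : ℝ) ≤ 3 * ε * (1.74 * (√D * L)) :=
    mul_le_mul (by linarith) h2 (Real.sqrt_nonneg _) (by positivity)
  have h4 : 3 * ε * (1.74 * (√D * L)) = 5.22 * (ε * √D * L) := by ring
  have h5 : ε * √D ≤ ε * √D * L := le_mul_of_one_le_right (by positivity) hL
  have h6 : ε ≤ ε * √D := le_mul_of_one_le_right hε.le hs1
  unfold evalError
  rw [h1]
  linarith

/-- In units of `B / (1 - γ) ^ 2` the three terms are at most `1`, `16` and `16`, well below `74`.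
-/
lemma iterationGap_approx_le {γ z B : ℝ} {k : ℕ} (hγ0 : 0 < γ) (hγ1 : γ < 1) (hz : 0 < z)
    (hzB : z ≤ B) (hk : 1 / (1 - γ) * Real.log (1 / z) ≤ k) :
    iterationGap γ (8 * B) k + 2 * (8 * B) ≤ 74 * B / (1 - γ) ^ 2 := by
  have hg : 0 < 1 - γ := sub_pos.2 hγ1
  have hB0 : 0 < B := hz.trans_le hzB
  have h1 := pow_le_inv_pow (p := 1) (k := k) (z := 1 / z) hγ0 hγ1
    (by positivity) (by exact_mod_cast hk)
  rw [inv_div, pow_one, div_one] at h1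
  have hsq : (1 - γ) ^ 2 ≤ 1 := pow_le_one₀ hg.le (by linarith)
  have h4 : γ ^ k / (1 - γ) ≤ B / (1 - γ) ^ 2 := by
    rw [div_le_div_iff₀ hg (by positivity)]
    have h5 : (1 - γ) ^ 2 ≤ 1 - γ := by nlinarith
    exact mul_le_mul (h1.trans hzB) h5 (by positivity) hB0.le
  have h5 : B ≤ B / (1 - γ) ^ 2 := by
    rw [le_div_iff₀ (by positivity)]
    exact mul_le_of_le_one_right hB0.le hsq
  have h6 : 2 * (8 * B) / (1 - γ) ^ 2 = 16 * (B / (1 - γ) ^ 2) := by ring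
  have h7 : 74 * B / (1 - γ) ^ 2 = 74 * (B / (1 - γ) ^ 2) := by ring
  unfold iterationGap
  rw [h6, h7]
  linarith

end Numerics

/-! ### The two guarantees for fixed parameters -/

section Guarantees

universe u v
variable {S : Type u} {A : Type v} {d : ℕ} [MeasurableSpace S] [MeasurableSpace A] [Fintype A]
  [LinearOrder A] [Nonempty A] [MeasurableSingletonClass A]
  {M : MDP S A} {F : Features S A d} {π₀ : Policy S A}

set_option linter.unusedSectionVars false in
lemma length_le_coreBound {lam : ℝ} (hlam : 0 < lam) (hd : 0 < d) (C : List (CoreElt S A d))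
    (hC : ValidCore lam C) : C.length ≤ coreBound d lam :=
  Nat.le_floor (hC.length_le hlam hd)

lemma guarantee_exactParams {b κ δ maxQ maxC : ℝ} {cφ : ℕ} (hd : 0 < d)
    (hF : ∀ s a, ‖F.φ s a‖ ≤ 1) (hb : 0 < b) (hreal : Realizable M F b 0) (hκ0 : 0 < κ)
    (hκ1 : κ ≤ 1) (hδ0 : 0 < δ) (hδ1 : δ < 1) {par : Params}
    (hpar : par = exactParams d M.γ b κ δ)
    (hQ : (totalQueries par.n par.m par.K (coreBound d par.lam) : ℝ) ≤ maxQ)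
    (hC : (totalCost d cφ (Fintype.card A) par.n par.m par.K (coreBound d par.lam) : ℝ) ≤ maxC) :
    Guarantee M F π₀ cφ par δ κ maxQ maxC := by
  have hg := M.one_sub_γ_pos
  have hγ0 := M.γ_pos
  have htau : par.tau = 1 := by rw [hpar]; rfl
  have hlam : par.lam = κ ^ 2 * (1 - M.γ) ^ 4 / (1024 * b ^ 2) := by rw [hpar]; rfl
  have hlam0 : 0 < par.lam := by rw [hlam]; positivity
  have hF' := dotProduct_features_le hF
  -- If `b ≤ κ`, exact realizability bounds all values by `b`, so any output will do. The other case
  -- provides `Λ ≥ 2`.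
  rcases le_or_gt b κ with hbκ | hbκ
  · refine guarantee_of_forall_good htau hlam0 hF' (length_le_coreBound hlam0 hd) hQ hC hδ0.le
      fun πs π => ?_
    have h1 : value M πs M.ρ ≤ b := by
      rw [value_eq_integral]
      refine (integral_mem_of_forall_mem (integrable_qValue M πs _ _) (l := 0)
        (fun a => (qValue_mem M πs _ a).1) fun a => ?_).2
      obtain ⟨w, h1, h2⟩ := hreal πs
      have h3 := (abs_le.1 (h2 M.ρ a)).2
      have h4 := real_inner_le_norm w (F.φ M.ρ a)
      have h5 : ‖w‖ * ‖F.φ M.ρ a‖ ≤ b * 1 :=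
        mul_le_mul h1 (hF _ _) (norm_nonneg _) hb.le
      linarith
    linarith [(value_mem M π M.ρ).1]
  set c := coreBound d par.lam with hc
  set Λ := Real.log (1 + par.lam⁻¹) with hΛ
  set Y : ℝ := d * (1 + Λ) with hY
  have hY1 : 1 ≤ Y := one_le_mul_log hd hlam0
  have hcY : (c : ℝ) ≤ 3 * Y := coreBound_le hlam0
  have hd1 : (1 : ℝ) ≤ d := by exact_mod_cast hd
  have hK : (par.K : ℝ) ≥ 2 + 2 / (1 - M.γ) * Real.log (3 / (κ * (1 - M.γ))) := by
    rw [hpar]; exact Nat.le_ceil _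
  have hn : (par.n : ℝ) ≥ 3 / (1 - M.γ) * Real.log (4 * (1 + Λ * d) / (κ * (1 - M.γ))) := by
    rw [hΛ, hpar]; exact Nat.le_ceil _
  have hm : (par.m : ℝ) ≥ 4096 * (Y / (κ ^ 2 * (1 - M.γ) ^ 6)) *
      Real.log (8 * par.K * Y / δ) := by
    rw [hY, hΛ, hpar, ← mul_assoc]; exact Nat.le_ceil _
  have hΛ2 : 2 ≤ Λ := two_le_log_exact hγ0 M.γ_lt_one hκ0 hbκ hlam
  have hlogK : 0 ≤ Real.log (3 / (κ * (1 - M.γ))) := Real.log_nonneg (by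
    rw [le_div_iff₀ (by positivity)]; nlinarith)
  have hK2 : (2 : ℝ) ≤ par.K := by
    have : 0 ≤ 2 / (1 - M.γ) * Real.log (3 / (κ * (1 - M.γ))) := by positivity
    linarith
  have hK2' : 2 ≤ par.K := by exact_mod_cast hK2
  have hlogm : 0 < Real.log (8 * par.K * Y / δ) := Real.log_pos (by
    rw [lt_div_iff₀ hδ0]; nlinarith)
  have hm0 : 0 < par.m := by
    have : (0 : ℝ) < par.m := lt_of_lt_of_le (by positivity) hm
    exact_mod_cast this
  -- accuracy of the rollouts
  set θ := κ * (1 - M.γ) ^ 2 / (64 * √Y) with hθ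
  have hθ0 : 0 < θ := by positivity
  have hθsq : θ ^ 2 = κ ^ 2 * (1 - M.γ) ^ 4 / (4096 * Y) := by
    rw [hθ, div_pow, mul_pow, mul_pow, Real.sq_sqrt (by positivity)]
    ring
  have hexp : 2 * Real.log (8 * par.K * Y / δ) ≤
      2 * par.m * θ ^ 2 / (1 / (1 - M.γ)) ^ 2 := by
    have h1 : 2 * (par.m : ℝ) * θ ^ 2 / (1 / (1 - M.γ)) ^ 2 =
        2 * (par.m * (κ ^ 2 * (1 - M.γ) ^ 6 / (4096 * Y))) := by
      rw [hθsq]; field_simp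
    have h2 := mul_le_mul_of_nonneg_right hm
      (show 0 ≤ κ ^ 2 * (1 - M.γ) ^ 6 / (4096 * Y) by positivity)
    have h3 : 4096 * (Y / (κ ^ 2 * (1 - M.γ) ^ 6)) * Real.log (8 * par.K * Y / δ) *
        (κ ^ 2 * (1 - M.γ) ^ 6 / (4096 * Y)) = Real.log (8 * par.K * Y / δ) := by
      field_simp
    rw [h1]
    linarith
  set y := 1 + Λ * d with hy
  have hy3 : 3 ≤ y := by nlinarith
  have hYy : Y ≤ 2 * y := by rw [hY, hy]; nlinarith
  have hη := evalError_exact_le M.γ_lt_one hκ0 hb hlam hY1 hcY hy3 hYy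
    (truncation_exact_le hγ0 M.γ_lt_one hκ0 hκ1 (by linarith) hn)
  -- The summand `2` in `K` leaves room for the passage to `K - 1`.
  have hgap := iterationGap_exact_le (k := par.K - 1) hγ0 M.γ_lt_one hκ0 hκ1 (by
    rw [Nat.cast_sub (by omega)]; push_cast; linarith)
  refine guarantee_of_succeeds htau hlam0 hF' (length_le_coreBound hlam0 hd) hQ hC hδ0.le ?_
  refine (succeeds_confidentMCLSPI htau (by rw [hpar]; rfl) hm0 (by omega) hb.le hlam0 le_rfl hθ0
    hreal hF' (length_le_coreBound hlam0 hd) hη hgap).mono ?_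
  exact failure_le hδ0 hδ1 hY1 (by omega) hcY rfl hexp

lemma guarantee_approxParams {b ε δ maxQ maxC : ℝ} {cφ : ℕ} (hd : 0 < d)
    (hF : ∀ s a, ‖F.φ s a‖ ≤ 1) (hb : 0 < b) (hε : 0 < ε) (hreal : Realizable M F b ε)
    (hδ0 : 0 < δ) (hδ1 : δ < 1) {par : Params} (hpar : par = approxParams d M.γ b ε δ)
    (hQ : (totalQueries par.n par.m par.K (coreBound d par.lam) : ℝ) ≤ maxQ)
    (hC : (totalCost d cφ (Fintype.card A) par.n par.m par.K (coreBound d par.lam) : ℝ) ≤ maxC) :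
    Guarantee M F π₀ cφ par δ
      (74 * ε * √d / (1 - M.γ) ^ 2 * (1 + Real.log (1 + b ^ 2 * (ε ^ 2)⁻¹ * (d : ℝ)⁻¹)))
      maxQ maxC := by
  have hg := M.one_sub_γ_pos
  have hγ0 := M.γ_pos
  have hd1 : (1 : ℝ) ≤ d := by exact_mod_cast hd
  have htau : par.tau = 1 := by rw [hpar]; rfl
  have hlam : par.lam = ε ^ 2 * d / b ^ 2 := by rw [hpar]; rfl
  have hlam0 : 0 < par.lam := by rw [hlam]; positivity
  have hF' := dotProduct_features_le hF
  have hinv : b ^ 2 * (ε ^ 2)⁻¹ * (d : ℝ)⁻¹ = par.lam⁻¹ := by rw [hlam]; field_simp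
  rw [hinv]
  set c := coreBound d par.lam with hc
  set Λ := Real.log (1 + par.lam⁻¹) with hΛ
  have hΛ0 : 0 ≤ Λ := log_one_add_inv_nonneg hlam0
  set Y : ℝ := d * (1 + Λ) with hY
  have hY1 : 1 ≤ Y := one_le_mul_log hd hlam0
  have hcY : (c : ℝ) ≤ 3 * Y := coreBound_le hlam0
  have hs1 : 1 ≤ √(d : ℝ) := Real.one_le_sqrt.2 hd1
  have hK : (par.K : ℝ) ≥ 2 + 1 / (1 - M.γ) * Real.log (1 / (ε * √d)) := by
    rw [hpar]; exact Nat.le_ceil _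
  have hn : (par.n : ℝ) ≥ 1 / (1 - M.γ) * Real.log (1 / (ε * (1 - M.γ))) := by
    rw [hpar]; exact Nat.le_ceil _
  have hm : (par.m : ℝ) ≥ 1 / (ε ^ 2 * (1 - M.γ) ^ 2) * Real.log (8 * par.K * Y / δ) := by
    rw [hY, hΛ, hpar, ← mul_assoc]; exact Nat.le_ceil _
  set B := ε * √(d : ℝ) * (1 + Λ) with hB
  have hB0 : 0 < B := by positivity
  have hgapB : 74 * ε * √d / (1 - M.γ) ^ 2 * (1 + Λ) = 74 * B / (1 - M.γ) ^ 2 := by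
    rw [hB]; ring
  rw [hgapB]
  -- `K = 0` can occur only if `ε * √d ≥ 1`; then the claimed gap exceeds `1 / (1 - γ)`, the largest
  -- possible value.
  rcases Nat.eq_zero_or_pos par.K with hK0 | hK0
  · refine guarantee_of_forall_good htau hlam0 hF' (length_le_coreBound hlam0 hd) hQ hC hδ0.le
      fun πs π => ?_
    have h1 : 1 ≤ ε * √d := by
      by_contra hcon
      push Not at hcon
      have h2 : 0 ≤ Real.log (1 / (ε * √d)) := Real.log_nonneg (by
        rw [le_div_iff₀ (by positivity)]; linarith)
      have h3 : 0 ≤ 1 / (1 - M.γ) * Real.log (1 / (ε * √d)) := by positivity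
      rw [hK0] at hK
      push_cast at hK
      linarith
    have h2 : 1 ≤ B := by rw [hB]; nlinarith
    have h3 : 1 / (1 - M.γ) ≤ 74 * B / (1 - M.γ) ^ 2 := by
      rw [div_le_div_iff₀ hg (by positivity)]
      nlinarith
    linarith [(value_mem M π M.ρ).1, (value_mem M πs M.ρ).2]
  have hK1 : (1 : ℝ) ≤ par.K := by exact_mod_cast hK0
  have hlogm : 0 < Real.log (8 * par.K * Y / δ) := Real.log_pos (by
    rw [lt_div_iff₀ hδ0]; nlinarith)
  have hm0 : 0 < par.m := by
    have : (0 : ℝ) < par.m := lt_of_lt_of_le (by positivity) hm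
    exact_mod_cast this
  have hexp : 2 * Real.log (8 * par.K * Y / δ) ≤
      2 * par.m * ε ^ 2 / (1 / (1 - M.γ)) ^ 2 := by
    have h1 : 2 * (par.m : ℝ) * ε ^ 2 / (1 / (1 - M.γ)) ^ 2 =
        2 * (par.m * (ε ^ 2 * (1 - M.γ) ^ 2)) := by field_simp
    have h2 := mul_le_mul_of_nonneg_right hm (show 0 ≤ ε ^ 2 * (1 - M.γ) ^ 2 by positivity)
    have h3 : 1 / (ε ^ 2 * (1 - M.γ) ^ 2) * Real.log (8 * par.K * Y / δ) *
        (ε ^ 2 * (1 - M.γ) ^ 2) = Real.log (8 * par.K * Y / δ) := by field_simp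
    rw [h1]
    linarith
  have hη := evalError_approx_le hε hb hd1 hlam (by linarith : 1 ≤ 1 + Λ) hcY
    (truncation_approx_le hγ0 M.γ_lt_one hε hn)
  have hgap := iterationGap_approx_le (k := par.K - 1) hγ0 M.γ_lt_one
    (by positivity : 0 < ε * √(d : ℝ)) (B := B)
    (le_mul_of_one_le_right (by positivity) (by linarith)) (by
      rw [Nat.cast_sub (by omega)]; push_cast; linarith)
  refine guarantee_of_succeeds htau hlam0 hF' (length_le_coreBound hlam0 hd) hQ hC hδ0.le ?_
  refine (succeeds_confidentMCLSPI htau (by rw [hpar]; rfl) hm0 hK0 hb.le hlam0 hε.le hε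
    hreal hF' (length_le_coreBound hlam0 hd) hη hgap).mono ?_
  exact failure_le hδ0 hδ1 hY1 hK0 hcY rfl hexp

end Guarantees

end MCLSPI

end

theorem theorem1 :
    -- exact realizability
    (∃ PQ : MvPolynomial (Fin 5) ℝ, ∀ featCost : Polynomial ℕ, ∃ PC : MvPolynomial (Fin 6) ℝ,
      ∀ (S : Type*) (A : Type*) [MeasurableSpace S] [Fintype A] [LinearOrder A] [Nonempty A]
        [MeasurableSpace A] [MeasurableSingletonClass A]
        (d : ℕ) (M : MDP S A) (F : Features S A d) (π₀ : Policy S A) (b κ δ : ℝ),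
        0 < d → (∀ s a, ‖F.φ s a‖ ≤ 1) →
        0 < b → Realizable M F b 0 →
        0 < κ → κ ≤ 1 → 0 < δ → δ < 1 →
        Guarantee M F π₀ (featCost.eval d) (exactParams d M.γ b κ δ) δ κ
          (MvPolynomial.eval
            ![(d : ℝ), 1 / (1 - M.γ), 1 / κ, Real.log (1 / δ), Real.log b] PQ)
          (MvPolynomial.eval
            ![(d : ℝ), 1 / (1 - M.γ), 1 / κ, (Fintype.card A : ℝ), Real.log (1 / δ), Real.log b]
            PC)) ∧
    -- approximate realizability
    (∃ PQ : MvPolynomial (Fin 5) ℝ, ∀ featCost : Polynomial ℕ, ∃ PC : MvPolynomial (Fin 6) ℝ,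
      ∀ (S : Type*) (A : Type*) [MeasurableSpace S] [Fintype A] [LinearOrder A] [Nonempty A]
        [MeasurableSpace A] [MeasurableSingletonClass A]
        (d : ℕ) (M : MDP S A) (F : Features S A d) (π₀ : Policy S A) (b ε δ : ℝ),
        0 < d → (∀ s a, ‖F.φ s a‖ ≤ 1) →
        0 < b → 0 < ε → Realizable M F b ε →
        0 < δ → δ < 1 →
        Guarantee M F π₀ (featCost.eval d) (approxParams d M.γ b ε δ) δ
          (74 * ε * √d / (1 - M.γ) ^ 2 * (1 + Real.log (1 + b ^ 2 * (ε ^ 2)⁻¹ * (d : ℝ)⁻¹)))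
          (MvPolynomial.eval
            ![(d : ℝ), 1 / (1 - M.γ), 1 / ε, Real.log (1 / δ), Real.log b] PQ)
          (MvPolynomial.eval
            ![(d : ℝ), 1 / (1 - M.γ), 1 / ε, (Fintype.card A : ℝ), Real.log (1 / δ), Real.log b]
            PC)) := by
  constructor
  -- The index set contains only numbers (`d`, `|A|`, `γ`, `b`, `κ`, `δ`), no spaces or MDPs, so
  -- polynomials chosen over it are universal.
  · let ι := {t : (ℕ × ℕ) × ℝ × ℝ × ℝ × ℝ // 0 < t.1.1 ∧ 0 < t.2.1 ∧ t.2.1 < 1 ∧ 0 < t.2.2.1 ∧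
      0 < t.2.2.2.1 ∧ 0 < t.2.2.2.2 ∧ t.2.2.2.2 < 1}
    let d : ι → ℕ := fun t => t.1.1.1
    let nA : ι → ℕ := fun t => t.1.1.2
    let γ : ι → ℝ := fun t => t.1.2.1
    let b : ι → ℝ := fun t => t.1.2.2.1
    let κ : ι → ℝ := fun t => t.1.2.2.2.1
    let δ : ι → ℝ := fun t => t.1.2.2.2.2
    have hγ1 : ∀ i, γ i < 1 := fun i => i.2.2.2.1
    have hb : ∀ i, 0 < b i := fun i => i.2.2.2.2.1
    have hκ : ∀ i, 0 < κ i := fun i => i.2.2.2.2.2.1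
    have hδ0 : ∀ i, 0 < δ i := fun i => i.2.2.2.2.2.2.1
    have hδ1 : ∀ i, δ i < 1 := fun i => i.2.2.2.2.2.2.2
    have hg : ∀ i, 0 ≤ 1 / (1 - γ i) := fun i => (one_div_pos.2 (sub_pos.2 (hγ1 i))).le
    have hk : ∀ i, 0 ≤ 1 / κ i := fun i => (one_div_pos.2 (hκ i)).le
    have hl : ∀ i, 0 ≤ Real.log (1 / δ i) := fun i =>
      Real.log_nonneg ((one_le_div (hδ0 i)).2 (hδ1 i).le)
    let V5 : ι → Fin 5 → ℝ := fun i =>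
      ![(d i : ℝ), 1 / (1 - γ i), 1 / κ i, Real.log (1 / δ i), Real.log (b i)]
    let V6 : ι → Fin 6 → ℝ := fun i =>
      ![(d i : ℝ), 1 / (1 - γ i), 1 / κ i, (nA i : ℝ), Real.log (1 / δ i), Real.log (b i)]
    obtain ⟨pn, pm, pK, pc⟩ := polyBdd_exactParams (V := V5) hγ1 hb hκ hδ0 hδ1
      (polyBdd_var (V := V5) 0 fun i => Nat.cast_nonneg (d i)) (polyBdd_var (V := V5) 1 hg)
      (polyBdd_var (V := V5) 2 hk) (polyBdd_var (V := V5) 3 hl) (polyBdd_var_sq (V := V5) 4)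
    obtain ⟨PQ, hPQ⟩ := polyBdd_totalQueries pn pm pK pc
    refine ⟨PQ, fun featCost => ?_⟩
    have pd : PolyBdd V6 fun i => (d i : ℝ) := polyBdd_var (V := V6) 0 fun i => Nat.cast_nonneg (d i)
    -- The same bounds again in six variables, where `|A|` is available; `PQ` was already fixed,
    -- independently of `featCost`.
    obtain ⟨pn, pm, pK, pc⟩ := polyBdd_exactParams (V := V6) hγ1 hb hκ hδ0 hδ1
      pd (polyBdd_var (V := V6) 1 hg)
      (polyBdd_var (V := V6) 2 hk) (polyBdd_var (V := V6) 4 hl) (polyBdd_var_sq (V := V6) 5)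
    obtain ⟨PC, hPC⟩ := polyBdd_totalCost pd (polyBdd_natPolynomial pd featCost)
      (polyBdd_var (V := V6) 3 fun i => Nat.cast_nonneg (nA i) : PolyBdd V6 fun i => (nA i : ℝ))
      pn pm pK pc
    refine ⟨PC, fun S A _ _ _ _ _ _ d M F π₀ b κ δ hd hF hb hreal hκ0 hκ1 hδ0 hδ1 => ?_⟩
    let i : ι := ⟨((d, Fintype.card A), M.γ, b, κ, δ), hd, M.γ_pos, M.γ_lt_one, hb, hκ0, hδ0, hδ1⟩
    exact guarantee_exactParams hd hF hb hreal hκ0 hκ1 hδ0 hδ1 rfl (hPQ i).2 (hPC i).2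
  · let ι := {t : (ℕ × ℕ) × ℝ × ℝ × ℝ × ℝ // 0 < t.1.1 ∧ 0 < t.2.1 ∧ t.2.1 < 1 ∧ 0 < t.2.2.1 ∧
      0 < t.2.2.2.1 ∧ 0 < t.2.2.2.2 ∧ t.2.2.2.2 < 1}
    let d : ι → ℕ := fun t => t.1.1.1
    let nA : ι → ℕ := fun t => t.1.1.2
    let γ : ι → ℝ := fun t => t.1.2.1
    let b : ι → ℝ := fun t => t.1.2.2.1
    let ε : ι → ℝ := fun t => t.1.2.2.2.1
    let δ : ι → ℝ := fun t => t.1.2.2.2.2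
    have hd : ∀ i, 0 < d i := fun i => i.2.1
    have hγ1 : ∀ i, γ i < 1 := fun i => i.2.2.2.1
    have hb : ∀ i, 0 < b i := fun i => i.2.2.2.2.1
    have hε : ∀ i, 0 < ε i := fun i => i.2.2.2.2.2.1
    have hδ0 : ∀ i, 0 < δ i := fun i => i.2.2.2.2.2.2.1
    have hδ1 : ∀ i, δ i < 1 := fun i => i.2.2.2.2.2.2.2
    have hg : ∀ i, 0 ≤ 1 / (1 - γ i) := fun i => (one_div_pos.2 (sub_pos.2 (hγ1 i))).le
    have hk : ∀ i, 0 ≤ 1 / ε i := fun i => (one_div_pos.2 (hε i)).le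
    have hl : ∀ i, 0 ≤ Real.log (1 / δ i) := fun i =>
      Real.log_nonneg ((one_le_div (hδ0 i)).2 (hδ1 i).le)
    let V5 : ι → Fin 5 → ℝ := fun i =>
      ![(d i : ℝ), 1 / (1 - γ i), 1 / ε i, Real.log (1 / δ i), Real.log (b i)]
    let V6 : ι → Fin 6 → ℝ := fun i =>
      ![(d i : ℝ), 1 / (1 - γ i), 1 / ε i, (nA i : ℝ), Real.log (1 / δ i), Real.log (b i)]
    obtain ⟨pn, pm, pK, pc⟩ := polyBdd_approxParams (V := V5) hd hγ1 hb hε hδ0 hδ1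
      (polyBdd_var (V := V5) 0 fun i => Nat.cast_nonneg (d i)) (polyBdd_var (V := V5) 1 hg)
      (polyBdd_var (V := V5) 2 hk) (polyBdd_var (V := V5) 3 hl) (polyBdd_var_sq (V := V5) 4)
    obtain ⟨PQ, hPQ⟩ := polyBdd_totalQueries pn pm pK pc
    refine ⟨PQ, fun featCost => ?_⟩
    have pd : PolyBdd V6 fun i => (d i : ℝ) := polyBdd_var (V := V6) 0 fun i => Nat.cast_nonneg (d i)
    obtain ⟨pn, pm, pK, pc⟩ := polyBdd_approxParams (V := V6) hd hγ1 hb hε hδ0 hδ1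
      pd (polyBdd_var (V := V6) 1 hg)
      (polyBdd_var (V := V6) 2 hk) (polyBdd_var (V := V6) 4 hl) (polyBdd_var_sq (V := V6) 5)
    obtain ⟨PC, hPC⟩ := polyBdd_totalCost pd (polyBdd_natPolynomial pd featCost)
      (polyBdd_var (V := V6) 3 fun i => Nat.cast_nonneg (nA i) : PolyBdd V6 fun i => (nA i : ℝ))
      pn pm pK pc
    refine ⟨PC, fun S A _ _ _ _ _ _ d M F π₀ b ε δ hd hF hb hε hreal hδ0 hδ1 => ?_⟩
    let i : ι := ⟨((d, Fintype.card A), M.γ, b, ε, δ), hd, M.γ_pos, M.γ_lt_one, hb, hε, hδ0, hδ1⟩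
    exact guarantee_approxParams hd hF hb hε hreal hδ0 hδ1 rfl (hPQ i).2 (hPC i).2
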